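/- Let $\mathcal T$ be the topological $N=2$ superconformal algebra over $\mathbb C$: the Lie superalgebra with even basis elements $\mathcal L_n,\mathcal H_n$ ($n\in\mathbb Z$), central even $C$, odd basis elements $\mathcal G_n,\mathcal Q_n$ ($n\in\mathbb Z$), and $[\mathcal L_m,\mathcal L_n]=(m-n)\mathcal L_{m+n}$, $[\mathcal H_m,\mathcal H_n]=\frac C3 m\,\delta_{m+n,0}$, $[\mathcal L_m,\mathcal G_n]=(m-n)\mathcal G_{m+n}$, $[\mathcal H_m,\mathcal G_n]=\mathcal G_{m+n}$, $[\mathcal L_m,\mathcal Q_n]=-n\mathcal Q_{m+n}$, $[\mathcal H_m,\mathcal Q_n]=-\mathcal Q_{m+n}$, $[\mathcal L_m,\mathcal H_n]=-n\mathcal H_{m+n}+\frac C6(m^2+m)\delta_{m+n,0}$, $\{\mathcal G_m,\mathcal Q_n\}=2\mathcal L_{m+n}-2n\mathcal H_{m+n}+\frac C3(m^2+m)\delta_{m+n,0}$, $\{\mathcal G_m,\mathcal G_n\}=\{\mathcal Q_m,\mathcal Q_n\}=0$. Let $U$ be its universal enveloping algebra, $U^+\subset U$ the span of all $Y$ with $[\mathcal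 L_0,Y]=lY$ for some integer $l<0$, and for $c,q\in\mathbb C$ let $\mathcal V^{GQ}_{0,q}$ be the chiral Verma module: the $U$-module generated by a vector $|0,q\rangle^{GQ}$ subject to $\mathcal L_0=0$, $\mathcal H_0=q$, $C=c$, and annihilation by $\mathcal L_n,\mathcal H_n,\mathcal G_n,\mathcal Q_n$ ($n>0$), $\mathcal G_0$ and $\mathcal Q_0$. For $m\in\mathbb N_0$, $n\in\mathbb Z$ let $\mathcal C^{GQ}_{m,n}$ be the set of terms $$X=L\,H\,G\,Q\;\mathcal L_{-1}^{k}\mathcal G_{-1}^{r_1}\mathcal Q_{-1}^{r_2},\qquad k\ge 0,\ r_1,r_2\in\{0,1\},$$ where $L=\mathcal L_{-l_a}\cdots\mathcal L_{-l_1}$ ($l_a\ge\dots\ge l_1\ge2$), $H=\mathcal H_{-h_b}\cdots\mathcal H_{-h_1}$ ($h_b\ge\dots\ge h_1\ge1$), $G=\mathcal G_{-g_d}\cdots\mathcal G_{-g_1}$ ($g_d>\dots>g_1\ge2$), $Q=\mathcal Q_{-q_e}\cdots\mathcal Q_{-q_1}$ ($q_e>\dots>q_1\ge2$), each possibly $1$,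 with level $\sum l_i+\sum h_i+\sum g_i+\sum q_i+k+r_1+r_2=m$ and charge $d-e+r_1-r_2=n$. Words of one type are compared from right to left: at the first position where the indices $j$ of the factors $Z_{-j}$ differ, the word with the smaller $j$ is smaller; if no position common to both words differs, the longer word is smaller. The ordering $\prec_G$ on $\mathcal C^{GQ}_{m,n}$ is reflexive, and for $X_1\ne X_2$ one sets $X_1\prec_G X_2$ if $k^1>k^2$; if $k^1=k^2$, if $r^1_1+r^1_2>r^2_1+r^2_2$; in case of equality, if $Q^1$ is smaller than $Q^2$; if $Q^1=Q^2$, if $G^1$ is smaller than $G^2$; if also $G^1=G^2$, if $L^1$ is smaller than $L^2$; and if also $L^1=L^2$, if $H^1$ is smaller than $H^2$. For a set $\mathcal K\subset U$ of annihilation operators, a total ordering $\prec$ on $\mathcal C^{GQ}_{m,n}$, with a global minimum if this set is non-empty, is called adapted to $\mathcal C^A\subset\mathcal C^{GQ}_{m,n}$ in $\mathcal V^{GQ}_{0,q}$, with ordering kernel $\mathcal C^{GQ}_{m,n}\setminus\mathcal C^A$, if for each $X_0\in\mathcal C^A$ there are $\Gamma\in\mathcal K$, a basis $\mathcal B$ of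 $\mathcal V^{GQ}_{0,q}$ and $\tilde X\in\mathcal B$ such that the $\tilde X$-coefficient (with respect to $\mathcal B$) of $\Gamma X_0|0,q\rangle^{GQ}$ is non-zero, while that of $\Gamma Y|0,q\rangle^{GQ}$ is zero for all $Y\in\mathcal C^{GQ}_{m,n}$ with $X_0\prec Y$ and $Y\neq X_0$. **Theorem.** Let $c\in\mathbb C$ with $c\ne3$, $q\in\mathbb C$, $m\in\mathbb N_0$ and $n\in\mathbb Z$. Then $\prec_G$ is adapted on $\mathcal C^{GQ}_{m,n}$ in $\mathcal V^{GQ}_{0,q}$ with the following ordering kernels. 1. For $\mathcal K=U^+\oplus\mathbb C\,\mathcal G_0$: $\{\mathcal L_{-1}^{m-1}\mathcal G_{-1}\}$ if $n=1$, $\{\mathcal L_{-1}^{m}\}$ if $n=0$, and $\emptyset$ for all other $n$. 2. For $\mathcal K=U^+\oplus\mathbb C\,\mathcal Q_0$: $\{\mathcal L_{-1}^{m}\}$ if $n=0$, $\{\mathcal L_{-1}^{m-1}\mathcal Q_{-1}\}$ if $n=-1$, and $\emptyset$ for all other $n$. For $m=0$ the terms containing $\mathcal L_{-1}^{m-1}$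 do not exist and the corresponding kernels are empty. -/

import Mathlib

namespace TopN2

/-- Basis of the topological `N = 2` superconformal algebra: the even elements `L n`, `H n` and the
central element `C`, and the odd elements `G n`, `Q n`, for integers `n`. -/
inductive Gen : Type
  | L (n : ℤ)
  | H (n : ℤ)
  | G (n : ℤ)
  | Q (n : ℤ)
  | C

/-- The generator `g` in the free associative algebra. -/
noncomputable abbrev fr (g : Gen) : FreeAlgebra ℂ Gen := FreeAlgebra.ι ℂ g

/-- The commutator in the free algebra. -/
noncomputable abbrev comm (x y : FreeAlgebra ℂ Gen) : FreeAlgebra ℂ Gen := x * y - y * x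

/-- The anticommutator in the free algebra. -/
noncomputable abbrev acomm (x y : FreeAlgebra ℂ Gen) : FreeAlgebra ℂ Gen := x * y + y * x

/-- The (anti-)commutation relations of the topological `N = 2` superconformal algebra. -/
inductive Rel : FreeAlgebra ℂ Gen → FreeAlgebra ℂ Gen → Prop
  | LL (m n : ℤ) : Rel (comm (fr (.L m)) (fr (.L n))) (((m : ℂ) - n) • fr (.L (m + n)))
  | HH (m n : ℤ) : Rel (comm (fr (.H m)) (fr (.H n)))
      (if m + n = 0 then ((m : ℂ) / 3) • fr .C else 0)
  | LG (m n : ℤ) : Rel (comm (fr (.L m)) (fr (.G n))) (((m : ℂ) - n) • fr (.G (m + n)))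
  | HG (m n : ℤ) : Rel (comm (fr (.H m)) (fr (.G n))) (fr (.G (m + n)))
  | LQ (m n : ℤ) : Rel (comm (fr (.L m)) (fr (.Q n))) ((-(n : ℂ)) • fr (.Q (m + n)))
  | HQ (m n : ℤ) : Rel (comm (fr (.H m)) (fr (.Q n))) (-fr (.Q (m + n)))
  | LH (m n : ℤ) : Rel (comm (fr (.L m)) (fr (.H n)))
      ((-(n : ℂ)) • fr (.H (m + n)) +
        if m + n = 0 then (((m : ℂ) ^ 2 + m) / 6) • fr .C else 0)
  | GQ (m n : ℤ) : Rel (acomm (fr (.G m)) (fr (.Q n)))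
      ((2 : ℂ) • fr (.L (m + n)) - (2 * (n : ℂ)) • fr (.H (m + n)) +
        if m + n = 0 then (((m : ℂ) ^ 2 + m) / 3) • fr .C else 0)
  | GG (m n : ℤ) : Rel (acomm (fr (.G m)) (fr (.G n))) 0
  | QQ (m n : ℤ) : Rel (acomm (fr (.Q m)) (fr (.Q n))) 0
  | central (g : Gen) : Rel (comm (fr .C) (fr g)) 0

/-- The universal enveloping algebra of the topological `N = 2` superconformal algebra. -/
abbrev U : Type := RingQuot Rel

/-- The image of a generator in the universal enveloping algebra. -/
noncomputable def gen (g : Gen) : U := RingQuot.mkAlgHom ℂ Rel (fr g)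

/-- The left ideal of `U` generated by the chiral highest weight conditions: `L 0 = 0`, `H 0 = q`,
`C = c`, all generators of positive index, `G 0` and `Q 0` act by zero. -/
noncomputable def chiralIdeal (c q : ℂ) : Submodule U U :=
  Submodule.span U
    ({gen (.L 0), gen (.H 0) - algebraMap ℂ U q, gen .C - algebraMap ℂ U c,
        gen (.G 0), gen (.Q 0)} ∪
      {x | ∃ n : ℤ, 0 < n ∧
        (x = gen (.L n) ∨ x = gen (.H n) ∨ x = gen (.G n) ∨ x = gen (.Q n))})

/-- The chiral Verma module, i.e. the left `U`-module induced from the one-dimensional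
representation spanned by the chiral highest weight vector, as the quotient of `U` by the left ideal
of the highest weight conditions. -/
abbrev ChiralVerma (c q : ℂ) : Type := U ⧸ chiralIdeal c q

/-- The chiral highest weight vector. -/
noncomputable def ket (c q : ℂ) : ChiralVerma c q := (chiralIdeal c q).mkQ 1

/-- The data of a product
`L_{-l_a} ⋯ L_{-l_1} H_{-h_b} ⋯ H_{-h_1} G_{-g_d} ⋯ G_{-g_1} Q_{-q_e} ⋯ Q_{-q_1}
  L_{-1}^k G_{-1}^{r1} Q_{-1}^{r2} Q_0^{r3}`.
The four lists are read from right to left: `L = [l_1, …, l_a]`, and so on. -/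
structure BasisTerm : Type where
  L : List ℕ
  H : List ℕ
  G : List ℕ
  Q : List ℕ
  k : ℕ
  r1 : ℕ
  r2 : ℕ
  r3 : ℕ

/-- For `w = [m_1, …, m_I]`, the product `Z_{-m_I} ⋯ Z_{-m_1}` in `U`. -/
noncomputable def word (Z : ℤ → Gen) (w : List ℕ) : U :=
  (w.reverse.map fun j => gen (Z (-(j : ℤ)))).prod

/-- The element of `U` given by a term. -/
noncomputable def BasisTerm.op (X : BasisTerm) : U :=
  word .L X.L * word .H X.H * word .G X.G * word .Q X.Q *
    gen (.L (-1)) ^ X.k * gen (.G (-1)) ^ X.r1 * gen (.Q (-1)) ^ X.r2 * gen (.Q 0) ^ X.r3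

/-- The set `C^G_{m,n}` of terms of level `m` and charge `n`. -/
def CG (m : ℕ) (n : ℤ) : Set BasisTerm :=
  {X | (X.L.Pairwise (· ≤ ·) ∧ ∀ j ∈ X.L, 2 ≤ j) ∧
    (X.H.Pairwise (· ≤ ·) ∧ ∀ j ∈ X.H, 1 ≤ j) ∧
    (X.G.Pairwise (· < ·) ∧ ∀ j ∈ X.G, 2 ≤ j) ∧
    (X.Q.Pairwise (· < ·) ∧ ∀ j ∈ X.Q, 2 ≤ j) ∧
    X.r1 ≤ 1 ∧ X.r2 ≤ 1 ∧ X.r3 ≤ 1 ∧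
    X.L.sum + X.H.sum + X.G.sum + X.Q.sum + X.k + X.r1 + X.r2 = m ∧
    (X.G.length : ℤ) - X.Q.length + X.r1 - X.r2 - X.r3 = n}

/-- The set `C^{GQ}_{m,n}` of standard basis terms of the chiral Verma modules: no `Q_0`. -/
def CGQ (m : ℕ) (n : ℤ) : Set BasisTerm := {X ∈ CG m n | X.r3 = 0}

/-- The strict ordering of words of one type (`L`, `H`, `G` or `Q`). The words are compared from
right to left; at the first disagreement the word with the smaller index is the smaller one, and if
there is no disagreement then the longer word is the smaller one. -/
def wordLT : List ℕ → List ℕ → Prop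
  | [], _ => False
  | _ :: _, [] => True
  | a :: as, b :: bs => a < b ∨ (a = b ∧ wordLT as bs)

/-- The strict part of the ordering `≺_G`. -/
def ltG (X Y : BasisTerm) : Prop :=
  Y.k < X.k ∨ (X.k = Y.k ∧
    (Y.r1 + Y.r2 < X.r1 + X.r2 ∨ (X.r1 + X.r2 = Y.r1 + Y.r2 ∧
      (wordLT X.Q Y.Q ∨ (X.Q = Y.Q ∧
        (wordLT X.G Y.G ∨ (X.G = Y.G ∧
          (wordLT X.L Y.L ∨ (X.L = Y.L ∧ wordLT X.H Y.H)))))))))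

/-- The ordering `≺_G`. -/
def precG (X Y : BasisTerm) : Prop := X = Y ∨ ltG X Y

/-- The part of `U` spanned by the elements `Y` with `[L_0, Y] = l Y` for some negative `l`
(the positive operators have negative level). -/
noncomputable def posU : Submodule ℂ U :=
  Submodule.span ℂ
    {Y | ∃ l : ℤ, l < 0 ∧ gen (.L 0) * Y - Y * gen (.L 0) = (l : ℂ) • Y}

/-- The annihilation operators given by the positive operators and `G_0`. -/
noncomputable def annG : Submodule ℂ U := posU ⊔ Submodule.span ℂ {gen (.G 0)}

/-- The annihilation operators given by the positive operators and `Q_0`. -/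
noncomputable def annQ : Submodule ℂ U := posU ⊔ Submodule.span ℂ {gen (.Q 0)}

/-- `prec` is a total ordering on `C` with a global minimum (if `C` is nonempty), adapted to the
subset `A` of `C` in the module `M` with vector `v` and annihilation operators `K`. Here `op X` is
the operator denoted by the term `X`. The basis `B` of `M` may depend on `X₀`. -/
structure IsAdapted {R M τ : Type} [Ring R] [AddCommGroup M] [Module R M] [Module ℂ M]
    (K : Set R) (op : τ → R) (v : M) (prec : τ → τ → Prop) (C A : Set τ) : Prop where
  refl : ∀ X ∈ C, prec X X
  antisymm : ∀ X ∈ C, ∀ Y ∈ C, prec X Y → prec Y X → X = Y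
  trans : ∀ X ∈ C, ∀ Y ∈ C, ∀ Z ∈ C, prec X Y → prec Y Z → prec X Z
  total : ∀ X ∈ C, ∀ Y ∈ C, prec X Y ∨ prec Y X
  exists_min : C.Nonempty → ∃ X ∈ C, ∀ Y ∈ C, prec X Y
  subset : A ⊆ C
  adapted : ∀ X₀ ∈ A, ∃ Γ ∈ K, ∃ (ι : Type) (B : Module.Basis ι ℂ M) (i : ι),
    B.repr (Γ • (op X₀ • v)) i ≠ 0 ∧
      ∀ Y ∈ C, prec X₀ Y → Y ≠ X₀ → B.repr (Γ • (op Y • v)) i = 0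

/-- `prec` is adapted on `C` with ordering kernel `N`: it is adapted to a subset of `C` whose
complement in `C` is `N`. -/
def IsOrderingKernel {R M τ : Type} [Ring R] [AddCommGroup M] [Module R M] [Module ℂ M]
    (K : Set R) (op : τ → R) (v : M) (prec : τ → τ → Prop) (C N : Set τ) : Prop :=
  ∃ A : Set τ, IsAdapted K op v prec C A ∧ C \ A = N

/-- The term `L_{-1}^k G_{-1}^{r1} Q_{-1}^{r2}`. -/
def lowTerm (k r1 r2 : ℕ) : BasisTerm := ⟨[], [], [], [], k, r1, r2, 0⟩

/-- `{L_{-1}^{m-1} G_{-1}}` for `n = 1` (empty if `m = 0`), `{L_{-1}^m}` for `n = 0`, and empty for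
all other charges `n`. -/
def kernelG (m : ℕ) (n : ℤ) : Set BasisTerm :=
  {X | (n = 1 ∧ 1 ≤ m ∧ X = lowTerm (m - 1) 1 0) ∨ (n = 0 ∧ X = lowTerm m 0 0)}

/-- `{L_{-1}^m}` for `n = 0`, `{L_{-1}^{m-1} Q_{-1}}` for `n = -1` (empty if `m = 0`), and empty for
all other charges `n`. -/
def kernelQ (m : ℕ) (n : ℤ) : Set BasisTerm :=
  {X | (n = 0 ∧ X = lowTerm m 0 0) ∨ (n = -1 ∧ 1 ≤ m ∧ X = lowTerm (m - 1) 0 1)}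

end TopN2

/-! Write v for the highest weight vector. The basis in the definition may depend on the term, so a
coordinate function is nothing but a linear functional that takes the value 1 somewhere
(`exists_basis_repr`). Hence one functional φ suffices, provided that for each X₀ outside the kernel
some Γ in K satisfies φ(ΓXv) = δ_{X,X₀} for all X outside the kernel; the kernel terms are minimal
for ≺_G and never come after X₀. By finite-dimensional duality such Γ exist unless a nontrivial
combination x of these vectors Xv satisfies φ(Γx) = 0 for all Γ in K.

The functional φ is built from a Whittaker functional f with values in ℂ[X]: f(v) = 1, L_{-1}
becomes multiplication by X, and all other negative generators become zero (`exists_whittaker`). It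
exists because brackets of negative generators never involve L_{-1}. On a weight vector f is a
monomial, and it vanishes on nonzero relative charge. Let A be the zero mode in K (G_0 or Q_0) and B
the other one. Then φ(y) = f(y)(1) + f(By)(1) detects both f(y) and f(By) on a weight vector. It
vanishes on Xv unless X is L_{-1}^m or L_{-1}^{m-1}D, where D is the letter G_{-1} or Q_{-1} whose
bracket with B contains L_{-1}; this is where the kernels come from. Since AB = 2L_0 - BA and A² =
B² = 0, vanishing of φ on x and on Kx forces f(Ux) = 0 (`map_smul_eq_zero`).

It remains to see that for c ≠ 3 the vectors Xv are independent modulo the radical of f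
(`coeff_eq_zero_of_mem_radical`). Filter by the power of L_{-1} standing to the right of a word in
the other negative generators, the letters. A generator raises this power by at most one, by
contracting a letter to L_{-1} (`nonneg_smul_vec`). The letters L_n, G_n, Q_n are contracted by
L_{-1-n}, Q_{-1-n}, G_{-1-n}. No generator contracts H_n, since [·, H_n] contains no L; the
substitute is T_s = Σ_a (2L_a H_{s-a} - G_a Q_{s-a}). Quadratic operators could raise the power by
two, but modulo those raising it by one the families T, GH, QH, HH are closed under commutation with
letters, so T_s raises it by one only (`quad_smul_vec`). On words in the H_n it removes H_{-s-1}
with coefficient 2(s+1)(c/3 - 1), which is where c ≠ 3 enters (`quad_famT_smul_vec_H`). Induction on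
the word length (`Nondeg.succ`) contracts everything down to L_{-1}^k v, which f detects. -/

namespace TopN2

set_option linter.unusedSectionVars false

/-! ### Generators, gradings and the superbracket. -/

/-- The index (minus the level) of a generator. -/
def Gen.idx : Gen → ℤ
  | .L n => n
  | .H n => n
  | .G n => n
  | .Q n => n
  | .C => 0

/-- The charge of a generator. -/
def Gen.chg : Gen → ℤ
  | .G _ => 1
  | .Q _ => -1
  | _ => 0

/-- Whether a generator is odd. -/
def Gen.odd : Gen → Bool
  | .G _ => true
  | .Q _ => true
  | _ => false

/-- The sign in the supercommutator of two generators. -/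
def sgn (x y : Gen) : ℂ := if x.odd && y.odd then -1 else 1

/-- The value of the superbracket `[x, y]` under a linear map with values `Φ` on generators. -/
noncomputable def brv {M : Type*} [AddCommGroup M] [Module ℂ M] (Φ : Gen → M) : Gen → Gen → M
  | .L m, .L n => ((m : ℂ) - n) • Φ (.L (m + n))
  | .L m, .H n => (-(n : ℂ)) • Φ (.H (m + n)) +
      (if m + n = 0 then ((m : ℂ) ^ 2 + m) / 6 else 0) • Φ .C
  | .H m, .L n => (m : ℂ) • Φ (.H (m + n)) -
      (if m + n = 0 then ((n : ℂ) ^ 2 + n) / 6 else 0) • Φ .C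
  | .H m, .H n => (if m + n = 0 then (m : ℂ) / 3 else 0) • Φ .C
  | .L m, .G n => ((m : ℂ) - n) • Φ (.G (m + n))
  | .G m, .L n => ((m : ℂ) - n) • Φ (.G (m + n))
  | .L m, .Q n => (-(n : ℂ)) • Φ (.Q (m + n))
  | .Q m, .L n => (m : ℂ) • Φ (.Q (m + n))
  | .H m, .G n => Φ (.G (m + n))
  | .G m, .H n => -Φ (.G (m + n))
  | .H m, .Q n => -Φ (.Q (m + n))
  | .Q m, .H n => Φ (.Q (m + n))
  | .G m, .Q n => (2 : ℂ) • Φ (.L (m + n)) - (2 * (n : ℂ)) • Φ (.H (m + n)) +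
      (if m + n = 0 then ((m : ℂ) ^ 2 + m) / 3 else 0) • Φ .C
  | .Q m, .G n => (2 : ℂ) • Φ (.L (m + n)) - (2 * (m : ℂ)) • Φ (.H (m + n)) +
      (if m + n = 0 then ((n : ℂ) ^ 2 + n) / 3 else 0) • Φ .C
  | .G _, .G _ => 0
  | .Q _, .Q _ => 0
  | .C, _ => 0
  | .L _, .C => 0
  | .H _, .C => 0
  | .G _, .C => 0
  | .Q _, .C => 0

section
variable {M N : Type*} [AddCommGroup M] [Module ℂ M] [AddCommGroup N] [Module ℂ N]

theorem map_brv (T : M →ₗ[ℂ] N) (Φ : Gen → M) (x y : Gen) :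
    T (brv Φ x y) = brv (fun g => T (Φ g)) x y := by
  cases x <;> cases y <;>
    simp only [brv, map_add, map_sub, map_neg, map_zero, LinearMap.map_smul]

theorem brv_add (Φ Ψ : Gen → M) (x y : Gen) :
    brv (fun g => Φ g + Ψ g) x y = brv Φ x y + brv Ψ x y := by
  cases x <;> cases y <;> simp only [brv] <;> module

theorem brv_sub (Φ Ψ : Gen → M) (x y : Gen) :
    brv (fun g => Φ g - Ψ g) x y = brv Φ x y - brv Ψ x y := by
  cases x <;> cases y <;> simp only [brv] <;> module

theorem brv_smul (a : ℂ) (Φ : Gen → M) (x y : Gen) :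
    brv (fun g => a • Φ g) x y = a • brv Φ x y := by
  cases x <;> cases y <;> simp only [brv] <;> module

/-- The bracket is homogeneous for index and charge, and C only occurs when the indices cancel. Most
later case distinctions on brackets thereby reduce to an inequality between indices. -/
theorem brv_mem {S : Submodule ℂ M} {Φ : Gen → M} {x y : Gen}
    (h : ∀ g : Gen, g.idx = x.idx + y.idx → g.chg = x.chg + y.chg → Φ g ∈ S) :
    brv Φ x y ∈ S := by
  have hite : ∀ (p : Prop) [Decidable p] (a : ℂ) (m : M), (p → m ∈ S) →
      (if p then a else 0) • m ∈ S := by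
    intro p _ a m hm
    split_ifs with hp
    · exact S.smul_mem _ (hm hp)
    · simp
  cases x <;> cases y <;> simp only [brv, Gen.idx, Gen.chg] at h ⊢ <;>
    first
    | exact S.zero_mem
    | exact S.smul_mem _ (h _ rfl rfl)
    | exact h _ rfl rfl
    | exact S.neg_mem (h _ rfl rfl)
    | exact hite _ _ _ fun h0 => h .C h0.symm rfl
    | exact S.add_mem (S.smul_mem _ (h _ rfl rfl)) (hite _ _ _ fun h0 => h .C h0.symm rfl)
    | exact S.sub_mem (S.smul_mem _ (h _ rfl rfl)) (hite _ _ _ fun h0 => h .C h0.symm rfl)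
    | exact S.add_mem (S.sub_mem (S.smul_mem _ (h _ rfl rfl)) (S.smul_mem _ (h _ rfl rfl)))
        (hite _ _ _ fun h0 => h .C h0.symm rfl)

theorem brv_congr {Φ Ψ : Gen → M} {x y : Gen}
    (h : ∀ g : Gen, g.idx = x.idx + y.idx → g.chg = x.chg + y.chg → Φ g = Ψ g) :
    brv Φ x y = brv Ψ x y := by
  rw [← sub_eq_zero, ← brv_sub, ← Submodule.mem_bot ℂ]
  exact brv_mem fun g h1 h2 => by simp [h g h1 h2]

theorem sgn_comm (x y : Gen) : sgn x y = sgn y x := by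
  simp [sgn, Bool.and_comm]

theorem sgn_mul_self (x y : Gen) : sgn x y * sgn x y = 1 := by
  unfold sgn; split_ifs <;> simp

theorem brv_skew (Φ : Gen → M) (x y : Gen) : brv Φ x y = -(sgn x y • brv Φ y x) := by
  rcases x with a | a | a | a | _ <;> rcases y with b | b | b | b | _ <;>
    try simp only [brv, sgn, Gen.odd, Bool.and_true, Bool.and_false, Bool.and_self,
      Bool.false_eq_true, if_true, if_false, add_comm b a]
  all_goals try simp only [brv, smul_zero, neg_zero]
  all_goals try module
  by_cases h : a + b = 0
  · obtain rfl : b = -a := by lia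
    simp only [add_neg_cancel, if_true]
    push_cast
    module
  · simp [h]

set_option maxHeartbeats 4000000 in
theorem brv_jacobi (Φ : Gen → M) (x y z : Gen) :
    brv (fun g => brv Φ x g) y z =
      brv (fun g => brv Φ g z) x y + sgn x y • brv (fun g => brv Φ y g) x z := by
  rcases x with a | a | a | a | _ <;> rcases y with b | b | b | b | _ <;>
    rcases z with c | c | c | c | _ <;>
    try simp only [brv, sgn, Gen.odd, Bool.and_true, Bool.and_false, Bool.and_self,
      Bool.false_eq_true, if_true, if_false, add_assoc, add_left_comm b a c, smul_zero,
      neg_zero, add_zero, zero_add, sub_zero, smul_neg, Int.cast_add]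
  all_goals try simp only [brv, smul_zero, neg_zero, add_zero, sub_zero]
  all_goals try module
  all_goals
    -- What is left are the cases with central terms. These are present only if the three indices
    -- sum to zero, and then the cocycle identity is polynomial in a and b.
    by_cases h : a + (b + c) = 0
    · obtain rfl : c = -a - b := by lia
      simp only [h, if_true]
      push_cast
      module
    · simp only [h, if_false]
      module
end

theorem brv_sgn {M : Type*} [AddCommGroup M] [Module ℂ M] (Φ : Gen → M) (x y z : Gen) :
    brv (fun g => sgn g z • Φ g) x y = (sgn x z * sgn y z) • brv Φ x y := by
  rcases x with a | a | a | a | _ <;> rcases y with b | b | b | b | _ <;>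
    rcases z with c | c | c | c | _ <;>
    simp [brv, sgn, Gen.odd]

/-- The defining relations of the enveloping algebra, in terms of superbrackets. -/
theorem gen_mul (x y : Gen) : gen x * gen y = sgn x y • (gen y * gen x) + brv gen x y := by
  have key : ∀ {a b : FreeAlgebra ℂ Gen}, Rel a b →
      RingQuot.mkAlgHom ℂ Rel a = RingQuot.mkAlgHom ℂ Rel b :=
    fun h => RingQuot.mkAlgHom_rel ℂ h
  have hC : ∀ g, gen .C * gen g = gen g * gen .C := by
    intro g
    have := key (Rel.central g)
    simpa [gen, sub_eq_zero] using this
  have h1 : ∀ m n, gen (.L m) * gen (.H n) = gen (.H n) * gen (.L m) +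
      brv gen (.L m) (.H n) := by
    intro m n
    have := key (Rel.LH m n)
    simp only [map_sub, map_mul, map_add, map_smul, sub_eq_iff_eq_add'] at this
    simp only [brv, gen, this]
    split_ifs <;> simp only [map_smul, map_zero, zero_smul]
  have h2 : ∀ m n, gen (.G m) * gen (.Q n) = -(gen (.Q n) * gen (.G m)) +
      brv gen (.G m) (.Q n) := by
    intro m n
    have := key (Rel.GQ m n)
    simp only [map_sub, map_mul, map_add, map_smul] at this
    simp only [brv, gen]
    rw [← sub_eq_iff_eq_add', sub_neg_eq_add, this]
    split_ifs <;> simp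
  have h3 : ∀ m n, gen (.L m) * gen (.G n) = gen (.G n) * gen (.L m) +
      brv gen (.L m) (.G n) := by
    intro m n
    have := key (Rel.LG m n)
    simp only [map_sub, map_mul, map_smul, sub_eq_iff_eq_add'] at this
    simp only [brv, gen, this]
  have h4 : ∀ m n, gen (.L m) * gen (.Q n) = gen (.Q n) * gen (.L m) +
      brv gen (.L m) (.Q n) := by
    intro m n
    have := key (Rel.LQ m n)
    simp only [map_sub, map_mul, map_smul, sub_eq_iff_eq_add'] at this
    simp only [brv, gen, this]
  have h5 : ∀ m n, gen (.H m) * gen (.G n) = gen (.G n) * gen (.H m) +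
      brv gen (.H m) (.G n) := by
    intro m n
    have := key (Rel.HG m n)
    simp only [map_sub, map_mul, sub_eq_iff_eq_add'] at this
    simp only [brv, gen, this]
  have h6 : ∀ m n, gen (.H m) * gen (.Q n) = gen (.Q n) * gen (.H m) +
      brv gen (.H m) (.Q n) := by
    intro m n
    have := key (Rel.HQ m n)
    simp only [map_sub, map_mul, map_neg, sub_eq_iff_eq_add'] at this
    simp only [brv, gen, this]
  have h7 : ∀ m n, gen (.H m) * gen (.H n) = gen (.H n) * gen (.H m) +
      brv gen (.H m) (.H n) := by
    intro m n
    have := key (Rel.HH m n)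
    simp only [map_sub, map_mul, sub_eq_iff_eq_add'] at this
    simp only [brv, gen, this]
    split_ifs <;> simp
  have h8 : ∀ m n, gen (.L m) * gen (.L n) = gen (.L n) * gen (.L m) +
      brv gen (.L m) (.L n) := by
    intro m n
    have := key (Rel.LL m n)
    simp only [map_sub, map_mul, map_smul, sub_eq_iff_eq_add'] at this
    simp only [brv, gen, this]
  have h9 : ∀ m n, gen (.G m) * gen (.G n) = -(gen (.G n) * gen (.G m)) := by
    intro m n
    have := key (Rel.GG m n)
    simp only [map_mul, map_add, map_zero] at this
    exact eq_neg_of_add_eq_zero_left this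
  have h10 : ∀ m n, gen (.Q m) * gen (.Q n) = -(gen (.Q n) * gen (.Q m)) := by
    intro m n
    have := key (Rel.QQ m n)
    simp only [map_mul, map_add, map_zero] at this
    exact eq_neg_of_add_eq_zero_left this
  -- The defining relations fix one order of each pair of types; the opposite order follows by
  -- skew-symmetry.
  have flip : ∀ x y : Gen, sgn x y = 1 →
      gen x * gen y = gen y * gen x + brv gen x y →
      gen y * gen x = sgn y x • (gen x * gen y) + brv gen y x := by
    intro x y hs h
    rw [brv_skew gen y x, sgn_comm, hs, h]
    module
  rcases x with a | a | a | a | _ <;> rcases y with b | b | b | b | _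
  all_goals first
    | (simp only [sgn, Gen.odd, Bool.and_true, Bool.and_false, Bool.and_self,
        Bool.false_eq_true, if_true, if_false, one_smul]
       first
       | exact h1 _ _ | exact h2 _ _ | exact h3 _ _ | exact h4 _ _ | exact h5 _ _
       | exact h6 _ _ | exact h7 _ _ | exact h8 _ _
       | (simp only [brv, add_zero]
          first
          | exact h9 _ _
          | exact h10 _ _
          | exact hC _
          | exact (hC _).symm))
    | (refine flip _ _ rfl ?_
       first | exact h1 _ _ | exact h3 _ _ | exact h4 _ _ | exact h5 _ _ | exact h6 _ _)
    | skip
  · rw [brv_skew gen, h2 b a]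
    simp [sgn, Gen.odd]
  · simp [sgn, Gen.odd, brv]

/-! ### The induced module, realised on words of negative generators. -/

/-- The space spanned by all words in the generators. -/
abbrev WordSpace : Type := List Gen →₀ ℂ

/-- Prepending a letter to a word. -/
noncomputable def consW (g : Gen) : WordSpace →ₗ[ℂ] WordSpace :=
  Finsupp.lmapDomain ℂ ℂ (List.cons g)

@[simp] theorem consW_single (g : Gen) (w : List Gen) (a : ℂ) :
    consW g (Finsupp.single w a) = Finsupp.single (g :: w) a := by
  simp [consW]

/-- The eigenvalues of the generators of nonnegative index on a chiral highest weight vector. -/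
def hwChar (c q : ℂ) : Gen → ℂ
  | .H n => if n = 0 then q else 0
  | .C => c
  | _ => 0

/-- The action of a generator of nonnegative index on a word of negative generators, by commuting
it to the right. -/
noncomputable def actNonneg (c q : ℂ) : List Gen → Gen → WordSpace
  | [], z => Finsupp.single [] (hwChar c q z)
  | y :: w, z => sgn z y • consW y (actNonneg c q w z) +
      brv (fun g => if g.idx < 0 then Finsupp.single (g :: w) 1 else actNonneg c q w g) z y

/-- The action of a generator on words. -/
noncomputable def act (c q : ℂ) (g : Gen) : WordSpace →ₗ[ℂ] WordSpace :=
  if g.idx < 0 then consW g else Finsupp.linearCombination ℂ fun w => actNonneg c q w g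

section
variable {c q : ℂ}

theorem act_neg {g : Gen} (h : g.idx < 0) (u : WordSpace) : act c q g u = consW g u := by
  simp [act, h]

theorem act_nonneg_single {g : Gen} (h : 0 ≤ g.idx) (w : List Gen) :
    act c q g (Finsupp.single w 1) = actNonneg c q w g := by
  simp [act, not_lt.mpr h]

theorem act_nonneg_cons {z : Gen} (hz : 0 ≤ z.idx) (y : Gen) (u : WordSpace) :
    act c q z (consW y u) = sgn z y • consW y (act c q z u) + brv (fun g => act c q g u) z y := by
  induction u using Finsupp.induction_linear with
  | zero =>
    have : brv (fun _ : Gen => (0 : WordSpace)) z y = 0 := by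
      simpa using brv_smul (0 : ℂ) (fun _ : Gen => (0 : WordSpace)) z y
    simp [this]
  | add u v hu hv =>
    simp only [map_add, brv_add, hu, hv, smul_add]
    abel
  | single w a =>
    have h1 : (Finsupp.single w a : WordSpace) = a • Finsupp.single w 1 := by simp
    rw [h1]
    simp only [map_smul, brv_smul, consW_single, act_nonneg_single hz]
    rw [smul_comm (sgn z y) a, ← smul_add, actNonneg]
    congr 3
    funext g
    split_ifs with h
    · simp [act_neg h]
    · rw [act_nonneg_single (not_lt.mp h)]

/-- The relations between words of negative generators. -/
inductive WordRel : WordSpace → Prop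
  | base (y y' : Gen) (hy : y.idx < 0) (hy' : y'.idx < 0) (u : WordSpace) :
      WordRel (consW y (consW y' u) - sgn y y' • consW y' (consW y u) -
        brv (fun g => consW g u) y y')
  | cons (g : Gen) (x : WordSpace) (h : WordRel x) : WordRel (consW g x)

/-- The span of the relations between words of negative generators. -/
noncomputable def relSpan : Submodule ℂ WordSpace := Submodule.span ℂ {x | WordRel x}

theorem consW_mem (g : Gen) {x : WordSpace} (hx : x ∈ relSpan) : consW g x ∈ relSpan := by
  have : relSpan ≤ relSpan.comap (consW g) :=
    Submodule.span_le.mpr fun x hx => Submodule.subset_span (WordRel.cons g x hx)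
  exact this hx

theorem mkQ_consW_congr (g : Gen) {x y : WordSpace} (h : relSpan.mkQ x = relSpan.mkQ y) :
    relSpan.mkQ (consW g x) = relSpan.mkQ (consW g y) := by
  rw [← sub_eq_zero, ← map_sub, Submodule.mkQ_apply, Submodule.Quotient.mk_eq_zero] at h ⊢
  rw [← map_sub]
  exact consW_mem g h

theorem mkQ_base {y y' : Gen} (hy : y.idx < 0) (hy' : y'.idx < 0) (u : WordSpace) :
    relSpan.mkQ (consW y (consW y' u)) = sgn y y' • relSpan.mkQ (consW y' (consW y u)) +
      brv (fun g => relSpan.mkQ (consW g u)) y y' := by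
  have := (Submodule.Quotient.mk_eq_zero relSpan).mpr
    (Submodule.subset_span (WordRel.base y y' hy hy' u))
  rw [← Submodule.mkQ_apply, map_sub, map_sub, map_brv, map_smul, sub_sub, sub_eq_zero] at this
  exact this

/-- For negative x this is one of the relations divided out; for the other x it is the recursion
defining the action. -/
theorem mkQ_act_cons (x : Gen) {y : Gen} (hy : y.idx < 0) (u : WordSpace) :
    relSpan.mkQ (act c q x (consW y u)) = sgn x y • relSpan.mkQ (consW y (act c q x u)) +
      brv (fun g => relSpan.mkQ (act c q g u)) x y := by
  rcases lt_or_ge x.idx 0 with hx | hx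
  · rw [act_neg hx, act_neg hx, mkQ_base hx hy]
    congr 1
    refine brv_congr fun g hg _ => ?_
    rw [act_neg (by lia)]
  · rw [act_nonneg_cons hx, map_add, map_smul, map_brv]

theorem sgn_cases (x y : Gen) : sgn x y = 1 ∨ sgn x y = -1 := by
  unfold sgn; split_ifs <;> simp

theorem brv_sgn' {M : Type*} [AddCommGroup M] [Module ℂ M] (Φ : Gen → M) (x y z : Gen) :
    brv (fun g => sgn z g • Φ g) x y = (sgn z x * sgn z y) • brv Φ x y := by
  simp only [sgn_comm z, brv_sgn]

theorem brv_skew_inner {M : Type*} [AddCommGroup M] [Module ℂ M] (Φ : Gen → M) (x y z : Gen) :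
    brv (fun g => brv Φ z g) x y = -((sgn z x * sgn z y) • brv (fun g => brv Φ g z) x y) := by
  rw [← brv_sgn', ← neg_one_smul ℂ, ← brv_smul]
  refine brv_congr fun g _ _ => ?_
  rw [brv_skew, neg_one_smul]

/-- Commuting z through the relation of y and y' produces relations again, together with double
brackets that cancel by the Jacobi identity. The induction is over all z at once, because a bracket
of z with a letter is again an arbitrary generator. -/
theorem act_mem (x : Gen) {u : WordSpace} (hu : u ∈ relSpan) : act c q x u ∈ relSpan := by
  have key : ∀ u, WordRel u → ∀ z : Gen, act c q z u ∈ relSpan := by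
    intro u hu
    induction hu with
    | cons g x h ih =>
      intro z
      rcases lt_or_ge z.idx 0 with hz | hz
      · rw [act_neg hz]
        exact consW_mem _ (consW_mem _ (Submodule.subset_span h))
      · rw [act_nonneg_cons hz]
        exact relSpan.add_mem (relSpan.smul_mem _ (consW_mem _ (ih z)))
          (brv_mem fun g _ _ => ih g)
    | base y y' hy hy' u =>
      intro z
      rcases lt_or_ge z.idx 0 with hz | hz
      · rw [act_neg hz]
        exact consW_mem _ (Submodule.subset_span (.base y y' hy hy' u))
      · rw [← Submodule.Quotient.mk_eq_zero, ← Submodule.mkQ_apply]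
        have h1 : ∀ y y' : Gen, y.idx < 0 → y'.idx < 0 →
            relSpan.mkQ (act c q z (consW y (consW y' u))) =
            (sgn z y * sgn z y') • relSpan.mkQ (consW y (consW y' (act c q z u))) +
            sgn z y • brv (fun g => relSpan.mkQ (consW y (act c q g u))) z y' +
            (sgn z y' * sgn y y') • brv (fun g => relSpan.mkQ (consW y' (act c q g u))) z y +
            brv (fun g => brv (fun g' => relSpan.mkQ (act c q g' u)) g y') z y := by
          intro y y' hy hy'
          rw [mkQ_act_cons z hy, act_nonneg_cons hz, map_add, map_add, smul_add, map_smul,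
            map_smul, smul_smul, map_brv (consW y), map_brv relSpan.mkQ]
          simp only [mkQ_act_cons _ hy', brv_add, brv_sgn]
          abel
        rw [map_sub, map_sub, map_sub, map_sub, map_smul, map_smul, h1 y y' hy hy', h1 y' y hy' hy,
          map_brv (act c q z), map_brv relSpan.mkQ]
        have h2 : brv (fun g => relSpan.mkQ (act c q z (consW g u))) y y' =
            (sgn z y * sgn z y') • brv (fun g => relSpan.mkQ (consW g (act c q z u))) y y' +
            brv (fun g => brv (fun g' => relSpan.mkQ (act c q g' u)) z g) y y' := by
          rw [← brv_sgn', ← brv_add]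
          exact brv_congr fun g hg _ => mkQ_act_cons z (by lia) u
        rw [h2, mkQ_base hy hy', brv_jacobi _ z y y', brv_skew_inner _ z y' y]
        rw [sgn_comm y' y, sgn_comm y z]
        rcases sgn_cases z y with e1 | e1 <;> rcases sgn_cases z y' with e2 | e2 <;>
          rcases sgn_cases y y' with e3 | e3 <;> rw [e1, e2, e3] <;> module
  have : relSpan ≤ relSpan.comap (act c q x) :=
    Submodule.span_le.mpr fun u hu => key u hu x
  exact this hu

theorem hwChar_mul {x y : Gen} :
    hwChar c q x * hwChar c q y = sgn x y * (hwChar c q x * hwChar c q y) := by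
  cases x <;> cases y <;> simp [hwChar, sgn, Gen.odd]

/-- The highest weight conditions define a character of the subalgebra of nonnegative index: there a
vanishing index sum forces both indices to be 0, where all cocycles vanish, and the bracket of the
odd zero modes is 2L_0, which has value 0. -/
theorem brv_hwChar {x y : Gen} (hx : 0 ≤ x.idx) (hy : 0 ≤ y.idx) : brv (hwChar c q) x y = 0 := by
  rcases x with a | a | a | a | _ <;> rcases y with b | b | b | b | _ <;>
    simp only [Gen.idx] at hx hy <;> simp [hwChar, brv] <;>
  · by_cases h : a + b = 0
    · obtain rfl : a = 0 := by lia
      obtain rfl : b = 0 := by lia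
      simp
    · simp [h]

/-- If one of x, y is negative this is `mkQ_act_cons`. Otherwise both are commuted past the first
letter of the word, and the resulting double brackets match by the Jacobi identity. -/
theorem mkQ_act_act (x y : Gen) (u : WordSpace) :
    relSpan.mkQ (act c q x (act c q y u)) = sgn x y • relSpan.mkQ (act c q y (act c q x u)) +
      brv (fun g => relSpan.mkQ (act c q g u)) x y := by
  have hneg : ∀ (x y : Gen) (u : WordSpace), y.idx < 0 →
      relSpan.mkQ (act c q x (act c q y u)) = sgn x y • relSpan.mkQ (act c q y (act c q x u)) +
      brv (fun g => relSpan.mkQ (act c q g u)) x y := by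
    intro x y u hy
    rw [act_neg hy, act_neg hy, mkQ_act_cons x hy]
  have hneg' : ∀ (x y : Gen) (u : WordSpace), x.idx < 0 →
      relSpan.mkQ (act c q x (act c q y u)) = sgn x y • relSpan.mkQ (act c q y (act c q x u)) +
      brv (fun g => relSpan.mkQ (act c q g u)) x y := by
    intro x y u hx
    rw [hneg y x u hx, brv_skew _ y x, sgn_comm y x]
    rcases sgn_cases x y with e | e <;> rw [e] <;> module
  suffices H : ∀ (w : List Gen) (x y : Gen),
      relSpan.mkQ (act c q x (act c q y (Finsupp.single w 1))) =
      sgn x y • relSpan.mkQ (act c q y (act c q x (Finsupp.single w 1))) +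
      brv (fun g => relSpan.mkQ (act c q g (Finsupp.single w 1))) x y by
    induction u using Finsupp.induction_linear with
    | zero =>
      have : brv (fun _ : Gen => (0 : WordSpace ⧸ relSpan)) x y = 0 := by
        simpa using brv_smul (0 : ℂ) (fun _ : Gen => (0 : WordSpace ⧸ relSpan)) x y
      simp [this]
    | add u v hu hv =>
      simp only [map_add, brv_add, hu, hv, smul_add]
      abel
    | single w a =>
      have h1 : (Finsupp.single w a : WordSpace) = a • Finsupp.single w 1 := by simp
      rw [h1]
      simp only [map_smul, brv_smul, H w x y]
      module
  intro w
  induction w with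
  | nil =>
    intro x y
    rcases lt_or_ge y.idx 0 with hy | hy
    · exact hneg x y _ hy
    rcases lt_or_ge x.idx 0 with hx | hx
    · exact hneg' x y _ hx
    have h0 : ∀ z : Gen, 0 ≤ z.idx → act c q z (Finsupp.single [] 1) =
        hwChar c q z • Finsupp.single [] 1 := by
      intro z hz
      rw [act_nonneg_single hz, actNonneg]
      simp
    have h1 : brv (fun g => relSpan.mkQ (act c q g (Finsupp.single [] 1))) x y = 0 := by
      have h2 := map_brv (LinearMap.toSpanSingleton ℂ (WordSpace ⧸ relSpan)
        (relSpan.mkQ (Finsupp.single [] 1))) (hwChar c q) x y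
      rw [brv_hwChar hx hy, map_zero] at h2
      rw [h2]
      refine brv_congr fun g hg _ => ?_
      rw [h0 g (by lia), map_smul, LinearMap.toSpanSingleton_apply]
    rw [h1]
    simp only [h0 y hy, h0 x hx, map_smul, smul_smul, add_zero]
    congr 1
    linear_combination hwChar_mul (c := c) (q := q) (x := x) (y := y)
  | cons y₀ w ih =>
    intro x y
    rcases lt_or_ge y.idx 0 with hy | hy
    · exact hneg x y _ hy
    rcases lt_or_ge x.idx 0 with hx | hx
    · exact hneg' x y _ hx
    rw [← consW_single]
    set u : WordSpace := Finsupp.single w 1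
    have h1 : ∀ x y : Gen, 0 ≤ x.idx → 0 ≤ y.idx →
        relSpan.mkQ (act c q x (act c q y (consW y₀ u))) =
        (sgn x y₀ * sgn y y₀) • relSpan.mkQ (consW y₀ (act c q x (act c q y u))) +
        sgn y y₀ • ((sgn x y * sgn y₀ y) •
          brv (fun g => relSpan.mkQ (act c q y (act c q g u))) x y₀ +
          brv (fun g => brv (fun g' => relSpan.mkQ (act c q g' u)) g y) x y₀) +
        brv (fun g => relSpan.mkQ (act c q x (act c q g u))) y y₀ := by
      intro x y hx hy
      rw [act_nonneg_cons hy, map_add, map_smul, act_nonneg_cons hx, map_brv (act c q x),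
        ← brv_sgn, ← brv_add, map_add, map_smul, map_add, map_smul, map_brv relSpan.mkQ,
        map_brv relSpan.mkQ]
      simp only [ih _ y]
      module
    have h2 : brv (fun g => relSpan.mkQ (act c q g (consW y₀ u))) x y =
        (sgn x y₀ * sgn y y₀) • brv (fun g => relSpan.mkQ (consW y₀ (act c q g u))) x y +
        brv (fun g => brv (fun g' => relSpan.mkQ (act c q g' u)) g y₀) x y := by
      rw [← brv_sgn, ← brv_add]
      refine brv_congr fun g hg _ => ?_
      rw [act_nonneg_cons (by lia), map_add, map_smul, map_brv relSpan.mkQ]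
    have h3 : relSpan.mkQ (consW y₀ (act c q x (act c q y u))) =
        sgn x y • relSpan.mkQ (consW y₀ (act c q y (act c q x u))) +
        brv (fun g => relSpan.mkQ (consW y₀ (act c q g u))) x y := by
      have := ih x y
      rw [← map_brv relSpan.mkQ, ← map_smul, ← map_add] at this
      rw [mkQ_consW_congr y₀ this, map_add, map_add, map_smul, map_smul, map_brv (consW y₀),
        map_brv relSpan.mkQ]
    have h4 := brv_jacobi (fun g' => relSpan.mkQ (act c q g' u)) x y y₀
    rw [brv_skew_inner _ y y₀ x, brv_skew_inner _ x y₀ y] at h4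
    rw [h1 x y hx hy, h1 y x hy hx, h2, h3]
    rw [sgn_comm y x] at h4 ⊢
    rw [sgn_comm y₀ y, sgn_comm y₀ x]
    generalize brv (fun g => brv (fun g' => relSpan.mkQ (act c q g' u)) g y₀) x y = A at *
    generalize brv (fun g => brv (fun g' => relSpan.mkQ (act c q g' u)) g x) y y₀ = B at *
    generalize brv (fun g => brv (fun g' => relSpan.mkQ (act c q g' u)) g y) x y₀ = D at *
    have h5 : A = -((sgn x y * sgn x y₀) • B) - sgn x y • -((sgn x y * sgn y y₀) • D) := by
      rw [h4]; abel
    rw [h5]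
    rcases sgn_cases x y with e1 | e1 <;> rcases sgn_cases x y₀ with e2 | e2 <;>
      rcases sgn_cases y y₀ with e3 | e3 <;> rw [e1, e2, e3] <;> module

end

/-- The action of a generator on the quotient of the space of words by the relations between
negative generators. -/
noncomputable def actQ (c q : ℂ) (g : Gen) : Module.End ℂ (WordSpace ⧸ relSpan) :=
  relSpan.mapQ relSpan (act c q g) fun _ hu => act_mem g hu

theorem actQ_mul (c q : ℂ) (x y : Gen) :
    actQ c q x * actQ c q y = sgn x y • (actQ c q y * actQ c q x) + brv (actQ c q) x y := by
  refine LinearMap.ext fun u => ?_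
  obtain ⟨u, rfl⟩ := relSpan.mkQ_surjective u
  have h := map_brv (LinearMap.applyₗ (relSpan.mkQ u)) (actQ c q) x y
  simp only [LinearMap.applyₗ_apply_apply] at h
  rw [LinearMap.add_apply, h]
  exact mkQ_act_act x y u

/-- The representation of the enveloping algebra on words modulo relations. -/
noncomputable def wordRep (c q : ℂ) : U →ₐ[ℂ] Module.End ℂ (WordSpace ⧸ relSpan) :=
  RingQuot.liftAlgHom ℂ ⟨FreeAlgebra.lift ℂ (actQ c q), by
    have h := actQ_mul c q
    intro x y hxy
    induction hxy with
    | LL m n =>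
      have := h (.L m) (.L n)
      simp only [sgn, Gen.odd, brv] at this
      simp [this]
    | HH m n =>
      have := h (.H m) (.H n)
      simp only [sgn, Gen.odd, brv] at this
      simp [this, apply_ite]
      split_ifs <;> module
    | LG m n =>
      have := h (.L m) (.G n)
      simp only [sgn, Gen.odd, brv] at this
      simp [this]
    | HG m n =>
      have := h (.H m) (.G n)
      simp only [sgn, Gen.odd, brv] at this
      simp [this]
    | LQ m n =>
      have := h (.L m) (.Q n)
      simp only [sgn, Gen.odd, brv] at this
      simp [this]
    | HQ m n =>
      have := h (.H m) (.Q n)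
      simp only [sgn, Gen.odd, brv] at this
      simp [this]
    | LH m n =>
      have := h (.L m) (.H n)
      simp only [sgn, Gen.odd, brv] at this
      simp [this, apply_ite]
      split_ifs <;> module
    | GQ m n =>
      have := h (.G m) (.Q n)
      simp only [sgn, Gen.odd, brv] at this
      simp [this, apply_ite]
      split_ifs <;> module
    | GG m n =>
      have := h (.G m) (.G n)
      simp only [sgn, Gen.odd, brv] at this
      simp [this]
      module
    | QQ m n =>
      have := h (.Q m) (.Q n)
      simp only [sgn, Gen.odd, brv] at this
      simp [this]
      module
    | central g =>
      have := h .C g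
      simp only [sgn, Gen.odd, brv] at this
      simp [this]⟩

theorem wordRep_gen (c q : ℂ) (g : Gen) : wordRep c q (gen g) = actQ c q g := by
  simp [wordRep, gen]

/-! ### The Whittaker functional. -/

open Polynomial in
/-- The value of the Whittaker character on a generator. -/
noncomputable def whittakerChar : Gen → ℂ[X]
  | .L n => if n = -1 then X else 0
  | _ => 0

open Polynomial in
/-- The Whittaker functional on words. -/
noncomputable def whittakerWord : WordSpace →ₗ[ℂ] ℂ[X] :=
  Finsupp.linearCombination ℂ fun w => (w.map whittakerChar).prod

theorem whittakerWord_consW (g : Gen) (u : WordSpace) :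
    whittakerWord (consW g u) = whittakerChar g * whittakerWord u := by
  induction u using Finsupp.induction_linear with
  | zero => simp
  | add u v hu hv => simp [hu, hv, mul_add]
  | single w a => simp [whittakerWord]

theorem whittakerChar_eq_zero {g : Gen} (h : g ≠ .L (-1)) : whittakerChar g = 0 := by
  cases g <;> simp_all [whittakerChar]

/-- The bracket of two negative generators has index at most -2, so it does not involve L_{-1} and
has character value 0. The values themselves commute and vanish on odd generators. -/
theorem relSpan_le_ker : relSpan ≤ LinearMap.ker whittakerWord := by
  refine Submodule.span_le.mpr fun x hx => ?_
  induction hx with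
  | base y y' hy hy' u =>
    rw [SetLike.mem_coe, LinearMap.mem_ker, map_sub, map_sub, map_smul, map_brv]
    have h1 : brv (fun g => whittakerWord (consW g u)) y y' = 0 := by
      rw [← Submodule.mem_bot ℂ]
      refine brv_mem fun g hg _ => ?_
      rw [whittakerWord_consW, whittakerChar_eq_zero, zero_mul, Submodule.mem_bot]
      rintro rfl
      have : (Gen.L (-1)).idx = -1 := rfl
      lia
    rw [h1]
    simp only [whittakerWord_consW]
    by_cases hy1 : y = .L (-1)
    · subst hy1
      simp [sgn, Gen.odd, mul_left_comm]
    · simp [whittakerChar_eq_zero hy1]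
  | cons g x h ih =>
    rw [SetLike.mem_coe, LinearMap.mem_ker] at ih ⊢
    rw [whittakerWord_consW, ih, mul_zero]

/-- The highest weight vector in the space of words modulo relations. -/
noncomputable def emptyWord : WordSpace ⧸ relSpan := relSpan.mkQ (Finsupp.single [] 1)

theorem actQ_emptyWord (c q : ℂ) {g : Gen} (hg : 0 ≤ g.idx) :
    actQ c q g emptyWord = hwChar c q g • emptyWord := by
  have h0 : act c q g (Finsupp.single [] 1) = hwChar c q g • Finsupp.single [] 1 := by
    rw [act_nonneg_single hg, actNonneg]
    simp
  rw [emptyWord, ← map_smul, ← h0]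
  rfl

theorem wordRep_chiralIdeal (c q : ℂ) {u : U} (hu : u ∈ chiralIdeal c q) :
    wordRep c q u emptyWord = 0 := by
  have hg : ∀ g : Gen, 0 ≤ g.idx → hwChar c q g = 0 → wordRep c q (gen g) emptyWord = 0 := by
    intro g h1 h2
    rw [wordRep_gen, actQ_emptyWord c q h1, h2, zero_smul]
  induction hu using Submodule.span_induction with
  | mem x hx =>
    rcases hx with hx | ⟨n, hn, rfl | rfl | rfl | rfl⟩
    · simp only [Set.mem_insert_iff, Set.mem_singleton_iff] at hx
      rcases hx with rfl | rfl | rfl | rfl | rfl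
      · exact hg _ le_rfl rfl
      · rw [map_sub, LinearMap.sub_apply, wordRep_gen, actQ_emptyWord c q le_rfl,
          AlgHom.commutes, Module.algebraMap_end_apply]
        simp [hwChar]
      · rw [map_sub, LinearMap.sub_apply, wordRep_gen, actQ_emptyWord c q le_rfl,
          AlgHom.commutes, Module.algebraMap_end_apply]
        simp [hwChar]
      · exact hg _ le_rfl rfl
      · exact hg _ le_rfl rfl
    · exact hg _ hn.le rfl
    · exact hg _ hn.le (by simp [hwChar, hn.ne'])
    · exact hg _ hn.le rfl
    · exact hg _ hn.le rfl
  | zero => simp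
  | add x y _ _ hx hy => simp [hx, hy]
  | smul a x _ hx => simp [hx]

open Polynomial in
/-- There is a functional on the chiral Verma module on which `L_{-1}` acts as multiplication by `X`
and all other generators of negative index act by zero. -/
theorem exists_whittaker (c q : ℂ) : ∃ f : ChiralVerma c q →ₗ[ℂ] ℂ[X],
    f (ket c q) = 1 ∧ (∀ y, f (gen (.L (-1)) • y) = X * f y) ∧
    ∀ g : Gen, g.idx < 0 → g ≠ .L (-1) → ∀ y, f (gen g • y) = 0 := by
  let φ : WordSpace ⧸ relSpan →ₗ[ℂ] ℂ[X] := relSpan.liftQ whittakerWord relSpan_le_ker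
  let F : U →ₗ[ℂ] ℂ[X] :=
    φ ∘ₗ (LinearMap.applyₗ emptyWord) ∘ₗ (wordRep c q).toLinearMap
  have hF : (chiralIdeal c q).restrictScalars ℂ ≤ LinearMap.ker F := by
    intro u hu
    simp [F, wordRep_chiralIdeal c q hu]
  let f : ChiralVerma c q →ₗ[ℂ] ℂ[X] :=
    ((chiralIdeal c q).restrictScalars ℂ).liftQ F hF ∘ₗ
      (Submodule.Quotient.restrictScalarsEquiv ℂ (chiralIdeal c q)).symm.toLinearMap
  have hf : ∀ u : U, f ((chiralIdeal c q).mkQ u) = F u := fun u => rfl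
  have hφ : ∀ g : Gen, g.idx < 0 → ∀ y, f (gen g • y) = whittakerChar g * f y := by
    intro g hg y
    obtain ⟨u, rfl⟩ := (chiralIdeal c q).mkQ_surjective y
    rw [← map_smul, hf, hf]
    simp only [F, LinearMap.comp_apply, AlgHom.toLinearMap_apply, LinearMap.applyₗ_apply_apply,
      smul_eq_mul, map_mul, wordRep_gen, Module.End.mul_apply]
    obtain ⟨w, hw⟩ := relSpan.mkQ_surjective (wordRep c q u emptyWord)
    rw [← hw]
    change whittakerWord (act c q g w) = _ * whittakerWord w
    rw [act_neg hg, whittakerWord_consW]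
  refine ⟨f, ?_, fun y => ?_, fun g hg h y => ?_⟩
  · rw [ket, hf]
    simp only [F, LinearMap.comp_apply, AlgHom.toLinearMap_apply, LinearMap.applyₗ_apply_apply,
      map_one, Module.End.one_apply]
    change whittakerWord (Finsupp.single [] 1) = 1
    simp [whittakerWord]
  · rw [hφ _ (by decide)]
    simp [whittakerChar]
  · rw [hφ g hg, whittakerChar_eq_zero h, zero_mul]

/-! ### The filtration by powers of L_{-1} and the leading action of the generators. -/

/-- The negative generators other than `L_{-1}`. -/
def IsLetter (g : Gen) : Prop := g.idx < 0 ∧ g ≠ .L (-1)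

theorem isLetter_of_idx_lt {g : Gen} (h : g.idx < -1) : IsLetter g := by
  refine ⟨by lia, ?_⟩
  rintro rfl
  have : (Gen.L (-1)).idx = -1 := rfl
  lia

/-- The product of the generators in a list. -/
noncomputable def wordU (w : List Gen) : U := (w.map gen).prod

theorem gen_smul_smul {M : Type*} [AddCommGroup M] [Module U M] [Module ℂ M] [IsScalarTower ℂ U M]
    (x y : Gen) (v : M) :
    gen x • gen y • v = sgn x y • gen y • gen x • v + brv (fun g => gen g • v) x y := by
  have h := map_brv ((LinearMap.toSpanSingleton U M v).restrictScalars ℂ) gen x y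
  simp only [LinearMap.coe_restrictScalars, LinearMap.toSpanSingleton_apply] at h
  rw [← h, smul_smul, gen_mul, add_smul, smul_assoc, mul_smul]

/-- A vector satisfying the conditions on a chiral highest weight vector. -/
def IsChiralVec (c q : ℂ) {M : Type*} [AddCommGroup M] [Module U M] [Module ℂ M] (v : M) : Prop :=
  ∀ g : Gen, 0 ≤ g.idx → gen g • v = hwChar c q g • v

theorem ket_annihilated {c q : ℂ} {u : U} (hu : u ∈ chiralIdeal c q) : u • ket c q = 0 := by
  rw [ket, ← map_smul, smul_eq_mul, mul_one, Submodule.mkQ_apply, Submodule.Quotient.mk_eq_zero]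
  exact hu

theorem isChiralVec_ket (c q : ℂ) : IsChiralVec c q (ket c q) := by
  intro g hg
  have h1 : ∀ (g : Gen) (a : ℂ), gen g - algebraMap ℂ U a ∈ chiralIdeal c q →
      gen g • ket c q = a • ket c q := by
    intro g a h
    have := ket_annihilated h
    rwa [sub_smul, algebraMap_smul, sub_eq_zero] at this
  have hmem : ∀ x, x ∈ ({gen (.L 0), gen (.H 0) - algebraMap ℂ U q, gen .C - algebraMap ℂ U c,
        gen (.G 0), gen (.Q 0)} : Set U) → x ∈ chiralIdeal c q :=
    fun x hx => Submodule.subset_span (Or.inl hx)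
  have hpos : ∀ n : ℤ, 0 < n → ∀ x, (x = gen (.L n) ∨ x = gen (.H n) ∨ x = gen (.G n) ∨
      x = gen (.Q n)) → x ∈ chiralIdeal c q :=
    fun n hn x hx => Submodule.subset_span (Or.inr ⟨n, hn, hx⟩)
  refine h1 g _ ?_
  rcases g with n | n | n | n | _
  · rcases hg.eq_or_lt with h | h
    · obtain rfl : 0 = n := h
      exact hmem _ (by simp [hwChar])
    · exact hpos n h _ (by simp [hwChar])
  · rcases hg.eq_or_lt with h | h
    · obtain rfl : 0 = n := h
      exact hmem _ (by simp [hwChar])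
    · exact hpos n h _ (by simp [hwChar, show n ≠ 0 from ne_of_gt h])
  · rcases hg.eq_or_lt with h | h
    · obtain rfl : 0 = n := h
      exact hmem _ (by simp [hwChar])
    · exact hpos n h _ (by simp [hwChar])
  · rcases hg.eq_or_lt with h | h
    · obtain rfl : 0 = n := h
      exact hmem _ (by simp [hwChar])
    · exact hpos n h _ (by simp [hwChar])
  · exact hmem _ (by simp [hwChar])

section
variable {M : Type*} [AddCommGroup M] [Module U M] [Module ℂ M] [IsScalarTower ℂ U M] (v : M)

/-- The vector `w L_{-1}^k |0,q⟩` of the chiral Verma module. -/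
noncomputable def vec (w : List Gen) (k : ℕ) : M :=
  (wordU w * gen (.L (-1)) ^ k) • v

theorem vec_cons (g : Gen) (w : List Gen) (k : ℕ) : vec v (g :: w) k = gen g • vec v w k := by
  simp [vec, wordU, smul_smul, mul_assoc]

theorem vec_nil_succ (k : ℕ) : vec v [] (k + 1) = gen (.L (-1)) • vec v [] k := by
  simp [vec, wordU, smul_smul, pow_succ']

theorem vec_nil_zero : vec v [] 0 = v := by
  simp [vec, wordU]

/-- The span of the vectors `w L_{-1}^j |0,q⟩` with `w` a word of letters and `j < k`. -/
noncomputable def fil (k : ℕ) : Submodule ℂ (M) :=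
  Submodule.span ℂ {x | ∃ w j, (∀ g ∈ w, IsLetter g) ∧ j < k ∧ x = vec v w j}

variable {v}

theorem vec_mem_fil {w : List Gen} (hw : ∀ g ∈ w, IsLetter g) {j k : ℕ} (h : j < k) :
    vec v w j ∈ fil v k :=
  Submodule.subset_span ⟨w, j, hw, h, rfl⟩

theorem fil_mono {j k : ℕ} (h : j ≤ k) : fil v j ≤ fil v k :=
  Submodule.span_mono fun _ ⟨w, i, hw, hi, hx⟩ => ⟨w, i, hw, hi.trans_le h, hx⟩

theorem smul_mem_fil {u : U} {m : ℕ → ℕ} (hm : Monotone m)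
    (h : ∀ w : List Gen, (∀ g ∈ w, IsLetter g) → ∀ j, u • vec v w j ∈ fil v (m (j + 1)))
    {k : ℕ} {x : M} (hx : x ∈ fil v k) : u • x ∈ fil v (m k) := by
  have : fil v k ≤ (fil v (m k)).comap (Algebra.lsmul ℂ ℂ (M) u) := by
    refine Submodule.span_le.mpr ?_
    rintro _ ⟨w, j, hw, hj, rfl⟩
    exact fil_mono (hm hj) (h w hw j)
  exact this hx

theorem letter_smul_mem {y : Gen} (hy : IsLetter y) {k : ℕ} {x : M}
    (hx : x ∈ fil v k) : gen y • x ∈ fil v k := by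
  refine smul_mem_fil (m := id) monotone_id (fun w hw j => ?_) hx
  rw [← vec_cons]
  exact vec_mem_fil (by simpa using ⟨hy, hw⟩) (Nat.lt_succ_self j)

theorem sgn_L_left (n : ℤ) (x : Gen) : sgn (.L n) x = 1 := by simp [sgn, Gen.odd]

theorem sgn_L_right (n : ℤ) (x : Gen) : sgn x (.L n) = 1 := by simp [sgn, Gen.odd]

theorem sgn_H_left (n : ℤ) (x : Gen) : sgn (.H n) x = 1 := by simp [sgn, Gen.odd]

theorem sgn_H_right (n : ℤ) (x : Gen) : sgn x (.H n) = 1 := by simp [sgn, Gen.odd]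

/-- Brackets of L_{-1} with letters have index at most -2, hence are letters, so moving L_{-1} to
the right costs only terms with the lower power. -/
theorem t_smul_vec {w : List Gen} (hw : ∀ g ∈ w, IsLetter g) (k : ℕ) :
    gen (.L (-1)) • vec v w k - vec v w (k + 1) ∈ fil v (k + 1) := by
  induction w with
  | nil => simp [vec_nil_succ]
  | cons y w ih =>
    have hy : IsLetter y := hw y (by simp)
    have hw' : ∀ g ∈ w, IsLetter g := fun g hg => hw g (by simp [hg])
    rw [vec_cons, vec_cons, gen_smul_smul, sgn_L_left, one_smul, add_sub_right_comm, ← smul_sub]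
    refine Submodule.add_mem _ (letter_smul_mem hy (ih hw')) (brv_mem fun g hg _ => ?_)
    rw [← vec_cons]
    refine vec_mem_fil ?_ (Nat.lt_succ_self k)
    have h1 : (Gen.L (-1)).idx = -1 := rfl
    have h2 := hy.1
    simpa using ⟨isLetter_of_idx_lt (g := g) (by lia), hw'⟩

theorem t_smul_mem {k : ℕ} {x : M} (hx : x ∈ fil v k) :
    gen (.L (-1)) • x ∈ fil v (k + 1) := by
  refine smul_mem_fil (m := fun k => k + 1) (fun _ _ h => Nat.succ_le_succ h) (fun w hw j => ?_) hx
  have := Submodule.add_mem _ (fil_mono (Nat.le_succ _) (t_smul_vec (v := v) hw j))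
    (vec_mem_fil (v := v) hw (Nat.lt_succ_self (j + 1)))
  simpa using this

variable {c q : ℂ}

theorem idx_trichotomy (g : Gen) : 0 ≤ g.idx ∨ IsLetter g ∨ g = .L (-1) := by
  by_cases h : g = .L (-1)
  · exact Or.inr (Or.inr h)
  · rcases lt_or_ge g.idx 0 with h' | h'
    · exact Or.inr (Or.inl ⟨h', h⟩)
    · exact Or.inl h'

/-- Without letters there is nothing to contract: a new L_{-1} can only come from the bracket with
an existing one, which is consumed, so the power does not grow. -/
theorem nonneg_smul_vec_nil (hv : IsChiralVec c q v) {z : Gen} (hz : 0 ≤ z.idx) (k : ℕ) :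
    gen z • vec v [] k ∈ fil v (k + 1) := by
  induction k generalizing z with
  | zero =>
    have h0 : vec v [] 0 ∈ fil v 1 := vec_mem_fil (by simp) Nat.one_pos
    rw [vec_nil_zero] at h0 ⊢
    rw [hv _ hz]
    exact Submodule.smul_mem _ _ h0
  | succ k ih =>
    rw [vec_nil_succ, gen_smul_smul, sgn_L_right, one_smul]
    refine Submodule.add_mem _ (t_smul_mem (ih hz)) (brv_mem fun g hg _ => ?_)
    rcases idx_trichotomy g with h | h | rfl
    · exact fil_mono (Nat.le_succ _) (ih h)
    · rw [← vec_cons]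
      exact vec_mem_fil (by simpa using h) (by lia)
    · rw [← vec_nil_succ]
      exact vec_mem_fil (by simp) (by lia)

/-- At each letter z either passes or merges with it into a single generator, so at most one further
L_{-1} is created. -/
theorem gen_smul_mem (hv : IsChiralVec c q v) (z : Gen) {k : ℕ} {x : M} (hx : x ∈ fil v k) :
    gen z • x ∈ fil v (k + 1) := by
  refine smul_mem_fil (m := fun k => k + 1) (fun _ _ h => Nat.succ_le_succ h) (fun w hw j => ?_) hx
  induction w generalizing z with
  | nil =>
    rcases idx_trichotomy z with h | h | rfl
    · exact fil_mono (Nat.le_succ _) (nonneg_smul_vec_nil hv h j)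
    · exact fil_mono (Nat.le_succ _) (letter_smul_mem h (vec_mem_fil hw (Nat.lt_succ_self j)))
    · exact t_smul_mem (vec_mem_fil hw (Nat.lt_succ_self j))
  | cons y w ih =>
    have hw' : ∀ g ∈ w, IsLetter g := fun g hg => hw g (by simp [hg])
    rw [vec_cons, gen_smul_smul]
    exact Submodule.add_mem _
      (Submodule.smul_mem _ _ (letter_smul_mem (hw y (by simp)) (ih z hw')))
      (brv_mem fun g _ _ => ih g hw')

/-- The coefficient of `L_{-1}`. -/
def isT : Gen → ℂ
  | .L n => if n = -1 then 1 else 0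
  | _ => 0

theorem isT_eq_zero {g : Gen} (h : g ≠ .L (-1)) : isT g = 0 := by
  cases g <;> simp_all [isT]

/-- The contributions to the commutator of a generator with a word that replace one letter by
`L_{-1}` (which is then left out). -/
noncomputable def rem (z : Gen) : List Gen → WordSpace
  | [] => 0
  | y :: w => brv isT z y • Finsupp.single w 1 + sgn z y • consW y (rem z w)

variable (v) in
/-- The map sending a word `w` to `w L_{-1}^k |0,q⟩`. -/
noncomputable def vecL (k : ℕ) : WordSpace →ₗ[ℂ] M :=
  Finsupp.linearCombination ℂ fun w => vec v w k

theorem vecL_single (k : ℕ) (w : List Gen) (a : ℂ) :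
    vecL v k (Finsupp.single w a) = a • vec v w k := by
  simp [vecL]

theorem vecL_consW (k : ℕ) (g : Gen) (u : WordSpace) :
    vecL v k (consW g u) = gen g • vecL v k u := by
  induction u using Finsupp.induction_linear with
  | zero => simp
  | add u v hu hv => simp [hu, hv]
  | single w a => rw [consW_single, vecL_single, vecL_single, vec_cons, smul_comm]

/-- The span of the subwords of `w` that are shorter by at least `d`. -/
noncomputable def subwords (d : ℕ) (w : List Gen) : Submodule ℂ WordSpace :=
  Finsupp.supported ℂ ℂ {w' | w'.Sublist w ∧ w'.length + d ≤ w.length}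

theorem single_mem_subwords {d : ℕ} {w w' : List Gen} (h : w'.Sublist w)
    (h' : w'.length + d ≤ w.length) : Finsupp.single w' 1 ∈ subwords d w :=
  Finsupp.single_mem_supported ℂ 1 ⟨h, h'⟩

theorem consW_mem_subwords {d : ℕ} {w : List Gen} (y : Gen) {u : WordSpace}
    (hu : u ∈ subwords d w) : consW y u ∈ subwords d (y :: w) := by
  have : subwords d w ≤ (subwords d (y :: w)).comap (consW y) := by
    rw [subwords, Finsupp.supported_eq_span_single, Submodule.span_le]
    rintro _ ⟨w', ⟨h1, h2⟩, rfl⟩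
    rw [SetLike.mem_coe, Submodule.mem_comap, consW_single]
    exact single_mem_subwords (h1.cons_cons y) (by simp; lia)
  exact this hu

theorem subwords_le_cons {d : ℕ} {w : List Gen} (y : Gen) :
    subwords d w ≤ subwords (d + 1) (y :: w) :=
  Finsupp.supported_mono fun w' ⟨h1, h2⟩ => ⟨h1.trans (List.sublist_cons_self y w), by simp; lia⟩

theorem subwords_mono {d e : ℕ} (h : d ≤ e) (w : List Gen) : subwords e w ≤ subwords d w :=
  Finsupp.supported_mono fun w' ⟨h1, h2⟩ => ⟨h1, by lia⟩

theorem rem_mem_subwords (z : Gen) (w : List Gen) : rem z w ∈ subwords 1 w := by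
  induction w with
  | nil => exact Submodule.zero_mem _
  | cons y w ih =>
    exact Submodule.add_mem _
      (Submodule.smul_mem _ _ (single_mem_subwords (List.sublist_cons_self y w) (by simp)))
      (Submodule.smul_mem _ _ (consW_mem_subwords y ih))

theorem brv_isT_smul {M : Type*} [AddCommGroup M] [Module ℂ M] (v : M) (x y : Gen) :
    brv (fun g => isT g • v) x y = brv isT x y • v := by
  have := map_brv (LinearMap.toSpanSingleton ℂ M v) isT x y
  simpa using this.symm

theorem mem_map_sup_mono {S T : Submodule ℂ WordSpace} (h : S ≤ T) {f : WordSpace →ₗ[ℂ] M}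
    {F : Submodule ℂ M} {x : M} (hx : x ∈ S.map f ⊔ F) : x ∈ T.map f ⊔ F :=
  (sup_le_sup (Submodule.map_mono h) le_rfl : S.map f ⊔ F ≤ T.map f ⊔ F) hx

/-- Up to lower powers of `L_{-1}` and subwords that are shorter by at least two, a generator of
nonnegative index acts on a word by replacing one letter by `L_{-1}`. -/
theorem nonneg_smul_vec (hv : IsChiralVec c q v) {z : Gen} (hz : 0 ≤ z.idx) {w : List Gen} (hw : ∀ g ∈ w, IsLetter g)
    (k : ℕ) : gen z • vec v w k - vecL v (k + 1) (rem z w) ∈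
      (subwords 2 w).map (vecL v (k + 1)) ⊔ fil v (k + 1) := by
  induction w generalizing z with
  | nil =>
    rw [rem, map_zero, sub_zero]
    exact Submodule.mem_sup_right (nonneg_smul_vec_nil hv hz k)
  | cons y w ih =>
    have hy : IsLetter y := hw y (by simp)
    have hw' : ∀ g ∈ w, IsLetter g := fun g hg => hw g (by simp [hg])
    have e : gen z • vec v (y :: w) k - vecL v (k + 1) (rem z (y :: w)) =
        sgn z y • gen y • (gen z • vec v w k - vecL v (k + 1) (rem z w)) +
        brv (fun g => gen g • vec v w k - isT g • vec v w (k + 1)) z y := by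
      rw [vec_cons, gen_smul_smul, rem, map_add, map_smul, map_smul, vecL_single, one_smul,
        vecL_consW, brv_sub, brv_isT_smul, smul_sub, smul_sub]
      abel
    rw [e]
    refine Submodule.add_mem _ (Submodule.smul_mem _ _ ?_) (brv_mem fun g _ _ => ?_)
    · obtain ⟨_, ⟨u, hu, rfl⟩, b, hb, hab⟩ := Submodule.mem_sup.mp (ih hz hw')
      rw [← hab, smul_add, ← vecL_consW]
      exact Submodule.add_mem _
        (Submodule.mem_sup_left (Submodule.mem_map_of_mem (consW_mem_subwords y hu)))
        (Submodule.mem_sup_right (letter_smul_mem hy hb))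
    -- The bracket g of z with y has already used up y. If its index is nonnegative, it must use up
    -- a second letter to create L_{-1}; if it is a letter, no L_{-1} is created; if it is L_{-1},
    -- this is the term recorded by `rem`.
    · rcases idx_trichotomy g with h | h | rfl
      · rw [isT_eq_zero (by rintro rfl; exact absurd h (by decide)), zero_smul, sub_zero]
        have h1 : gen g • vec v w k ∈
            (subwords 1 w).map (vecL v (k + 1)) ⊔ fil v (k + 1) := by
          rw [← sub_add_cancel (gen g • vec v w k) (vecL v (k + 1) (rem g w))]
          exact Submodule.add_mem _
            (mem_map_sup_mono (subwords_mono one_le_two w) (ih h hw'))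
            (Submodule.mem_sup_left (Submodule.mem_map_of_mem (rem_mem_subwords g w)))
        exact mem_map_sup_mono (subwords_le_cons y) h1
      · rw [isT_eq_zero h.2, zero_smul, sub_zero]
        exact Submodule.mem_sup_right (letter_smul_mem h (vec_mem_fil hw' (Nat.lt_succ_self k)))
      · simp only [isT, if_true, one_smul]
        exact Submodule.mem_sup_right (t_smul_vec hw' k)

/-- The negative generators of type `H`. -/
def IsH (g : Gen) : Prop := ∃ n : ℤ, n < 0 ∧ g = .H n

theorem IsH.isLetter {g : Gen} (h : IsH g) : IsLetter g := by
  obtain ⟨n, hn, rfl⟩ := h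
  exact ⟨hn, by simp⟩

/-- Brackets with H_n never contain an L. This is why no single generator contracts H_n to L_{-1}.
-/
theorem brv_H_mem {M : Type*} [AddCommGroup M] [Module ℂ M] {S : Submodule ℂ M} {Φ : Gen → M}
    (z : Gen) (n : ℤ) (h : ∀ g : Gen, (∀ m, g ≠ .L m) → Φ g ∈ S) : brv Φ z (.H n) ∈ S := by
  rcases z with a | a | a | a | _ <;> simp only [brv]
  · exact S.add_mem (S.smul_mem _ (h _ (by simp))) (S.smul_mem _ (h _ (by simp)))
  · exact S.smul_mem _ (h _ (by simp))
  · exact S.neg_mem (h _ (by simp))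
  · exact h _ (by simp)
  · exact S.zero_mem

theorem nonneg_smul_vec_H (hv : IsChiralVec c q v) {z : Gen} (hz : 0 ≤ z.idx) {w : List Gen} (hw : ∀ g ∈ w, IsH g)
    (k : ℕ) : gen z • vec v w k ∈ fil v (k + 1) := by
  induction w generalizing z with
  | nil => exact nonneg_smul_vec_nil hv hz k
  | cons y w ih =>
    have hw' : ∀ g ∈ w, IsH g := fun g hg => hw g (by simp [hg])
    obtain ⟨n, hn, rfl⟩ := hw y (by simp)
    rw [vec_cons, gen_smul_smul]
    refine Submodule.add_mem _ (Submodule.smul_mem _ _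
      (letter_smul_mem (IsH.isLetter ⟨n, hn, rfl⟩) (ih hz hw'))) (brv_H_mem z n fun g hg => ?_)
    rcases idx_trichotomy g with h | h | rfl
    · exact ih h hw'
    · exact letter_smul_mem h (vec_mem_fil (fun g hg => (hw' g hg).isLetter) (Nat.lt_succ_self k))
    · exact absurd rfl (hg _)

end

/-! ### Quadratic operators modulo those raising the filtration by at most one. -/

/-- The convolution of a family indexed by pairs of integers. -/
noncomputable def conv {E : Type*} [AddCommGroup E] (F : ℤ → ℤ → E) (s : ℤ) : E :=
  ∑ᶠ a, F a (s - a)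

/-- The families vanishing outside of `a, b ≥ -1`. -/
def Bounded {E : Type*} [AddCommGroup E] (F : ℤ → ℤ → E) : Prop :=
  ∀ a b : ℤ, a < -1 ∨ b < -1 → F a b = 0

section
variable {E : Type*} [AddCommGroup E] [Module ℂ E] {F G : ℤ → ℤ → E}

theorem Bounded.add (hF : Bounded F) (hG : Bounded G) : Bounded fun a b => F a b + G a b :=
  fun a b h => by simp [hF a b h, hG a b h]

theorem Bounded.sub (hF : Bounded F) (hG : Bounded G) : Bounded fun a b => F a b - G a b :=
  fun a b h => by simp [hF a b h, hG a b h]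

theorem Bounded.smul (κ : ℤ → ℤ → ℂ) (hF : Bounded F) : Bounded fun a b => κ a b • F a b :=
  fun a b h => by simp [hF a b h]

theorem Bounded.swap (hF : Bounded F) : Bounded fun a b => F b a :=
  fun a b h => hF b a h.symm

theorem Bounded.conv_eq (hF : Bounded F) (s : ℤ) :
    conv F s = ∑ a ∈ Finset.Icc (-2) (s + 2), F a (s - a) := by
  refine finsum_eq_sum_of_support_subset _ fun a ha => ?_
  by_contra h
  refine ha (hF _ _ ?_)
  simp only [Finset.coe_Icc, Set.mem_Icc] at h
  lia

theorem conv_add (hF : Bounded F) (hG : Bounded G) (s : ℤ) :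
    conv (fun a b => F a b + G a b) s = conv F s + conv G s := by
  rw [(hF.add hG).conv_eq, hF.conv_eq, hG.conv_eq, Finset.sum_add_distrib]

theorem conv_sub (hF : Bounded F) (hG : Bounded G) (s : ℤ) :
    conv (fun a b => F a b - G a b) s = conv F s - conv G s := by
  rw [(hF.sub hG).conv_eq, hF.conv_eq, hG.conv_eq, Finset.sum_sub_distrib]

theorem conv_smul (κ : ℂ) (F : ℤ → ℤ → E) (s : ℤ) :
    conv (fun a b => κ • F a b) s = κ • conv F s := by
  simp only [conv, smul_finsum]

theorem conv_congr {s : ℤ} (h : ∀ a b, a + b = s → F a b = G a b) : conv F s = conv G s :=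
  finsum_congr fun a => h a (s - a) (by ring)

theorem conv_swap (F : ℤ → ℤ → E) (s : ℤ) : conv (fun a b => F b a) s = conv F s := by
  unfold conv
  rw [← finsum_comp_equiv (Equiv.subLeft s)]
  refine finsum_congr fun a => ?_
  simp

theorem conv_eq_zero_of_antisymm (h : ∀ a b, F a b = -F b a) (s : ℤ) : conv F s = 0 := by
  have h1 : conv F s = -conv F s := by
    conv_lhs => rw [← conv_swap]
    rw [conv_congr (G := fun a b => (-1 : ℂ) • F a b) (fun a b _ => by rw [h b a]; simp),
      conv_smul, neg_one_smul]
  have h2 : (2 : ℂ) • conv F s = 0 := by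
    rw [two_smul]
    nth_rewrite 1 [h1]
    simp
  simpa using h2

/-- Commuting with a generator of index n shifts one of the two indices by n. For n ≤ 0 the shifted
supports stay inside the fixed summation range, so truncating the sums loses nothing. -/
theorem conv_shift (hF : Bounded F) (hG : Bounded G) {n : ℤ} (hn : n ≤ 0) (s : ℤ) :
    ∑ a ∈ Finset.Icc (-2) (s + 2), (F (a + n) (s - a) + G a (s - a + n)) =
      conv (fun a b => F a b + G a b) (s + n) := by
  have h1 : ∑ a ∈ Finset.Icc (-2) (s + 2), F (a + n) (s - a) = conv F (s + n) := by
    unfold conv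
    rw [← finsum_comp_equiv (Equiv.addRight n)]
    simp only [Equiv.coe_addRight, add_sub_add_right_eq_sub]
    refine (finsum_eq_sum_of_support_subset _ fun a ha => ?_).symm
    by_contra h
    refine ha (hF _ _ ?_)
    simp only [Finset.coe_Icc, Set.mem_Icc] at h
    lia
  have h2 : ∑ a ∈ Finset.Icc (-2) (s + 2), G a (s - a + n) = conv G (s + n) := by
    unfold conv
    simp only [add_sub_right_comm s n]
    refine (finsum_eq_sum_of_support_subset _ fun a ha => ?_).symm
    by_contra h
    refine ha (hG _ _ ?_)
    simp only [Finset.coe_Icc, Set.mem_Icc] at h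
    lia
  rw [Finset.sum_add_distrib, h1, h2, conv_add hF hG]

end

/-- The truncated convolution sum of a family of elements of the enveloping algebra. -/
noncomputable def quad (F : ℤ → ℤ → U) (s : ℤ) : U :=
  ∑ a ∈ Finset.Icc (-2) (s + 2), F a (s - a)

section
variable {M : Type*} [AddCommGroup M] [Module U M] [Module ℂ M] [IsScalarTower ℂ U M]

/-- The operators raising the filtration by at most one. -/
noncomputable def raise (v : M) : Submodule ℂ U where
  carrier := {u | ∀ k, ∀ x ∈ fil v k, u • x ∈ fil v (k + 1)}
  add_mem' := fun ha hb k x hx => by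
    rw [add_smul]
    exact Submodule.add_mem _ (ha k x hx) (hb k x hx)
  zero_mem' := fun k x _ => by
    rw [zero_smul]
    exact Submodule.zero_mem _
  smul_mem' := fun a u hu k x hx => by
    rw [smul_assoc]
    exact Submodule.smul_mem _ _ (hu k x hx)

/-- The generators preserving the filtration that are used below. -/
def Keeps (v : M) (g : Gen) : Prop := ∀ k, ∀ x ∈ fil v k, gen g • x ∈ fil v k

/-- A quadratic monomial modulo the operators raising the filtration by at most one. -/
noncomputable def quadClass (v : M) (x y : Gen) : U ⧸ raise v := (raise v).mkQ (gen x * gen y)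

variable {v : M} {c q : ℂ} (hv : IsChiralVec c q v)
include hv

theorem gen_mem_raise (g : Gen) : gen g ∈ raise v := fun _ _ hx => gen_smul_mem hv g hx

theorem gen_C_smul_vec (w : List Gen) (k : ℕ) : gen .C • vec v w k = c • vec v w k := by
  have h0 : ∀ g : Gen, ∀ x : M, gen .C • gen g • x = gen g • gen .C • x := by
    intro g x
    rw [gen_smul_smul]
    simp [sgn, Gen.odd, brv]
  induction w with
  | nil =>
    induction k with
    | zero => rw [vec_nil_zero, hv _ le_rfl]; rfl
    | succ k ih => rw [vec_nil_succ, h0, ih, smul_comm]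
  | cons y w ih => rw [vec_cons, h0, ih, smul_comm]

theorem keeps_C : Keeps v .C := by
  intro k x hx
  refine smul_mem_fil (m := id) monotone_id (fun w hw j => ?_) hx
  rw [gen_C_smul_vec hv]
  exact Submodule.smul_mem _ _ (vec_mem_fil hw (Nat.lt_succ_self j))

omit hv in
theorem IsLetter.keeps {g : Gen} (h : IsLetter g) : Keeps v g := fun _ _ hx => letter_smul_mem h hx

theorem quadClass_left {x : Gen} (h : Keeps v x) (y : Gen) : quadClass v x y = 0 := by
  rw [quadClass, Submodule.mkQ_apply, Submodule.Quotient.mk_eq_zero]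
  intro k z hz
  rw [mul_smul]
  exact h _ _ (gen_smul_mem hv y hz)

theorem quadClass_right (x : Gen) {y : Gen} (h : Keeps v y) : quadClass v x y = 0 := by
  rw [quadClass, Submodule.mkQ_apply, Submodule.Quotient.mk_eq_zero]
  intro k z hz
  rw [mul_smul]
  exact gen_smul_mem hv x (h _ _ hz)

/-- The bracket is a combination of single generators, each raising the filtration by at most one.
-/
theorem quadClass_swap (x y : Gen) : quadClass v x y = sgn x y • quadClass v y x := by
  rw [quadClass, quadClass, gen_mul, map_add, map_smul, Submodule.mkQ_apply _ (brv gen x y),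
    (Submodule.Quotient.mk_eq_zero _).mpr (brv_mem fun g _ _ => gen_mem_raise hv g), add_zero]

omit hv in
theorem mkQ_commutator (x x' y : Gen) :
    (raise v).mkQ (gen x * gen x' * gen y - (sgn x y * sgn x' y) • (gen y * (gen x * gen x'))) =
      brv (fun g => quadClass v x g) x' y +
        sgn x' y • brv (fun g => quadClass v g x') x y := by
  have h1 : gen x * gen x' * gen y - (sgn x y * sgn x' y) • (gen y * (gen x * gen x')) =
      gen x * brv gen x' y + sgn x' y • (brv gen x y * gen x') := by
    rw [mul_assoc, gen_mul x' y, mul_add, mul_smul_comm, ← mul_assoc, gen_mul x y, add_mul,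
      smul_mul_assoc, mul_assoc]
    module
  have h2 := map_brv ((raise v).mkQ ∘ₗ LinearMap.mulLeft ℂ (gen x)) gen x' y
  have h3 := map_brv ((raise v).mkQ ∘ₗ LinearMap.mulRight ℂ (gen x')) gen x y
  simp only [LinearMap.comp_apply, LinearMap.mulLeft_apply, LinearMap.mulRight_apply] at h2 h3
  rw [h1, map_add, map_smul, h2, h3]
  rfl

/-- A factor of index below -1 is a letter and preserves the filtration, so the product raises it by
at most one. Only finitely many pairs with a given index sum therefore matter. -/
theorem bounded_quadClass {A B : ℤ → Gen} (hA : ∀ n, (A n).idx = n) (hB : ∀ n, (B n).idx = n) :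
    Bounded fun a b => quadClass v (A a) (B b) := by
  rintro a b (h | h)
  · exact quadClass_left hv (isLetter_of_idx_lt (by rw [hA]; exact h)).keeps _
  · exact quadClass_right hv _ (isLetter_of_idx_lt (by rw [hB]; exact h)).keeps

end

/-! ### Four quadratic families closed under commutation with letters. -/

/-- The quadratic family `2 L_a H_b - G_a Q_b`. -/
noncomputable def famT (a b : ℤ) : U :=
  (2 : ℂ) • (gen (.L a) * gen (.H b)) - gen (.G a) * gen (.Q b)

/-- The quadratic family `G_a H_b`. -/
noncomputable def famG (a b : ℤ) : U := gen (.G a) * gen (.H b)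

/-- The quadratic family `Q_a H_b`. -/
noncomputable def famQ (a b : ℤ) : U := gen (.Q a) * gen (.H b)

/-- The quadratic family `H_a H_b`. -/
noncomputable def famH (a b : ℤ) : U := gen (.H a) * gen (.H b)

section
variable {M : Type*} [AddCommGroup M] [Module U M] [Module ℂ M] [IsScalarTower ℂ U M]
variable {v : M} {c q : ℂ}

theorem mkQ_quad {F : ℤ → ℤ → U} {K : ℤ → ℤ → U ⧸ raise v} (hF : ∀ a b, (raise v).mkQ (F a b) = K a b)
    (hK : Bounded K) (s : ℤ) : (raise v).mkQ (quad F s) = conv K s := by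
  rw [hK.conv_eq, quad, map_sum]
  exact Finset.sum_congr rfl fun a _ => hF _ _

theorem quad_comm {F : ℤ → ℤ → U} {K K' : ℤ → ℤ → U ⧸ raise v} {σ : ℂ} {y : Gen} {n : ℤ}
    (hn : n ≤ 0) (hK : Bounded K) (hK' : Bounded K')
    (h : ∀ a b, (raise v).mkQ (F a b * gen y - σ • (gen y * F a b)) = K (a + n) b + K' a (b + n))
    (s : ℤ) : (raise v).mkQ (quad F s * gen y - σ • (gen y * quad F s)) =
      conv (fun a b => K a b + K' a b) (s + n) := by
  rw [← conv_shift hK hK' hn, quad, Finset.sum_mul, Finset.mul_sum, Finset.smul_sum,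
    ← Finset.sum_sub_distrib, map_sum]
  exact Finset.sum_congr rfl fun a _ => h _ _

/-- Induction step for `quad_smul_vec`: Q is moved past the letter y, which preserves the
filtration, at the cost of the commutator, represented by R modulo `raise v`. -/
theorem quad_step {Q R : U} {σ : ℂ} {y : Gen} (hy : IsLetter y) {w : List Gen}
    (hw : ∀ g ∈ w, IsLetter g) {k : ℕ}
    (h : (raise v).mkQ (Q * gen y - σ • (gen y * Q)) = (raise v).mkQ R)
    (hQ : Q • vec v w k ∈ fil v (k + 2)) (hR : R • vec v w k ∈ fil v (k + 2)) :
    Q • vec v (y :: w) k ∈ fil v (k + 2) := by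
  rw [← sub_eq_zero, ← map_sub, Submodule.mkQ_apply, Submodule.Quotient.mk_eq_zero] at h
  have h1 := h _ _ (vec_mem_fil hw (Nat.lt_succ_self k))
  have h2 : Q • vec v (y :: w) k = (Q * gen y - σ • (gen y * Q) - R) • vec v w k +
      σ • gen y • Q • vec v w k + R • vec v w k := by
    rw [vec_cons, sub_smul, sub_smul, mul_smul, smul_assoc, mul_smul]
    abel
  rw [h2]
  exact Submodule.add_mem _ (Submodule.add_mem _ h1
    (Submodule.smul_mem _ _ (letter_smul_mem hy hQ))) hR

theorem mkQ_famT_commutator (a b : ℤ) (y : Gen) :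
    (raise v).mkQ (famT a b * gen y - (1 : ℂ) • (gen y * famT a b)) =
      (2 : ℂ) • (brv (fun g => quadClass v (.L a) g) (.H b) y +
        brv (fun g => quadClass v g (.H b)) (.L a) y) -
      (brv (fun g => quadClass v (.G a) g) (.Q b) y +
        sgn (.Q b) y • brv (fun g => quadClass v g (.Q b)) (.G a) y) := by
  have e1 := mkQ_commutator (v := v) (.L a) (.H b) y
  have e2 := mkQ_commutator (v := v) (.G a) (.Q b) y
  rw [sgn_L_left, sgn_H_left, one_mul, one_smul, one_smul] at e1
  rw [show sgn (.G a) y = sgn (.Q b) y from rfl, sgn_mul_self, one_smul] at e2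
  rw [one_smul, ← e1, ← e2, ← map_smul, ← map_sub, famT]
  congr 1
  simp only [sub_mul, mul_sub, smul_mul_assoc, mul_smul_comm]
  module

variable (hv : IsChiralVec c q v)
include hv

theorem bounded_LH : Bounded fun a b => quadClass v (.L a) (.H b) :=
  bounded_quadClass hv (fun _ => rfl) fun _ => rfl

theorem bounded_GQ : Bounded fun a b => quadClass v (.G a) (.Q b) :=
  bounded_quadClass hv (fun _ => rfl) fun _ => rfl

theorem bounded_GH : Bounded fun a b => quadClass v (.G a) (.H b) :=
  bounded_quadClass hv (fun _ => rfl) fun _ => rfl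

theorem bounded_QH : Bounded fun a b => quadClass v (.Q a) (.H b) :=
  bounded_quadClass hv (fun _ => rfl) fun _ => rfl

theorem bounded_HH : Bounded fun a b => quadClass v (.H a) (.H b) :=
  bounded_quadClass hv (fun _ => rfl) fun _ => rfl

theorem bounded_T : Bounded fun a b =>
    (2 : ℂ) • quadClass v (.L a) (.H b) - quadClass v (.G a) (.Q b) :=
  ((bounded_LH hv).smul fun _ _ => 2).sub (bounded_GQ hv)

theorem mkQ_famT (s : ℤ) : (raise v).mkQ (quad famT s) =
    conv (fun a b => (2 : ℂ) • quadClass v (.L a) (.H b) - quadClass v (.G a) (.Q b)) s :=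
  mkQ_quad (fun a b => by rw [famT, map_sub, map_smul]; rfl) (bounded_T hv) s

theorem mkQ_famG (s : ℤ) : (raise v).mkQ (quad famG s) =
    conv (fun a b => quadClass v (.G a) (.H b)) s :=
  mkQ_quad (fun _ _ => rfl) (bounded_GH hv) s

theorem mkQ_famQ (s : ℤ) : (raise v).mkQ (quad famQ s) =
    conv (fun a b => quadClass v (.Q a) (.H b)) s :=
  mkQ_quad (fun _ _ => rfl) (bounded_QH hv) s

theorem mkQ_famH (s : ℤ) : (raise v).mkQ (quad famH s) =
    conv (fun a b => quadClass v (.H a) (.H b)) s :=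
  mkQ_quad (fun _ _ => rfl) (bounded_HH hv) s

theorem quadClass_C_left (y : Gen) : quadClass v .C y = 0 := quadClass_left hv (keeps_C hv) y

theorem quadClass_C_right (x : Gen) : quadClass v x .C = 0 := quadClass_right hv x (keeps_C hv)

/-! Commutators with `famG`. -/

theorem famG_L {n : ℤ} (hn : n < 0) (s : ℤ) :
    (raise v).mkQ (quad famG s * gen (.L n) - (1 : ℂ) • (gen (.L n) * quad famG s)) =
      (raise v).mkQ (((s : ℂ) - 2 * n) • quad famG (s + n)) := by
  rw [quad_comm hn.le ((bounded_GH hv).smul fun a _ => (a : ℂ) - 2 * n)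
    ((bounded_GH hv).smul fun _ b => (b : ℂ) - n), map_smul, mkQ_famG hv, ← conv_smul]
  · refine conv_congr fun a b h => ?_
    obtain rfl : s = a + b - n := by lia
    push_cast
    module
  · intro a b
    have := mkQ_commutator (v := v) (.G a) (.H b) (.L n)
    simp only [sgn_L_right, mul_one] at this
    rw [famG, this]
    simp only [brv, quadClass_C_right hv]
    push_cast
    module

theorem famG_H {n : ℤ} (hn : n < 0) (s : ℤ) :
    (raise v).mkQ (quad famG s * gen (.H n) - (1 : ℂ) • (gen (.H n) * quad famG s)) =
      (raise v).mkQ ((-1 : ℂ) • quad famG (s + n)) := by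
  rw [quad_comm hn.le ((bounded_GH hv).smul fun _ _ => -1)
    ((bounded_GH hv).smul fun _ _ => 0), map_smul, mkQ_famG hv, ← conv_smul]
  · refine conv_congr fun a b h => ?_
    module
  · intro a b
    have := mkQ_commutator (v := v) (.G a) (.H b) (.H n)
    simp only [sgn_H_right, mul_one] at this
    rw [famG, this]
    simp only [brv, quadClass_C_right hv]
    module

/-- The commutator is a convolution of the products G_a G_b, which are antisymmetric modulo `raise
v`. -/
theorem famG_G {n : ℤ} (hn : n < 0) (s : ℤ) :
    (raise v).mkQ (quad famG s * gen (.G n) - (-1 : ℂ) • (gen (.G n) * quad famG s)) =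
      (raise v).mkQ 0 := by
  have hGG : Bounded fun a b => quadClass v (.G a) (.G b) :=
    bounded_quadClass hv (fun _ => rfl) fun _ => rfl
  rw [quad_comm hn.le ((bounded_GH hv).smul fun _ _ => 0) hGG, map_zero]
  · refine conv_eq_zero_of_antisymm (fun a b => ?_) _
    simpa [sgn, Gen.odd] using quadClass_swap hv (.G a) (.G b)
  · intro a b
    have := mkQ_commutator (v := v) (.G a) (.H b) (.G n)
    simp only [sgn, Gen.odd, Bool.and_true, Bool.false_eq_true, if_true, if_false,
      mul_one] at this
    rw [famG, this]
    simp only [brv]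
    module

theorem famG_Q {n : ℤ} (hn : n < 0) (s : ℤ) :
    (raise v).mkQ (quad famG s * gen (.Q n) - (-1 : ℂ) • (gen (.Q n) * quad famG s)) =
      (raise v).mkQ (quad famT (s + n) + (-2 * n : ℂ) • quad famH (s + n)) := by
  rw [quad_comm hn.le (((bounded_LH hv).smul fun _ _ => 2).add
    ((bounded_HH hv).smul fun _ _ => -2 * n)) ((bounded_GQ hv).smul fun _ _ => -1),
    map_add, map_smul, mkQ_famT hv, mkQ_famH hv, ← conv_smul, ← conv_add (bounded_T hv)
    ((bounded_HH hv).smul fun _ _ => -2 * n)]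
  · refine conv_congr fun a b h => ?_
    module
  · intro a b
    have := mkQ_commutator (v := v) (.G a) (.H b) (.Q n)
    simp only [sgn, Gen.odd, Bool.and_true, Bool.false_eq_true, if_true, if_false,
      mul_one] at this
    rw [famG, this]
    simp only [brv, quadClass_C_left hv]
    module

/-! Commutators with `famQ`. -/

theorem famQ_L {n : ℤ} (hn : n < 0) (s : ℤ) :
    (raise v).mkQ (quad famQ s * gen (.L n) - (1 : ℂ) • (gen (.L n) * quad famQ s)) =
      (raise v).mkQ (((s : ℂ) - n) • quad famQ (s + n)) := by
  rw [quad_comm hn.le ((bounded_QH hv).smul fun a _ => (a : ℂ) - n)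
    ((bounded_QH hv).smul fun _ b => (b : ℂ) - n), map_smul, mkQ_famQ hv, ← conv_smul]
  · refine conv_congr fun a b h => ?_
    obtain rfl : s = a + b - n := by lia
    push_cast
    module
  · intro a b
    have := mkQ_commutator (v := v) (.Q a) (.H b) (.L n)
    simp only [sgn_L_right, mul_one] at this
    rw [famQ, this]
    simp only [brv, quadClass_C_right hv]
    push_cast
    module

theorem famQ_H {n : ℤ} (hn : n < 0) (s : ℤ) :
    (raise v).mkQ (quad famQ s * gen (.H n) - (1 : ℂ) • (gen (.H n) * quad famQ s)) =
      (raise v).mkQ (quad famQ (s + n)) := by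
  rw [quad_comm hn.le (bounded_QH hv) ((bounded_QH hv).smul fun _ _ => 0), mkQ_famQ hv]
  · refine conv_congr fun a b h => ?_
    module
  · intro a b
    have := mkQ_commutator (v := v) (.Q a) (.H b) (.H n)
    simp only [sgn_H_right, mul_one] at this
    rw [famQ, this]
    simp only [brv, quadClass_C_right hv]
    module

theorem famQ_Q {n : ℤ} (hn : n < 0) (s : ℤ) :
    (raise v).mkQ (quad famQ s * gen (.Q n) - (-1 : ℂ) • (gen (.Q n) * quad famQ s)) =
      (raise v).mkQ 0 := by
  have hQQ : Bounded fun a b => quadClass v (.Q a) (.Q b) :=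
    bounded_quadClass hv (fun _ => rfl) fun _ => rfl
  rw [quad_comm hn.le ((bounded_QH hv).smul fun _ _ => 0) (hQQ.smul fun _ _ => -1), map_zero]
  · refine conv_eq_zero_of_antisymm (fun a b => ?_) _
    have h := quadClass_swap hv (.Q a) (.Q b)
    simp only [sgn, Gen.odd, Bool.and_self, if_true] at h
    rw [h]
    module
  · intro a b
    have := mkQ_commutator (v := v) (.Q a) (.H b) (.Q n)
    simp only [sgn, Gen.odd, Bool.and_true, Bool.false_eq_true, if_true, if_false,
      mul_one] at this
    rw [famQ, this]
    simp only [brv]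
    module

/-- The products H_a H_b are symmetric modulo `raise v`, so the weight a may be replaced by its
average with b, which is s/2. -/
theorem conv_weight_HH (s : ℤ) : conv (fun a b => (a : ℂ) • quadClass v (.H a) (.H b)) s =
    ((s : ℂ) / 2) • conv (fun a b => quadClass v (.H a) (.H b)) s := by
  have h1 : conv (fun a b => (b : ℂ) • quadClass v (.H a) (.H b)) s =
      conv (fun a b => (a : ℂ) • quadClass v (.H a) (.H b)) s := by
    rw [← conv_swap]
    refine conv_congr fun a b _ => ?_
    rw [quadClass_swap hv, sgn_H_left, one_smul]
  have h2 := conv_add ((bounded_HH hv).smul fun a _ => (a : ℂ))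
    ((bounded_HH hv).smul fun _ b => (b : ℂ)) s
  rw [h1, conv_congr (G := fun a b => (s : ℂ) • quadClass v (.H a) (.H b)), conv_smul] at h2
  · rw [div_eq_inv_mul, mul_smul, h2]
    module
  · rintro a b rfl
    push_cast
    module

theorem famQ_G {n : ℤ} (hn : n < 0) (s : ℤ) :
    (raise v).mkQ (quad famQ s * gen (.G n) - (-1 : ℂ) • (gen (.G n) * quad famQ s)) =
      (raise v).mkQ (quad famT (s + n) + (n - s : ℂ) • quad famH (s + n)) := by
  have hQG : Bounded fun a b => quadClass v (.Q a) (.G b) :=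
    bounded_quadClass hv (fun _ => rfl) fun _ => rfl
  rw [quad_comm hn.le (((bounded_LH hv).smul fun _ _ => 2).add
    ((bounded_HH hv).smul fun a _ => -2 * ((a : ℂ) - n))) hQG, map_add, map_smul, mkQ_famT hv,
    mkQ_famH hv]
  · have e : conv (fun a b => quadClass v (.Q a) (.G b)) (s + n) =
        (-1 : ℂ) • conv (fun a b => quadClass v (.G a) (.Q b)) (s + n) := by
      rw [← conv_swap, ← conv_smul]
      refine conv_congr fun a b _ => ?_
      rw [quadClass_swap hv]
      simp [sgn, Gen.odd]
    have e' : conv (fun a b => (-2 * ((a : ℂ) - n)) • quadClass v (.H a) (.H b)) (s + n) =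
        (-2 : ℂ) • conv (fun a b => (a : ℂ) • quadClass v (.H a) (.H b)) (s + n) +
        (2 * n : ℂ) • conv (fun a b => quadClass v (.H a) (.H b)) (s + n) := by
      rw [← conv_smul, ← conv_smul, ← conv_add
        (((bounded_HH hv).smul fun a _ => (a : ℂ)).smul fun _ _ => -2)
        ((bounded_HH hv).smul fun _ _ => 2 * n)]
      refine conv_congr fun a b _ => ?_
      module
    rw [conv_add (((bounded_LH hv).smul fun _ _ => 2).add
      ((bounded_HH hv).smul fun a _ => -2 * ((a : ℂ) - n))) hQG,
      conv_add ((bounded_LH hv).smul fun _ _ => 2)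
      ((bounded_HH hv).smul fun a _ => -2 * ((a : ℂ) - n)), e, e', conv_weight_HH hv,
      conv_sub ((bounded_LH hv).smul fun _ _ => 2) (bounded_GQ hv)]
    push_cast
    module
  · intro a b
    have := mkQ_commutator (v := v) (.Q a) (.H b) (.G n)
    simp only [sgn, Gen.odd, Bool.and_true, Bool.false_eq_true, if_true, if_false,
      mul_one] at this
    rw [famQ, this]
    simp only [brv, quadClass_C_left hv]
    push_cast
    module

/-! Commutators with `famH`. -/

theorem famH_L {n : ℤ} (hn : n < 0) (s : ℤ) :
    (raise v).mkQ (quad famH s * gen (.L n) - (1 : ℂ) • (gen (.L n) * quad famH s)) =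
      (raise v).mkQ (((s : ℂ) - n) • quad famH (s + n)) := by
  rw [quad_comm hn.le ((bounded_HH hv).smul fun a _ => (a : ℂ) - n)
    ((bounded_HH hv).smul fun _ b => (b : ℂ) - n), map_smul, mkQ_famH hv, ← conv_smul]
  · refine conv_congr fun a b h => ?_
    obtain rfl : s = a + b - n := by lia
    push_cast
    module
  · intro a b
    have := mkQ_commutator (v := v) (.H a) (.H b) (.L n)
    simp only [sgn_L_right, mul_one] at this
    rw [famH, this]
    simp only [brv, quadClass_C_left hv, quadClass_C_right hv]
    push_cast
    module

theorem famH_H {n : ℤ} (hn : n < 0) (s : ℤ) :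
    (raise v).mkQ (quad famH s * gen (.H n) - (1 : ℂ) • (gen (.H n) * quad famH s)) =
      (raise v).mkQ 0 := by
  rw [quad_comm hn.le ((bounded_HH hv).smul fun _ _ => 0)
    ((bounded_HH hv).smul fun _ _ => 0), map_zero]
  · exact conv_eq_zero_of_antisymm (fun a b => by simp) _
  · intro a b
    have := mkQ_commutator (v := v) (.H a) (.H b) (.H n)
    simp only [sgn_H_right, mul_one] at this
    rw [famH, this]
    simp only [brv, quadClass_C_left hv, quadClass_C_right hv]
    module

theorem famH_G {n : ℤ} (hn : n < 0) (s : ℤ) :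
    (raise v).mkQ (quad famH s * gen (.G n) - (1 : ℂ) • (gen (.G n) * quad famH s)) =
      (raise v).mkQ ((2 : ℂ) • quad famG (s + n)) := by
  rw [quad_comm hn.le (bounded_GH hv) (bounded_GH hv).swap, map_smul, mkQ_famG hv,
    conv_add (bounded_GH hv) (bounded_GH hv).swap, conv_swap fun a b => quadClass v (.G a) (.H b)]
  · module
  · intro a b
    have := mkQ_commutator (v := v) (.H a) (.H b) (.G n)
    simp only [sgn_H_left, mul_one] at this
    rw [famH, this]
    simp only [brv]
    rw [quadClass_swap hv (.H a), sgn_H_left]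
    module

theorem famH_Q {n : ℤ} (hn : n < 0) (s : ℤ) :
    (raise v).mkQ (quad famH s * gen (.Q n) - (1 : ℂ) • (gen (.Q n) * quad famH s)) =
      (raise v).mkQ ((-2 : ℂ) • quad famQ (s + n)) := by
  rw [quad_comm hn.le ((bounded_QH hv).smul fun _ _ => -1)
    ((bounded_QH hv).swap.smul fun _ _ => -1), map_smul, mkQ_famQ hv,
    conv_add ((bounded_QH hv).smul fun _ _ => -1) ((bounded_QH hv).swap.smul fun _ _ => -1),
    conv_smul, conv_smul, conv_swap fun a b => quadClass v (.Q a) (.H b)]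
  · module
  · intro a b
    have := mkQ_commutator (v := v) (.H a) (.H b) (.Q n)
    simp only [sgn_H_left, mul_one] at this
    rw [famH, this]
    simp only [brv]
    rw [quadClass_swap hv (.H a), sgn_H_left]
    module

/-! Commutators with `famT`. -/

theorem famT_L {n : ℤ} (hn : n < 0) (s : ℤ) :
    (raise v).mkQ (quad famT s * gen (.L n) - (1 : ℂ) • (gen (.L n) * quad famT s)) =
      (raise v).mkQ (((s : ℂ) - 2 * n) • quad famT (s + n)) := by
  rw [quad_comm hn.le ((bounded_T hv).smul fun a _ => (a : ℂ) - 2 * n)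
    ((bounded_T hv).smul fun _ b => (b : ℂ) - n), map_smul, mkQ_famT hv, ← conv_smul]
  · refine conv_congr fun a b h => ?_
    obtain rfl : s = a + b - n := by lia
    push_cast
    module
  · intro a b
    rw [mkQ_famT_commutator a b (.L n), sgn_L_right]
    simp only [brv, quadClass_C_right hv]
    push_cast
    module

/-- The two GQ contributions, from shifting the index of G and that of Q, have opposite signs and
the same convolution. -/
theorem famT_H {n : ℤ} (hn : n < 0) (s : ℤ) :
    (raise v).mkQ (quad famT s * gen (.H n) - (1 : ℂ) • (gen (.H n) * quad famT s)) =
      (raise v).mkQ ((-2 * n : ℂ) • quad famH (s + n)) := by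
  rw [quad_comm hn.le (((bounded_HH hv).smul fun _ _ => -2 * n).add (bounded_GQ hv))
    ((bounded_GQ hv).smul fun _ _ => -1), map_smul, mkQ_famH hv, ← conv_smul]
  · refine conv_congr fun a b h => ?_
    module
  · intro a b
    rw [mkQ_famT_commutator a b (.H n), sgn_H_right]
    simp only [brv, quadClass_C_left hv, quadClass_C_right hv]
    module

/-- The bracket of H_b with G_n yields L_a G_b, that of Q_b with G_n yields G_a L_b. Their
convolutions agree and cancel; this forces the relative factor 2 in `famT`. -/
theorem famT_G {n : ℤ} (hn : n < 0) (s : ℤ) :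
    (raise v).mkQ (quad famT s * gen (.G n) - (1 : ℂ) • (gen (.G n) * quad famT s)) =
      (raise v).mkQ ((2 * (s - 2 * n) : ℂ) • quad famG (s + n)) := by
  have hLG : Bounded fun a b => quadClass v (.L a) (.G b) :=
    bounded_quadClass hv (fun _ => rfl) fun _ => rfl
  have hGL : Bounded fun a b => quadClass v (.G a) (.L b) :=
    bounded_quadClass hv (fun _ => rfl) fun _ => rfl
  have e : conv (fun a b => quadClass v (.L a) (.G b)) (s + n) =
      conv (fun a b => quadClass v (.G a) (.L b)) (s + n) := by
    rw [← conv_swap]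
    refine conv_congr fun a b _ => ?_
    rw [quadClass_swap hv, sgn_L_left, one_smul]
  rw [quad_comm hn.le ((bounded_GH hv).smul fun a _ => 2 * ((a : ℂ) - 2 * n))
    ((((hLG.sub hGL).smul fun _ _ => 2)).add ((bounded_GH hv).smul fun _ b => 2 * ((b : ℂ) - n))),
    map_smul, mkQ_famG hv,
    ← conv_smul, conv_congr (G := fun a b => (2 * (s - 2 * n) : ℂ) • quadClass v (.G a) (.H b) +
      (2 : ℂ) • (quadClass v (.L a) (.G b) - quadClass v (.G a) (.L b))),
    conv_add ((bounded_GH hv).smul fun _ _ => (2 * (s - 2 * n) : ℂ))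
      ((hLG.sub hGL).smul fun _ _ => 2), conv_smul 2, conv_sub hLG hGL, e, sub_self, smul_zero,
    add_zero]
  · intro a b h
    obtain rfl : s = a + b - n := by lia
    push_cast
    module
  · intro a b
    rw [mkQ_famT_commutator a b (.G n)]
    simp only [brv, quadClass_C_right hv]
    push_cast
    module

theorem famT_Q {n : ℤ} (hn : n < 0) (s : ℤ) :
    (raise v).mkQ (quad famT s * gen (.Q n) - (1 : ℂ) • (gen (.Q n) * quad famT s)) =
      (raise v).mkQ ((-4 * n : ℂ) • quad famQ (s + n)) := by
  have hLQ : Bounded fun a b => quadClass v (.L a) (.Q b) :=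
    bounded_quadClass hv (fun _ => rfl) fun _ => rfl
  have e : conv (fun a b => quadClass v (.H a) (.Q b)) (s + n) =
      conv (fun a b => quadClass v (.Q a) (.H b)) (s + n) := by
    rw [← conv_swap]
    refine conv_congr fun a b _ => ?_
    rw [quadClass_swap hv, sgn_H_left, one_smul]
  have hHQ : Bounded fun a b => quadClass v (.H a) (.Q b) :=
    bounded_quadClass hv (fun _ => rfl) fun _ => rfl
  rw [quad_comm hn.le
    (((hLQ.smul fun _ _ => 2).add (hHQ.smul fun _ _ => -2 * n)).add
      ((bounded_QH hv).smul fun _ _ => -2 * n)) (hLQ.smul fun _ _ => -2),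
    map_smul, mkQ_famQ hv,
    conv_congr (G := fun a b => (-2 * n : ℂ) • quadClass v (.H a) (.Q b) +
      (-2 * n : ℂ) • quadClass v (.Q a) (.H b)),
    conv_add (hHQ.smul fun _ _ => -2 * n) ((bounded_QH hv).smul fun _ _ => -2 * n), conv_smul,
    conv_smul, e]
  · module
  · intro a b h
    module
  · intro a b
    rw [mkQ_famT_commutator a b (.Q n)]
    rw [show sgn (.Q b) (.Q n) = -1 by simp [sgn, Gen.odd]]
    simp only [brv, quadClass_C_left hv]
    module

end

/-! ### The quadratic families raise the filtration by at most one. -/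

section
variable {M : Type*} [AddCommGroup M] [Module U M] [Module ℂ M] [IsScalarTower ℂ U M]
variable {v : M} {c q : ℂ} (hv : IsChiralVec c q v)
include hv

theorem mul_smul_vec_nil (x : Gen) {y : Gen} (hy : y ≠ .L (-1)) (k : ℕ) :
    (gen x * gen y) • vec v [] k ∈ fil v (k + 2) := by
  rw [mul_smul]
  refine gen_smul_mem hv x (k := k + 1) ?_
  rcases idx_trichotomy y with h | h | h
  · exact nonneg_smul_vec_nil hv h k
  · exact letter_smul_mem h (vec_mem_fil (by simp) (Nat.lt_succ_self k))
  · exact absurd h hy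

/-- The four families are treated together because their commutators with letters mix them. On
L_{-1}^k v the right factor, never being L_{-1}, does not raise the power, so the product raises it
at most once. -/
theorem quad_smul_vec {w : List Gen} (hw : ∀ g ∈ w, IsLetter g) (s : ℤ) (k : ℕ) :
    quad famT s • vec v w k ∈ fil v (k + 2) ∧ quad famG s • vec v w k ∈ fil v (k + 2) ∧
      quad famQ s • vec v w k ∈ fil v (k + 2) ∧ quad famH s • vec v w k ∈ fil v (k + 2) := by
  induction w generalizing s with
  | nil =>
    refine ⟨?_, ?_, ?_, ?_⟩ <;> rw [quad, Finset.sum_smul] <;>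
      refine Submodule.sum_mem _ fun a _ => ?_
    · rw [famT, sub_smul, smul_assoc]
      exact Submodule.sub_mem _ (Submodule.smul_mem _ _ (mul_smul_vec_nil hv _ (by simp) k))
        (mul_smul_vec_nil hv _ (by simp) k)
    all_goals exact mul_smul_vec_nil hv _ (by simp) k
  | cons y w ih =>
    have hy : IsLetter y := hw y (by simp)
    have hw' : ∀ g ∈ w, IsLetter g := fun g hg => hw g (by simp [hg])
    obtain ⟨iT, iG, iQ, iH⟩ := ih hw' s
    have step : ∀ (κ : ℂ) {u : U}, u • vec v w k ∈ fil v (k + 2) →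
        (κ • u) • vec v w k ∈ fil v (k + 2) := by
      intro κ u hu
      rw [smul_assoc]
      exact Submodule.smul_mem _ _ hu
    have step' : ∀ {u u' : U}, u • vec v w k ∈ fil v (k + 2) → u' • vec v w k ∈ fil v (k + 2) →
        (u + u') • vec v w k ∈ fil v (k + 2) := by
      intro u u' hu hu'
      rw [add_smul]
      exact Submodule.add_mem _ hu hu'
    have step0 : (0 : U) • vec v w k ∈ fil v (k + 2) := by
      rw [zero_smul]
      exact Submodule.zero_mem _
    rcases y with n | n | n | n | _
    · obtain ⟨jT, jG, jQ, jH⟩ := ih hw' (s + n)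
      exact ⟨quad_step hy hw' (famT_L hv hy.1 s) iT (step _ jT),
        quad_step hy hw' (famG_L hv hy.1 s) iG (step _ jG),
        quad_step hy hw' (famQ_L hv hy.1 s) iQ (step _ jQ),
        quad_step hy hw' (famH_L hv hy.1 s) iH (step _ jH)⟩
    · obtain ⟨jT, jG, jQ, jH⟩ := ih hw' (s + n)
      exact ⟨quad_step hy hw' (famT_H hv hy.1 s) iT (step _ jH),
        quad_step hy hw' (famG_H hv hy.1 s) iG (step _ jG),
        quad_step hy hw' (famQ_H hv hy.1 s) iQ jQ,
        quad_step hy hw' (famH_H hv hy.1 s) iH step0⟩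
    · obtain ⟨jT, jG, jQ, jH⟩ := ih hw' (s + n)
      exact ⟨quad_step hy hw' (famT_G hv hy.1 s) iT (step _ jG),
        quad_step hy hw' (famG_G hv hy.1 s) iG step0,
        quad_step hy hw' (famQ_G hv hy.1 s) iQ (step' jT (step _ jH)),
        quad_step hy hw' (famH_G hv hy.1 s) iH (step _ jG)⟩
    · obtain ⟨jT, jG, jQ, jH⟩ := ih hw' (s + n)
      exact ⟨quad_step hy hw' (famT_Q hv hy.1 s) iT (step _ jQ),
        quad_step hy hw' (famG_Q hv hy.1 s) iG (step' jT (step _ jH)),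
        quad_step hy hw' (famQ_Q hv hy.1 s) iQ step0,
        quad_step hy hw' (famH_Q hv hy.1 s) iH (step _ jQ)⟩
    · exact absurd hy.1 (lt_irrefl 0)

theorem quad_famT_mem_raise (s : ℤ) : quad famT s ∈ raise v := fun _ _ hx =>
  smul_mem_fil (m := fun k => k + 1) (fun _ _ h => Nat.succ_le_succ h)
    (fun _ hw j => (quad_smul_vec hv hw s j).1) hx

end

/-! ### The quadratic operator on words in the H_n. -/

theorem sum_Icc_shift {E : Type*} [AddCommGroup E] (e : ℤ → E) {A B : ℤ} (h : A ≤ B) :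
    ∑ a ∈ Finset.Icc A B, e (a - 1) + e B = ∑ a ∈ Finset.Icc A B, e a + e (A - 1) := by
  induction B, h using Int.leInduction with
  | base => simp [add_comm]
  | succ B h ih =>
    have h1 : Finset.Icc A (B + 1) = insert (B + 1) (Finset.Icc A B) := by
      ext a
      simp only [Finset.mem_insert, Finset.mem_Icc]
      lia
    rw [h1, Finset.sum_insert (by simp), Finset.sum_insert (by simp), add_sub_cancel_right,
      add_comm (e B), ih]
    abel

/-- Telescoping: e vanishes far to the left and is constantly ε far to the right, so each unit shift
loses one copy of ε. -/
theorem sum_Icc_shift_sub {E : Type*} [AddCommGroup E] (e : ℤ → E) (ε : E) {A B m : ℤ}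
    (h : A ≤ B) (p : ℕ) (h1 : ∀ a, a < A → e a = 0) (h2 : ∀ a, m < a → e a = ε)
    (hm : m + p ≤ B) :
    ∑ a ∈ Finset.Icc A B, (e (a - p) - e a) = -(p • ε) := by
  induction p with
  | zero => simp
  | succ p ih =>
    have h3 := sum_Icc_shift (fun a => e (a - p)) h
    simp only [h1 (A - 1 - p) (by lia), add_zero, h2 (B - p) (by push_cast at hm; lia)] at h3
    have h4 := ih (by push_cast at hm; lia)
    rw [Finset.sum_sub_distrib, sub_eq_iff_eq_add] at h4 ⊢
    rw [succ_nsmul, neg_add, add_right_comm, ← h4, ← h3]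
    push_cast
    simp only [sub_sub, add_comm (1 : ℤ), add_neg_cancel_right]

section
variable {M : Type*} [AddCommGroup M] [Module U M] [Module ℂ M] [IsScalarTower ℂ U M]

/-- The part of the filtration spanned by words in the `H_n`. -/
noncomputable def filH (v : M) (k : ℕ) : Submodule ℂ M :=
  Submodule.span ℂ {x | ∃ w j, (∀ g ∈ w, IsH g) ∧ j < k ∧ x = vec v w j}

variable {v : M} {c q : ℂ}

theorem vec_mem_filH {w : List Gen} (hw : ∀ g ∈ w, IsH g) {j k : ℕ} (h : j < k) :
    vec v w j ∈ filH v k :=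
  Submodule.subset_span ⟨w, j, hw, h, rfl⟩

theorem filH_mono {j k : ℕ} (h : j ≤ k) : filH v j ≤ filH v k :=
  Submodule.span_mono fun _ ⟨w, i, hw, hi, hx⟩ => ⟨w, i, hw, hi.trans_le h, hx⟩

theorem filH_le_fil (k : ℕ) : filH v k ≤ fil v k :=
  Submodule.span_mono fun _ ⟨w, i, hw, hi, hx⟩ => ⟨w, i, fun g hg => (hw g hg).isLetter, hi, hx⟩

theorem smul_mem_filH {u : U} {m : ℕ → ℕ} (hm : Monotone m)
    (h : ∀ w : List Gen, (∀ g ∈ w, IsH g) → ∀ j, u • vec v w j ∈ filH v (m (j + 1)))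
    {k : ℕ} {x : M} (hx : x ∈ filH v k) : u • x ∈ filH v (m k) := by
  have : filH v k ≤ (filH v (m k)).comap (Algebra.lsmul ℂ ℂ (M) u) := by
    refine Submodule.span_le.mpr ?_
    rintro _ ⟨w, j, hw, hj, rfl⟩
    exact filH_mono (hm hj) (h w hw j)
  exact this hx

theorem H_neg_smul_mem_filH {n : ℤ} (hn : n < 0) {k : ℕ} {x : M} (hx : x ∈ filH v k) :
    gen (.H n) • x ∈ filH v k := by
  refine smul_mem_filH (m := id) monotone_id (fun w hw j => ?_) hx
  rw [← vec_cons]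
  exact vec_mem_filH (by simpa using ⟨⟨n, hn, rfl⟩, hw⟩) (Nat.lt_succ_self j)

theorem t_smul_mem_filH {k : ℕ} {x : M} (hx : x ∈ filH v k) :
    gen (.L (-1)) • x ∈ filH v (k + 1) := by
  refine smul_mem_filH (m := fun k => k + 1) (fun _ _ h => Nat.succ_le_succ h)
    (fun w hw j => ?_) hx
  induction w with
  | nil =>
    rw [← vec_nil_succ]
    exact vec_mem_filH hw (by lia)
  | cons y w ih =>
    obtain ⟨n, hn, rfl⟩ := hw y (by simp)
    have hw' : ∀ g ∈ w, IsH g := fun g hg => hw g (by simp [hg])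
    rw [vec_cons, gen_smul_smul, sgn_L_left, one_smul]
    simp only [brv, if_neg (show ¬ (-1 + n = 0) by lia), zero_smul, add_zero]
    refine Submodule.add_mem _ (H_neg_smul_mem_filH hn (ih hw')) (Submodule.smul_mem _ _ ?_)
    exact H_neg_smul_mem_filH (by lia) (vec_mem_filH hw' (by lia))

theorem H_smul_t_smul (b : ℤ) (x : M) : gen (.H b) • gen (.L (-1)) • x =
    gen (.L (-1)) • gen (.H b) • x + (b : ℂ) • gen (.H (b - 1)) • x := by
  rw [gen_smul_smul, sgn_L_right, one_smul]
  simp only [brv, Int.cast_neg, Int.cast_one]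
  norm_num
  rfl

theorem famT_H_commutator (a b n : ℤ) (x : M) :
    famT a b • gen (.H n) • x = gen (.H n) • famT a b • x +
      (2 : ℂ) • (brv (fun g => gen (.L a) • gen g • x) (.H b) (.H n) +
        brv (fun g => gen g • gen (.H b) • x) (.L a) (.H n)) +
      (gen (.G (a + n)) • gen (.Q b) • x - gen (.G a) • gen (.Q (b + n)) • x) := by
  have h1 := map_brv ((Algebra.lsmul ℂ ℂ M (gen (.L a)))) (fun g => gen g • x) (.H b) (.H n)
  simp only [Algebra.lsmul_coe] at h1
  simp only [famT, sub_smul, smul_assoc, mul_smul, smul_sub, smul_add]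
  have h2 := map_brv ((Algebra.lsmul ℂ ℂ M (gen (.G a)))) (fun g => gen g • x) (.Q b) (.H n)
  simp only [Algebra.lsmul_coe] at h2
  rw [gen_smul_smul (.H b), gen_smul_smul (.Q b), sgn_H_right, sgn_H_right, one_smul, one_smul,
    smul_add, h1, smul_add, smul_add, h2, gen_smul_smul (.L a) (.H n), gen_smul_smul (.G a) (.H n),
    sgn_H_right, sgn_H_right, one_smul, one_smul, smul_comm (gen (.H n)) (2 : ℂ)]
  simp only [brv, smul_add]
  abel

section
variable (hv : IsChiralVec c q v)
include hv

theorem H_zero_smul_vec_nil (k : ℕ) : gen (.H 0) • vec v [] k = q • vec v [] k := by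
  induction k with
  | zero => rw [vec_nil_zero, hv (.H 0) le_rfl, hwChar, if_pos rfl]
  | succ k ih => rw [vec_nil_succ, H_smul_t_smul, ih, Int.cast_zero, zero_smul, add_zero,
      smul_comm]

/-- Since [H_b, L_{-1}] = b H_{b-1}, a positive H_b acts only by consuming factors L_{-1}. The power
drops strictly, leaving room for the factor L_a in `famT_smul_vec_nil`. -/
theorem H_pos_smul_vec_nil {b : ℤ} (hb : 0 < b) (k : ℕ) :
    gen (.H b) • vec v [] k ∈ filH v k := by
  induction k generalizing b with
  | zero =>
    rw [vec_nil_zero, hv (.H b) hb.le, hwChar, if_neg hb.ne', zero_smul]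
    exact Submodule.zero_mem _
  | succ k ih =>
    rw [vec_nil_succ, H_smul_t_smul]
    refine Submodule.add_mem _ (t_smul_mem_filH (ih hb)) (Submodule.smul_mem _ _ ?_)
    rcases eq_or_ne b 1 with rfl | h1
    · rw [sub_self, H_zero_smul_vec_nil hv]
      exact Submodule.smul_mem _ _ (vec_mem_filH (by simp) (Nat.lt_succ_self k))
    · exact filH_mono (Nat.le_succ k) (ih (by lia))

theorem H_nonneg_smul_vec_nil {b : ℤ} (hb : 0 ≤ b) (k : ℕ) :
    gen (.H b) • vec v [] k ∈ filH v (k + 1) := by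
  rcases hb.eq_or_lt with rfl | h
  · rw [H_zero_smul_vec_nil hv]
    exact Submodule.smul_mem _ _ (vec_mem_filH (by simp) (Nat.lt_succ_self k))
  · exact filH_mono (Nat.le_succ k) (H_pos_smul_vec_nil hv h k)

theorem H_smul_mem_filH (b : ℤ) {k : ℕ} {x : M} (hx : x ∈ filH v k) :
    gen (.H b) • x ∈ filH v k := by
  rcases lt_or_ge b 0 with hb | hb
  · exact H_neg_smul_mem_filH hb hx
  refine smul_mem_filH (m := id) monotone_id (fun w hw j => ?_) hx
  induction w with
  | nil => exact H_nonneg_smul_vec_nil hv hb j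
  | cons y w ih =>
    obtain ⟨n, hn, rfl⟩ := hw y (by simp)
    have hw' : ∀ g ∈ w, IsH g := fun g hg => hw g (by simp [hg])
    rw [vec_cons, gen_smul_smul, sgn_H_left, one_smul]
    refine Submodule.add_mem _ (H_neg_smul_mem_filH hn (ih hw')) ?_
    simp only [brv]
    rw [gen_C_smul_vec hv]
    exact Submodule.smul_mem _ _ (Submodule.smul_mem _ _ (vec_mem_filH hw' (Nat.lt_succ_self j)))

/-- Since [Q_b, L_{-1}] = b Q_{b-1} has coefficient 0 at b = 0, the letter Q_{-1} is never reached.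
-/
theorem Q_nonneg_smul_vec_nil {b : ℤ} (hb : 0 ≤ b) (k : ℕ) : gen (.Q b) • vec v [] k = 0 := by
  induction k generalizing b with
  | zero =>
    rw [vec_nil_zero, hv (.Q b) hb]
    exact zero_smul _ _
  | succ k ih =>
    rw [vec_nil_succ, gen_smul_smul, ih hb, smul_zero, smul_zero, zero_add]
    simp only [brv]
    rcases hb.eq_or_lt with rfl | h
    · rw [Int.cast_zero, zero_smul]
    · rw [ih (by lia), smul_zero]

/-- For b < 0 the letters H_b and Q_b are moved to the left; the brackets have index a + b ≥ 0 and
so create no new L_{-1}. For b ≥ 0 the factor Q_b kills the vector and H_b is a scalar or lowers the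
power. -/
theorem famT_smul_vec_nil {a b : ℤ} (h : 0 ≤ a + b) (k : ℕ) :
    famT a b • vec v [] k ∈ fil v (k + 1) := by
  have h0 : ∀ k, vec v [] k ∈ fil v (k + 1) := fun k => vec_mem_fil (by simp) (Nat.lt_succ_self k)
  have hC : gen .C • vec v [] k ∈ fil v (k + 1) := keeps_C hv _ _ (h0 k)
  rw [famT, sub_smul, smul_assoc, mul_smul, mul_smul]
  rcases lt_or_ge b 0 with hb | hb
  · have hL := nonneg_smul_vec_nil hv (z := .L a) (show 0 ≤ a by lia) k
    have hG := nonneg_smul_vec_nil hv (z := .G a) (show 0 ≤ a by lia) k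
    rw [gen_smul_smul, gen_smul_smul (.G a)]
    simp only [brv]
    have hs := nonneg_smul_vec_nil hv (z := .L (a + b)) h k
    have hs' := nonneg_smul_vec_nil hv (z := .H (a + b)) h k
    have hl : ∀ {x : M}, x ∈ fil v (k + 1) → gen (.H b) • x ∈ fil v (k + 1) :=
      fun hx => letter_smul_mem (y := .H b) ⟨hb, by simp⟩ hx
    have hl' : ∀ {x : M}, x ∈ fil v (k + 1) → gen (.Q b) • x ∈ fil v (k + 1) :=
      fun hx => letter_smul_mem (y := .Q b) ⟨hb, by simp⟩ hx
    have sm := fun (r : ℂ) {x : M} (hx : x ∈ fil v (k + 1)) => Submodule.smul_mem _ r hx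
    exact Submodule.sub_mem _ (sm _ (Submodule.add_mem _ (sm _ (hl hL))
      (Submodule.add_mem _ (sm _ hs') (sm _ hC)))) (Submodule.add_mem _ (sm _ (hl' hG))
      (Submodule.add_mem _ (Submodule.sub_mem _ (sm _ hs) (sm _ hs')) (sm _ hC)))
  · rw [Q_nonneg_smul_vec_nil hv hb, smul_zero, sub_zero]
    refine Submodule.smul_mem _ _ ?_
    rcases hb.eq_or_lt with rfl | hb
    · rw [H_zero_smul_vec_nil hv, smul_comm]
      exact Submodule.smul_mem _ _ (nonneg_smul_vec_nil hv (z := .L a) (show 0 ≤ a by lia) k)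
    · exact gen_smul_mem hv _ (filH_le_fil _ (H_pos_smul_vec_nil hv hb k))

/-- On a word in the `H_n`, the generators `L_m` with `m ≠ -1` act by lower powers. -/
theorem mkQ_L_smul_vec {w : List Gen} (hw : ∀ g ∈ w, IsH g) (m : ℤ) (k : ℕ) :
    (fil v (k + 1)).mkQ (gen (.L m) • vec v w k) =
      (if m = -1 then 1 else 0 : ℂ) • (fil v (k + 1)).mkQ (vec v w (k + 1)) := by
  have hw' : ∀ g ∈ w, IsLetter g := fun g hg => (hw g hg).isLetter
  split_ifs with h
  · subst h
    rw [one_smul, ← sub_eq_zero, ← map_sub, Submodule.mkQ_apply, Submodule.Quotient.mk_eq_zero]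
    exact t_smul_vec hw' k
  · rw [zero_smul, Submodule.mkQ_apply, Submodule.Quotient.mk_eq_zero]
    rcases idx_trichotomy (.L m) with h' | h' | h'
    · exact nonneg_smul_vec_H hv h' hw k
    · exact letter_smul_mem h' (vec_mem_fil hw' (Nat.lt_succ_self k))
    · exact absurd (by simpa using h') h

theorem mkQ_GQ_of_left_neg {w : List Gen} (hw : ∀ g ∈ w, IsH g) {a : ℤ} (ha : a < 0) (b : ℤ)
    (k : ℕ) : (fil v (k + 1)).mkQ (gen (.G a) • gen (.Q b) • vec v w k) = 0 := by
  have hw' : ∀ g ∈ w, IsLetter g := fun g hg => (hw g hg).isLetter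
  rw [Submodule.mkQ_apply, Submodule.Quotient.mk_eq_zero]
  refine letter_smul_mem (y := .G a) ⟨ha, by simp⟩ ?_
  rcases idx_trichotomy (.Q b) with h' | h' | h'
  · exact nonneg_smul_vec_H hv h' hw k
  · exact letter_smul_mem h' (vec_mem_fil hw' (Nat.lt_succ_self k))
  · exact absurd h' (by simp)

/-- Moving the letter Q_b to the left leaves only the summand 2L_{a+b} of the anticommutator at
leading order, and this counts only if it is L_{-1}. -/
theorem mkQ_GQ_of_right_neg {w : List Gen} (hw : ∀ g ∈ w, IsH g) (a : ℤ) {b : ℤ} (hb : b < 0)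
    (k : ℕ) : (fil v (k + 1)).mkQ (gen (.G a) • gen (.Q b) • vec v w k) =
      (if a + b = -1 then 2 else 0 : ℂ) • (fil v (k + 1)).mkQ (vec v w (k + 1)) := by
  have hw' : ∀ g ∈ w, IsLetter g := fun g hg => (hw g hg).isLetter
  have hG : gen (.Q b) • gen (.G a) • vec v w k ∈ fil v (k + 1) := by
    refine letter_smul_mem (y := .Q b) ⟨hb, by simp⟩ ?_
    rcases idx_trichotomy (.G a) with h' | h' | h'
    · exact nonneg_smul_vec_H hv h' hw k
    · exact letter_smul_mem h' (vec_mem_fil hw' (Nat.lt_succ_self k))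
    · exact absurd h' (by simp)
  have hH : gen (.H (a + b)) • vec v w k ∈ fil v (k + 1) :=
    filH_le_fil _ (H_smul_mem_filH hv _ (vec_mem_filH hw (Nat.lt_succ_self k)))
  have hC : gen .C • vec v w k ∈ fil v (k + 1) :=
    keeps_C hv _ _ (vec_mem_fil hw' (Nat.lt_succ_self k))
  rw [← Submodule.Quotient.mk_eq_zero] at hG hH hC
  rw [gen_smul_smul]
  simp only [brv]
  simp only [map_add, map_sub, LinearMap.map_smul, mkQ_L_smul_vec hv hw]
  simp only [Submodule.mkQ_apply, hG, hH, hC, smul_zero, zero_add, sub_zero, add_zero]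
  split_ifs <;> module

theorem mkQ_famT_H_commutator {w : List Gen} (hw : ∀ g ∈ w, IsH g) (a b n : ℤ)
    (k : ℕ) : (fil v (k + 1)).mkQ (famT a b • gen (.H n) • vec v w k) =
      (fil v (k + 1)).mkQ (gen (.H n) • famT a b • vec v w k) +
      (if a = -1 then (if b + n = 0 then 2 * c * b / 3 else 0) else 0 : ℂ) •
        (fil v (k + 1)).mkQ (vec v w (k + 1)) +
      ((fil v (k + 1)).mkQ (gen (.G (a + n)) • gen (.Q b) • vec v w k) -
        (fil v (k + 1)).mkQ (gen (.G a) • gen (.Q (b + n)) • vec v w k)) := by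
  have hw' : ∀ g ∈ w, IsLetter g := fun g hg => (hw g hg).isLetter
  have hb := H_smul_mem_filH hv b (vec_mem_filH (v := v) hw (Nat.lt_succ_self k))
  have hH : gen (.H (a + n)) • gen (.H b) • vec v w k ∈ fil v (k + 1) :=
    filH_le_fil _ (H_smul_mem_filH hv _ hb)
  have hC : gen .C • gen (.H b) • vec v w k ∈ fil v (k + 1) := keeps_C hv _ _ (filH_le_fil _ hb)
  rw [← Submodule.Quotient.mk_eq_zero] at hH hC
  rw [famT_H_commutator]
  simp only [brv]
  rw [gen_C_smul_vec hv, smul_comm (gen (.L a)) c]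
  simp only [map_add, map_sub, LinearMap.map_smul, mkQ_L_smul_vec hv hw]
  simp only [Submodule.mkQ_apply, hH, hC, smul_zero, add_zero]
  split_ifs <;> module

end

/-- The sum of the words obtained by removing one occurrence of `H_{-h}`. -/
noncomputable def remH (h : ℤ) : List Gen → WordSpace
  | [] => 0
  | .H n :: w => (if n = -h then 1 else 0 : ℂ) • Finsupp.single w 1 + consW (.H n) (remH h w)
  | y :: w => consW y (remH h w)

theorem quad_famT_smul_vec_H (hv : IsChiralVec c q v) {s : ℤ} (hs : 0 ≤ s) {w : List Gen}
    (hw : ∀ g ∈ w, IsH g) (k : ℕ) : (fil v (k + 1)).mkQ (quad famT s • vec v w k) =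
      (2 * (s + 1) * (c / 3 - 1)) • (fil v (k + 1)).mkQ (vecL v (k + 1) (remH (s + 1) w)) := by
  induction w with
  | nil =>
    rw [remH, map_zero, map_zero, smul_zero, Submodule.mkQ_apply, Submodule.Quotient.mk_eq_zero,
      quad, Finset.sum_smul]
    exact Submodule.sum_mem _ fun a _ => famT_smul_vec_nil hv (by lia) k
  | cons y w ih =>
    obtain ⟨n, hn, rfl⟩ := hw y (by simp)
    have hw' : ∀ g ∈ w, IsH g := fun g hg => hw g (by simp [hg])
    replace ih := ih hw'
    have hl : (fil v (k + 1)).mkQ (gen (.H n) • quad famT s • vec v w k) =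
        (2 * (s + 1) * (c / 3 - 1)) • (fil v (k + 1)).mkQ (vecL v (k + 1)
          (consW (.H n) (remH (s + 1) w))) := by
      rw [vecL_consW]
      rw [← map_smul, ← sub_eq_zero, ← map_sub, Submodule.mkQ_apply,
        Submodule.Quotient.mk_eq_zero] at ih ⊢
      rw [← smul_comm (gen (.H n)) (_ : ℂ), ← smul_sub]
      exact letter_smul_mem (y := .H n) ⟨hn, by simp⟩ ih
    set T := (fil v (k + 1)).mkQ (vec v w (k + 1)) with hT
    obtain ⟨p, rfl⟩ := Int.exists_eq_neg_ofNat hn.le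
    -- The terms G_{a-p} Q_{s-a} - G_a Q_{s-p-a} telescope. Modulo `fil v (k + 1)` they vanish when
    -- G has negative index, and are constant when Q has: 2 times the leading vector if s - p = -1,
    -- and 0 otherwise.
    have h1 := sum_Icc_shift_sub
      (fun a => (fil v (k + 1)).mkQ (gen (.G a) • gen (.Q (s - p - a)) • vec v w k))
      ((if s - p = -1 then 2 else 0 : ℂ) • T) (A := -2) (B := s + 2) (m := s - p) (by lia) p
      (fun a ha => mkQ_GQ_of_left_neg hv hw' (by lia) _ k)
      (fun a ha => by rw [mkQ_GQ_of_right_neg hv hw' a (by lia), add_sub_cancel]) (by lia)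
    rw [vec_cons, quad, Finset.sum_smul, map_sum]
    have h2 : ∀ a : ℤ, s - p - (a - p) = s - a := fun a => by ring
    have h3 : ∀ a : ℤ, s - p - a = s - a + -p := fun a => by ring
    simp only [h2] at h1
    simp only [h3] at h1
    simp only [mkQ_famT_H_commutator hv hw', Finset.sum_add_distrib, ← hT]
    simp only [← sub_eq_add_neg (_ : ℤ) (p : ℤ)] at h1 ⊢
    rw [h1, ← map_sum, ← Finset.smul_sum, ← Finset.sum_smul, ← quad, hl, ← Finset.sum_smul,
      Finset.sum_ite_eq', remH, map_add, map_smul, vecL_single, one_smul, map_add, map_smul, ← hT]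
    rw [if_pos (by rw [Finset.mem_Icc]; lia), ← Nat.cast_smul_eq_nsmul ℂ]
    -- For p = s + 1 the term 2L_{-1}[H_{s+1}, H_{-p}] gives 2(s+1)c/3 and the telescoped GQ terms
    -- give -2(s+1). For all other p both vanish.
    by_cases hp : s - p = -1
    · have hp' : (p : ℂ) = s + 1 := by
        have : (p : ℤ) = s + 1 := by lia
        exact_mod_cast this
      rw [if_pos (by lia), if_pos hp, if_pos (by lia), hp']
      push_cast
      module
    · rw [if_neg (by lia), if_neg hp, if_neg (by lia)]
      module

end

/-! ### Contractions of words and ordered words. -/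

open Polynomial in
/-- The properties of the Whittaker functional `exists_whittaker`. -/
structure IsWhittaker {M : Type*} [AddCommGroup M] [Module U M] [Module ℂ M] (v : M)
    (f : M →ₗ[ℂ] ℂ[X]) : Prop where
  map_vec : f v = 1
  map_t : ∀ y, f (gen (.L (-1)) • y) = X * f y
  map_letter : ∀ g, IsLetter g → ∀ y, f (gen g • y) = 0

/-- The sum over the letters `g` of a word of the word without `g`, with the coefficient `β g` and
a factor `σ g'` for each letter `g'` to the left of `g`. -/
noncomputable def contract (β σ : Gen → ℂ) : List Gen → WordSpace
  | [] => 0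
  | y :: w => β y • Finsupp.single w 1 + σ y • consW y (contract β σ w)

theorem rem_eq_contract (z : Gen) (w : List Gen) :
    rem z w = contract (fun g => brv isT z g) (sgn z) w := by
  induction w with
  | nil => rfl
  | cons y w ih => rw [rem, contract, ih]

open Classical in
theorem remH_eq_contract (h : ℤ) (w : List Gen) :
    remH h w = contract (fun g => if g = .H (-h) then 1 else 0) (fun _ => 1) w := by
  induction w with
  | nil => rfl
  | cons y w ih => cases y <;> simp [remH, contract, ih]

theorem contract_mem_subwords (β σ : Gen → ℂ) (w : List Gen) :
    contract β σ w ∈ subwords 1 w := by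
  induction w with
  | nil => exact Submodule.zero_mem _
  | cons y w ih =>
    exact Submodule.add_mem _
      (Submodule.smul_mem _ _ (single_mem_subwords (List.sublist_cons_self y w) (by simp)))
      (Submodule.smul_mem _ _ (consW_mem_subwords y ih))

theorem consW_apply_nil (g : Gen) (r : WordSpace) : consW g r [] = 0 := by
  induction r using Finsupp.induction_linear with
  | zero => simp
  | add u v hu hv => simp [hu, hv]
  | single w a => simp [consW_single]

theorem consW_apply_cons (g : Gen) (r : WordSpace) (u : List Gen) :
    consW g r (g :: u) = r u := by
  classical
  induction r using Finsupp.induction_linear with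
  | zero => simp
  | add u v hu hv => simp [hu, hv]
  | single w a => simp [consW_single, Finsupp.single_apply]

theorem consW_apply_of_ne {g g' : Gen} (h : g ≠ g') (r : WordSpace) (u : List Gen) :
    consW g r (g' :: u) = 0 := by
  classical
  induction r using Finsupp.induction_linear with
  | zero => simp
  | add u v hu hv => simp [hu, hv]
  | single w a => simp [consW_single, h]

/-- For ordered words this makes the contracted word determine the original one, so different words
cannot cancel each other after contraction. -/
theorem perm_of_contract_ne_zero {β σ : Gen → ℂ} {y : Gen} (hβ : ∀ g, β g ≠ 0 → g = y)
    {w u : List Gen} (h : contract β σ w u ≠ 0) : w.Perm (y :: u) := by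
  classical
  induction w generalizing u with
  | nil => exact absurd rfl h
  | cons g w ih =>
    rw [contract, Finsupp.add_apply, Finsupp.smul_apply, Finsupp.smul_apply,
      Finsupp.single_apply] at h
    by_cases h1 : β g ≠ 0 ∧ w = u
    · rw [hβ g h1.1, h1.2]
    · have h2 : consW g (contract β σ w) u ≠ 0 := by
        intro h2
        refine h ?_
        rw [h2, smul_zero, add_zero]
        by_cases h3 : β g = 0
        · simp [h3]
        · simp [show w ≠ u from fun h4 => h1 ⟨h3, h4⟩]
      rcases u with _ | ⟨g', u⟩
      · exact absurd (consW_apply_nil _ _) h2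
      · rcases eq_or_ne g g' with rfl | hg
        · rw [consW_apply_cons] at h2
          exact ((ih h2).cons g).trans (List.Perm.swap y g u)
        · exact absurd (consW_apply_of_ne hg _ _) h2

theorem contract_eq_zero {β σ : Gen → ℂ} {w : List Gen} (h : ∀ g ∈ w, β g = 0) :
    contract β σ w = 0 := by
  induction w with
  | nil => rfl
  | cons g w ih =>
    rw [contract, h g (by simp), ih fun g hg => h g (by simp [hg])]
    simp

-- An odd letter occurs at most once in an ordered word, so a single summand contributes and its
-- sign is harmless.
open Classical in
theorem contract_erase_ne_zero_of_nodup {β σ : Gen → ℂ} {y : Gen} (hβ : ∀ g, β g ≠ 0 → g = y)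
    (hy : β y ≠ 0) (hσ : ∀ g, σ g ≠ 0) {w : List Gen} (hw : w.Pairwise fun a b => ¬(a = y ∧ b = y))
    (hyw : y ∈ w) : contract β σ w (w.erase y) ≠ 0 := by
  induction w with
  | nil => simp at hyw
  | cons g w ih =>
    rw [List.pairwise_cons] at hw
    rcases eq_or_ne g y with rfl | hg
    · rw [contract, contract_eq_zero fun b hb => ?_]
      · simpa using hy
      · by_contra h
        exact hw.1 b hb ⟨rfl, hβ b h⟩
    · rw [contract, show β g = 0 by by_contra h; exact hg (hβ g h), zero_smul, zero_add,
        List.erase_cons_tail (by simpa using hg), Finsupp.smul_apply, consW_apply_cons]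
      exact smul_ne_zero (hσ g) (ih hw.2 (by simpa [hg.symm] using hyw))

/-- With trivial signs the coefficients count occurrences, so the contributions of a repeated even
letter cannot cancel. -/
theorem contract_apply_nat {β : Gen → ℂ} {y : Gen} (hβ : ∀ g, β g ≠ 0 → g = y)
    (w u : List Gen) : ∃ n : ℕ, contract β (fun _ => 1) w u = n * β y := by
  classical
  induction w generalizing u with
  | nil => exact ⟨0, by simp [contract]⟩
  | cons g w ih =>
    have h1 : ∃ n : ℕ, (β g • Finsupp.single w (1 : ℂ)) u = n * β y := by
      rw [Finsupp.smul_apply, Finsupp.single_apply]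
      by_cases h : β g ≠ 0 ∧ w = u
      · exact ⟨1, by simp [h.2, hβ g h.1]⟩
      · refine ⟨0, ?_⟩
        by_cases h3 : β g = 0
        · simp [h3]
        · simp [show w ≠ u from fun h4 => h ⟨h3, h4⟩]
    have h2 : ∃ n : ℕ, consW g (contract β (fun _ => 1) w) u = n * β y := by
      rcases u with _ | ⟨g', u⟩
      · exact ⟨0, by simp [consW_apply_nil]⟩
      · rcases eq_or_ne g g' with rfl | hg
        · rw [consW_apply_cons]
          exact ih u
        · exact ⟨0, by simp [consW_apply_of_ne hg]⟩
    obtain ⟨a, ha⟩ := h1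
    obtain ⟨b, hb⟩ := h2
    refine ⟨a + b, ?_⟩
    rw [contract, Finsupp.add_apply, ha, one_smul, hb]
    push_cast
    ring

open Classical in
theorem contract_erase_ne_zero {β : Gen → ℂ} {y : Gen} (hβ : ∀ g, β g ≠ 0 → g = y)
    (hy : β y ≠ 0) {w : List Gen} (hyw : y ∈ w) : contract β (fun _ => 1) w (w.erase y) ≠ 0 := by
  induction w with
  | nil => simp at hyw
  | cons g w ih =>
    rcases eq_or_ne g y with rfl | hg
    · have h2 : ∃ n : ℕ, consW g (contract β (fun _ => 1) w) w = n * β g := by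
        rcases w with _ | ⟨g', u⟩
        · exact ⟨0, by simp [consW_apply_nil]⟩
        · rcases eq_or_ne g g' with rfl | hg
          · rw [consW_apply_cons]
            exact contract_apply_nat hβ _ u
          · exact ⟨0, by simp [consW_apply_of_ne hg]⟩
      obtain ⟨n, hn⟩ := h2
      rw [contract, List.erase_cons_head, Finsupp.add_apply, one_smul, hn]
      have : (1 + n : ℂ) ≠ 0 := by exact_mod_cast (by lia : 1 + n ≠ 0)
      simpa [← one_add_mul] using ⟨this, hy⟩
    · rw [contract, show β g = 0 by by_contra h; exact hg (hβ g h), zero_smul, zero_add, one_smul,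
        List.erase_cons_tail (by simpa using hg), consW_apply_cons]
      exact ih (by simpa [hg.symm] using hyw)

/-- The type of a letter, in the order in which the types appear in a word. -/
def Gen.kind : Gen → ℕ
  | .L _ => 0
  | .H _ => 1
  | .G n => if n = -1 then 4 else 2
  | .Q n => if n = -1 then 5 else 3
  | .C => 6

/-- The order of the letters in an ordered word. -/
def letterLE (g g' : Gen) : Prop :=
  g.kind < g'.kind ∨ (g.kind = g'.kind ∧ (g.idx < g'.idx ∨ (g.idx = g'.idx ∧ g.odd = false)))

theorem letterLE_antisymm {g g' : Gen} (h : letterLE g g') (h' : letterLE g' g) : g = g' := by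
  have h1 : g.kind = g'.kind := by unfold letterLE at h h'; lia
  have h2 : g.idx = g'.idx := by unfold letterLE at h h'; lia
  rcases g with a | a | a | a | _ <;> rcases g' with b | b | b | b | _ <;>
    simp only [Gen.kind, Gen.idx] at h1 h2 <;> (try split_ifs at h1) <;> simp_all

/-- The ordered words of letters. -/
def Ordered (w : List Gen) : Prop := w.Pairwise letterLE ∧ ∀ g ∈ w, IsLetter g

theorem Ordered.sublist {w w' : List Gen} (hw : Ordered w) (h : w'.Sublist w) : Ordered w' :=
  ⟨hw.1.sublist h, fun g hg => hw.2 g (h.subset hg)⟩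

theorem Ordered.eq_of_perm {w w' : List Gen} (hw : Ordered w) (hw' : Ordered w')
    (h : w.Perm w') : w = w' :=
  h.eq_of_pairwise (fun _ _ _ _ => letterLE_antisymm) hw.1 hw'.1

theorem sgn_ne_zero (x y : Gen) : sgn x y ≠ 0 := by
  unfold sgn; split_ifs <;> simp

/-- Each letter that is not an `H_n` has a dual operator of nonnegative index. -/
theorem exists_dual {y : Gen} (hy : IsLetter y) (hH : ¬ IsH y) : ∃ z : Gen, 0 ≤ z.idx ∧
    (∀ g, brv isT z g ≠ 0 → g = y) ∧ brv isT z y ≠ 0 ∧ (y.odd = false → ∀ g, sgn z g = 1) := by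
  obtain ⟨h1, h2⟩ := hy
  rcases y with n | n | n | n | _ <;> simp only [Gen.idx] at h1
  -- The coefficient of L_{-1} in [L_{-1-n}, L_n] is -1 - 2n, which is never zero for an integer n.
  · refine ⟨.L (-1 - n), by simp only [Gen.idx]; lia, fun g hg => ?_, ?_,
      fun _ g => sgn_L_left _ g⟩
    · rcases g with m | m | m | m | _ <;> simp [brv, isT] at hg
      exact congrArg _ (by lia)
    · simp only [brv, isT]
      rw [if_pos (by lia)]
      have : ((-1 - n - n : ℤ) : ℂ) ≠ 0 := by exact_mod_cast (by lia)
      simpa using this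
  · exact absurd ⟨n, h1, rfl⟩ hH
  · refine ⟨.Q (-1 - n), by simp only [Gen.idx]; lia, fun g hg => ?_, ?_, by simp [Gen.odd]⟩
    · rcases g with m | m | m | m | _ <;> simp [brv, isT] at hg
      exact congrArg _ (by lia)
    · simp [brv, isT]
  · refine ⟨.G (-1 - n), by simp only [Gen.idx]; lia, fun g hg => ?_, ?_, by simp [Gen.odd]⟩
    · rcases g with m | m | m | m | _ <;> simp [brv, isT] at hg
      exact congrArg _ (by lia)
    · simp [brv, isT]
  · exact absurd h1 (lt_irrefl 0)

open Classical in
theorem rem_erase_ne_zero {y z : Gen} (h1 : ∀ g, brv isT z g ≠ 0 → g = y) (h2 : brv isT z y ≠ 0)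
    (h3 : y.odd = false → ∀ g, sgn z g = 1) {w : List Gen} (hw : Ordered w) (hy : y ∈ w) :
    rem z w (w.erase y) ≠ 0 := by
  rw [rem_eq_contract]
  cases hodd : y.odd
  · rw [show sgn z = fun _ => 1 from funext (h3 hodd)]
    exact contract_erase_ne_zero h1 h2 hy
  · refine contract_erase_ne_zero_of_nodup h1 h2 (sgn_ne_zero z) (hw.1.imp ?_) hy
    rintro a b h ⟨rfl, rfl⟩
    simp [letterLE, hodd] at h

/-! ### Independence of ordered words modulo a submodule killed by the Whittaker functional. -/

section
variable {M : Type*} [AddCommGroup M] [Module U M] [Module ℂ M] [IsScalarTower ℂ U M]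
variable {v : M} {c q : ℂ}

open Polynomial in
theorem IsWhittaker.map_vec_nil {f : M →ₗ[ℂ] ℂ[X]} (hf : IsWhittaker v f) (k : ℕ) :
    f (vec v [] k) = X ^ k := by
  induction k with
  | zero => rw [vec_nil_zero, hf.map_vec, pow_zero]
  | succ k ih => rw [vec_nil_succ, hf.map_t, ih, pow_succ']

-- The functional f kills every word that begins with a letter, and the empty word with L_{-1}^j
-- contributes X^j with j < k only.
open Polynomial in
theorem IsWhittaker.coeff_fil {f : M →ₗ[ℂ] ℂ[X]} (hf : IsWhittaker v f) {k : ℕ} {x : M}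
    (hx : x ∈ fil v k) : (f x).coeff k = 0 := by
  have : fil v k ≤ LinearMap.ker ((lcoeff ℂ k) ∘ₗ f) := by
    refine Submodule.span_le.mpr ?_
    rintro _ ⟨w, j, hw, hj, rfl⟩
    rw [SetLike.mem_coe, LinearMap.mem_ker, LinearMap.comp_apply, lcoeff_apply]
    rcases w with _ | ⟨y, w⟩
    · rw [hf.map_vec_nil, coeff_X_pow, if_neg hj.ne']
    · rw [vec_cons, hf.map_letter _ (hw y (by simp)), coeff_zero]
  exact this hx

variable (v) in
/-- The conclusion of the nondegeneracy argument for words of length at most `B`. -/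
def Nondeg (J : Submodule U M) (B : ℕ) : Prop :=
  ∀ (a : WordSpace), (∀ w ∈ a.support, Ordered w ∧ w.length ≤ B) →
    ∀ k, vecL v k a ∈ J.restrictScalars ℂ ⊔ fil v k → a = 0

theorem mem_sup_of_smul {J : Submodule U M} {u : U} (hu : u ∈ raise v) {k : ℕ} {x : M}
    (hx : x ∈ J.restrictScalars ℂ ⊔ fil v k) :
    u • x ∈ J.restrictScalars ℂ ⊔ fil v (k + 1) := by
  obtain ⟨a, ha, b, hb, rfl⟩ := Submodule.mem_sup.mp hx
  rw [smul_add]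
  exact Submodule.add_mem _ (Submodule.mem_sup_left (J.smul_mem u ha))
    (Submodule.mem_sup_right (hu k b hb))

theorem smul_vecL_mem {u : U} {k : ℕ} {a : WordSpace} {D : List Gen → WordSpace}
    {S : Submodule ℂ M} (h : ∀ w ∈ a.support, u • vec v w k - vecL v (k + 1) (D w) ∈ S) :
    u • vecL v k a - vecL v (k + 1) (Finsupp.linearCombination ℂ D a) ∈ S := by
  rw [vecL, Finsupp.linearCombination_apply, Finsupp.linearCombination_apply, Finsupp.sum,
    Finsupp.sum, Finset.smul_sum, map_sum, ← Finset.sum_sub_distrib]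
  refine Submodule.sum_mem _ fun w hw => ?_
  rw [map_smul, smul_comm, ← smul_sub]
  exact Submodule.smul_mem _ _ (h w hw)

theorem linearCombination_apply_eq {D : List Gen → WordSpace} {a : WordSpace} {w u : List Gen}
    (h : ∀ w' ∈ a.support, D w' u ≠ 0 → w' = w) :
    Finsupp.linearCombination ℂ D a u = a w * D w u := by
  rw [Finsupp.linearCombination_apply, Finsupp.sum, Finsupp.finsetSum_apply,
    Finset.sum_eq_single w]
  · rfl
  · intro w' hw' hne
    rw [Finsupp.smul_apply, smul_eq_mul]
    by_contra h0
    exact hne (h w' hw' (right_ne_zero_of_mul h0))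
  · intro hw
    rw [Finsupp.notMem_support_iff.mp hw, zero_smul, Finsupp.zero_apply]

/-- The formal sums of ordered words of length less than `n`. -/
noncomputable def short (n : ℕ) : Submodule ℂ WordSpace :=
  Finsupp.supported ℂ ℂ {w | Ordered w ∧ w.length < n}

theorem short_mono {m n : ℕ} (h : m ≤ n) : short m ≤ short n :=
  Finsupp.supported_mono fun _ hw => ⟨hw.1, hw.2.trans_le h⟩

theorem subwords_le_short {w : List Gen} (hw : Ordered w) {d n : ℕ} (h : w.length < n + d) :
    subwords d w ≤ short n :=
  Finsupp.supported_mono fun w' ⟨h1, h2⟩ => ⟨hw.sublist h1, by lia⟩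

theorem Nondeg.eq_zero {J : Submodule U M} {B : ℕ} (h : Nondeg v J B) {a : WordSpace}
    (ha : a ∈ short (B + 1)) {k : ℕ} (hk : vecL v k a ∈ J.restrictScalars ℂ ⊔ fil v k) : a = 0 :=
  h a (fun w hw => by
    have := (Finsupp.mem_supported ℂ a).mp ha hw
    exact ⟨this.1, Nat.lt_succ_iff.mp this.2⟩) k hk

theorem nondeg_zero {f : M →ₗ[ℂ] Polynomial ℂ} (hf : IsWhittaker v f) {J : Submodule U M}
    (hJ : ∀ y ∈ J, f y = 0) : Nondeg v J 0 := by
  intro a ha k hk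
  have h0 : a = Finsupp.single [] (a []) := by
    refine Finsupp.support_subset_singleton.mp fun w hw => ?_
    simpa using (ha w hw).2
  rw [h0, vecL_single] at hk
  obtain ⟨x, hx, y, hy, hxy⟩ := Submodule.mem_sup.mp hk
  have h1 := congrArg (fun z => (f z).coeff k) hxy
  simp only [map_add, hJ x hx, zero_add, hf.coeff_fil hy, LinearMap.map_smul, hf.map_vec_nil,
    Polynomial.coeff_smul, Polynomial.coeff_X_pow_self, smul_eq_mul, mul_one] at h1
  rw [h0, ← h1, Finsupp.single_zero]

/-- Among the words containing a letter other than H_n take a longest one, w, and contract such a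
letter y of w by its dual generator z. The coefficient at w without y comes from w alone, while the
induction hypothesis makes the contracted sum vanish. -/
theorem Nondeg.isH (hv : IsChiralVec c q v) {J : Submodule U M} {B : ℕ} (h : Nondeg v J B)
    {a : WordSpace} (ha : ∀ w ∈ a.support, Ordered w ∧ w.length ≤ B + 1) {k : ℕ}
    (hk : vecL v k a ∈ J.restrictScalars ℂ ⊔ fil v k) : ∀ w ∈ a.support, ∀ g ∈ w, IsH g := by
  classical
  by_contra! hcon
  obtain ⟨w, hw, hmax⟩ := Finset.exists_max_image
    (a.support.filter fun w => ∃ g ∈ w, ¬ IsH g) List.length (by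
      obtain ⟨w, hw, g, hg, hH⟩ := hcon
      exact ⟨w, by simpa using ⟨by simpa using hw, g, hg, hH⟩⟩)
  rw [Finset.mem_filter] at hw
  obtain ⟨hw, y, hy, hyH⟩ := hw
  obtain ⟨z, hz, hz1, hz2, hz3⟩ := exists_dual ((ha w hw).1.2 y hy) hyH
  -- Words in the H_n alone may be longer than w, but z acts on them without raising the power of
  -- L_{-1}, so they contribute neither a leading term nor an error term in subwords.
  set D : List Gen → WordSpace := fun w' => if ∃ g ∈ w', ¬ IsH g then rem z w' else 0 with hD
  have hS : ∀ w' ∈ a.support, gen z • vec v w' k - vecL v (k + 1) (D w') ∈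
      (short (w.length - 1)).map (vecL v (k + 1)) ⊔ fil v (k + 1) := by
    intro w' hw'
    have hlet := (ha w' hw').1.2
    by_cases hN : ∃ g ∈ w', ¬ IsH g
    · simp only [hD, if_pos hN]
      refine mem_map_sup_mono (subwords_le_short (ha w' hw').1 ?_) (nonneg_smul_vec hv hz hlet k)
      have := hmax w' (Finset.mem_filter.mpr ⟨hw', hN⟩)
      have h0 : 0 < w.length := List.length_pos_of_mem hy
      lia
    · simp only [hD, if_neg hN, map_zero, sub_zero]
      push Not at hN
      exact Submodule.mem_sup_right (nonneg_smul_vec_H hv hz hN k)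
  obtain ⟨_, ⟨s, hs, rfl⟩, b, hb, hsb⟩ := Submodule.mem_sup.mp (smul_vecL_mem hS)
  have hDs : Finsupp.linearCombination ℂ D a ∈ short (B + 1) := by
    rw [Finsupp.linearCombination_apply]
    refine Submodule.sum_mem _ fun w' hw' => Submodule.smul_mem _ _ ?_
    simp only [hD]
    split_ifs
    · exact subwords_le_short (ha w' hw').1 (Nat.lt_succ_of_le (ha w' hw').2)
        (rem_mem_subwords z w')
    · exact Submodule.zero_mem _
  have h0 : Finsupp.linearCombination ℂ D a + s = 0 := by
    refine h.eq_zero (k := k + 1)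
      (Submodule.add_mem _ hDs (short_mono (by have := (ha w hw).2; lia) hs)) ?_
    rw [map_add, show vecL v (k + 1) (Finsupp.linearCombination ℂ D a) + vecL v (k + 1) s =
      gen z • vecL v k a - b by rw [eq_sub_iff_add_eq, add_assoc, hsb]; abel]
    exact Submodule.sub_mem _ (mem_sup_of_smul (gen_mem_raise hv z) hk)
      (Submodule.mem_sup_right hb)
  have h1 := DFunLike.congr_fun h0 (w.erase y)
  -- The error terms have lost at least two letters, hence are shorter than w without y.
  have h2 : s (w.erase y) = 0 := by
    by_contra hne
    have := ((Finsupp.mem_supported ℂ s).mp hs (Finsupp.mem_support_iff.mpr hne)).2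
    rw [List.length_erase_of_mem hy] at this
    exact lt_irrefl _ this
  rw [Finsupp.add_apply, h2, add_zero, linearCombination_apply_eq (w := w)] at h1
  · have h3 : D w = rem z w := if_pos ⟨y, hy, hyH⟩
    rw [h3] at h1
    exact mul_ne_zero (Finsupp.mem_support_iff.mp hw) (rem_erase_ne_zero hz1 hz2 hz3 (ha w hw).1 hy)
      h1
  · intro w' hw' hne
    have h3 : rem z w' (w.erase y) ≠ 0 := by
      intro h3
      refine hne ?_
      simp only [hD]
      split_ifs
      · exact h3
      · rfl
    rw [rem_eq_contract] at h3
    exact (ha w' hw').1.eq_of_perm (ha w hw).1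
      ((perm_of_contract_ne_zero hz1 h3).trans (List.perm_cons_erase hy).symm)

/-- By `Nondeg.isH` only words in the H_n remain. If one contains H_n, the operator T_s with s = -n
- 1 removes this letter with a coefficient that is nonzero because c ≠ 3, and the induction
hypothesis applies to the shortened words. -/
theorem Nondeg.succ (hc : c ≠ 3) (hv : IsChiralVec c q v) {f : M →ₗ[ℂ] Polynomial ℂ}
    (hf : IsWhittaker v f) {J : Submodule U M} (hJ : ∀ y ∈ J, f y = 0) {B : ℕ}
    (h : Nondeg v J B) : Nondeg v J (B + 1) := by
  classical
  intro a ha k hk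
  have hH := h.isH hv ha hk
  by_cases hnil : ∀ w ∈ a.support, w = []
  · exact nondeg_zero hf hJ a (fun w hw => ⟨(ha w hw).1, by simp [hnil w hw]⟩) k hk
  push Not at hnil
  obtain ⟨w, hw, hne⟩ := hnil
  obtain ⟨y, hy⟩ := List.exists_mem_of_ne_nil w hne
  obtain ⟨n, hn, rfl⟩ := hH w hw y hy
  set s := -n - 1 with hs
  have hs0 : 0 ≤ s := by lia
  set κ : ℂ := 2 * (s + 1) * (c / 3 - 1) with hκ
  have hκ0 : κ ≠ 0 := by
    have h1 : (s + 1 : ℂ) ≠ 0 := by exact_mod_cast (by lia : s + 1 ≠ 0)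
    refine mul_ne_zero (mul_ne_zero two_ne_zero h1) fun h2 => hc ?_
    linear_combination 3 * h2
  set D : List Gen → WordSpace := fun w' => κ • remH (s + 1) w' with hD
  have hS : ∀ w' ∈ a.support, quad famT s • vec v w' k - vecL v (k + 1) (D w') ∈
      fil v (k + 1) := by
    intro w' hw'
    have := quad_famT_smul_vec_H hv hs0 (hH w' hw') k
    rwa [← map_smul, ← sub_eq_zero, ← map_sub, Submodule.mkQ_apply,
      Submodule.Quotient.mk_eq_zero, ← map_smul] at this
  have hDs : Finsupp.linearCombination ℂ D a ∈ short (B + 1) := by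
    rw [Finsupp.linearCombination_apply]
    refine Submodule.sum_mem _ fun w' hw' => Submodule.smul_mem _ _ (Submodule.smul_mem _ _ ?_)
    rw [remH_eq_contract]
    exact subwords_le_short (ha w' hw').1 (Nat.lt_succ_of_le (ha w' hw').2)
      (contract_mem_subwords _ _ w')
  have h0 : Finsupp.linearCombination ℂ D a = 0 := by
    refine h.eq_zero (k := k + 1) hDs ?_
    rw [← sub_sub_cancel (quad famT s • vecL v k a)
      (vecL v (k + 1) (Finsupp.linearCombination ℂ D a))]
    exact Submodule.sub_mem _ (mem_sup_of_smul (quad_famT_mem_raise hv s) hk)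
      (Submodule.mem_sup_right (smul_vecL_mem hS))
  have h1 := DFunLike.congr_fun h0 (w.erase (.H n))
  have hβ : ∀ g : Gen, (if g = .H (-(s + 1)) then 1 else 0 : ℂ) ≠ 0 → g = .H n := by
    intro g hg
    rw [ite_ne_right_iff] at hg
    rw [hg.1]
    exact congrArg _ (by lia)
  rw [linearCombination_apply_eq (w := w)] at h1
  · refine absurd h1 (mul_ne_zero (Finsupp.mem_support_iff.mp hw) ?_)
    simp only [hD, Finsupp.smul_apply, remH_eq_contract]
    refine smul_ne_zero hκ0 (contract_erase_ne_zero hβ ?_ hy)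
    rw [if_pos (congrArg _ (by lia))]
    exact one_ne_zero
  · intro w' hw' hne'
    simp only [hD, Finsupp.smul_apply, remH_eq_contract] at hne'
    exact (ha w' hw').1.eq_of_perm (ha w hw).1
      ((perm_of_contract_ne_zero hβ (right_ne_zero_of_smul hne')).trans
        (List.perm_cons_erase hy).symm)

theorem nondeg (hc : c ≠ 3) (hv : IsChiralVec c q v) {f : M →ₗ[ℂ] Polynomial ℂ}
    (hf : IsWhittaker v f) {J : Submodule U M} (hJ : ∀ y ∈ J, f y = 0) (B : ℕ) : Nondeg v J B := by
  induction B with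
  | zero => exact nondeg_zero hf hJ
  | succ B ih => exact ih.succ hc hv hf hJ

theorem eq_zero_of_vecL_mem (hc : c ≠ 3) (hv : IsChiralVec c q v) {f : M →ₗ[ℂ] Polynomial ℂ}
    (hf : IsWhittaker v f) {J : Submodule U M} (hJ : ∀ y ∈ J, f y = 0) {a : WordSpace}
    (ha : ∀ w ∈ a.support, Ordered w) {k : ℕ}
    (hk : vecL v k a ∈ J.restrictScalars ℂ ⊔ fil v k) : a = 0 :=
  nondeg hc hv hf hJ (a.support.sup List.length) a
    (fun w hw => ⟨ha w hw, Finset.le_sup (f := List.length) hw⟩) k hk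

end

/-! ### Weights, zero modes and the passage from annihilation operators to all of U. -/

theorem gen_induction {p : U → Prop} (halg : ∀ r : ℂ, p (algebraMap ℂ U r)) (hgen : ∀ g, p (gen g))
    (hadd : ∀ a b, p a → p b → p (a + b)) (hmul : ∀ a b, p a → p b → p (a * b)) (u : U) : p u := by
  obtain ⟨u, rfl⟩ := RingQuot.mkAlgHom_surjective ℂ Rel u
  induction u using FreeAlgebra.induction with
  | grade0 r => simpa using halg r
  | grade1 g => exact hgen g
  | mul a b ha hb => simpa using hmul _ _ ha hb
  | add a b ha hb => simpa using hadd _ _ ha hb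

section
variable {M : Type*} [AddCommGroup M] [Module U M] [Module ℂ M] [IsScalarTower ℂ U M]
variable {v : M} {c q : ℂ}

theorem smul_mem_of_gen_smul_mem {S : Submodule ℂ M} (hS : ∀ g, ∀ y ∈ S, gen g • y ∈ S) (u : U) :
    ∀ y ∈ S, u • y ∈ S := by
  induction u using gen_induction with
  | halg r =>
    intro y hy
    rw [algebraMap_smul]
    exact S.smul_mem r hy
  | hgen g => exact hS g
  | hadd a b ha hb =>
    intro y hy
    rw [add_smul]
    exact S.add_mem (ha y hy) (hb y hy)
  | hmul a b ha hb =>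
    intro y hy
    rw [mul_smul]
    exact ha _ (hb y hy)

/-- A subspace stable under the generators of negative index contains the submodule generated by
any smaller subspace that is stable under the other generators. -/
theorem smul_mem_of_stable {S T : Submodule ℂ M} (hS : ∀ z : Gen, 0 ≤ z.idx → ∀ y ∈ S, gen z • y ∈ S)
    (hST : S ≤ T) (hT : ∀ z : Gen, z.idx < 0 → ∀ y ∈ T, gen z • y ∈ T) (u : U) {y : M}
    (hy : y ∈ S) : u • y ∈ T := by
  set N : Submodule ℂ M :=
    Submodule.span ℂ {x | ∃ w : List Gen, (∀ g ∈ w, g.idx < 0) ∧ ∃ y ∈ S, x = wordU w • y} with hN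
  have hw0 : ∀ y : M, wordU [] • y = y := fun y => by simp [wordU]
  have hw1 : ∀ (g : Gen) (w : List Gen) (y : M), wordU (g :: w) • y = gen g • wordU w • y :=
    fun g w y => by simp [wordU, mul_smul]
  have hSN : S ≤ N := fun y hy => Submodule.subset_span ⟨[], by simp, y, hy, (hw0 y).symm⟩
  have hNT : N ≤ T := by
    refine Submodule.span_le.mpr ?_
    rintro _ ⟨w, hw, y, hy, rfl⟩
    induction w with
    | nil => rw [hw0]; exact hST hy
    | cons g w ih =>
      rw [hw1]
      exact hT g (hw g (by simp)) _ (ih fun g hg => hw g (by simp [hg]))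
  have hneg : ∀ z : Gen, z.idx < 0 → ∀ y ∈ N, gen z • y ∈ N := by
    intro z hz
    suffices N ≤ N.comap (Algebra.lsmul ℂ ℂ M (gen z)) from fun y hy => this hy
    refine Submodule.span_le.mpr ?_
    rintro _ ⟨w, hw, y, hy, rfl⟩
    refine Submodule.subset_span ⟨z :: w, by simpa using ⟨hz, hw⟩, y, hy, ?_⟩
    rw [hw1, Algebra.lsmul_coe]
  have hgen : ∀ z : Gen, ∀ y ∈ N, gen z • y ∈ N := by
    intro z
    suffices N ≤ N.comap (Algebra.lsmul ℂ ℂ M (gen z)) from fun y hy => this hy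
    refine Submodule.span_le.mpr ?_
    rintro _ ⟨w, hw, y, hy, rfl⟩
    rw [SetLike.mem_coe, Submodule.mem_comap, Algebra.lsmul_coe]
    induction w generalizing z with
    | nil =>
      rw [hw0]
      rcases lt_or_ge z.idx 0 with h | h
      · exact hneg z h y (hSN hy)
      · exact hSN (hS z h y hy)
    | cons g w ih =>
      have hw' : ∀ g ∈ w, g.idx < 0 := fun g hg => hw g (by simp [hg])
      rw [hw1]
      change gen z • gen g • wordU w • y ∈ N
      rw [gen_smul_smul]
      exact N.add_mem (N.smul_mem _ (hneg g (hw g (by simp)) _ (ih z hw')))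
        (brv_mem fun g _ _ => ih g hw')
  exact hNT (smul_mem_of_gen_smul_mem hgen u y (hSN hy))

theorem mem_of_neg_stable (hv : IsChiralVec c q v) {T : Submodule ℂ M} (hvT : v ∈ T)
    (hT : ∀ z : Gen, z.idx < 0 → ∀ y ∈ T, gen z • y ∈ T) (u : U) : u • v ∈ T := by
  refine smul_mem_of_stable (S := Submodule.span ℂ {v}) (fun z hz y hy => ?_)
    (by simpa [Submodule.span_le] using hvT) hT u (Submodule.mem_span_singleton_self v)
  obtain ⟨r, rfl⟩ := Submodule.mem_span_singleton.mp hy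
  rw [smul_comm, hv z hz]
  exact Submodule.smul_mem _ _ (Submodule.smul_mem _ _ (Submodule.mem_span_singleton_self v))

theorem brv_L_zero (Φ : Gen → M) (z : Gen) : brv Φ (.L 0) z = -((z.idx : ℂ) • Φ z) := by
  cases z <;> simp [brv, Gen.idx]

theorem brv_H_zero (Φ : Gen → M) (z : Gen) : brv Φ (.H 0) z = (z.chg : ℂ) • Φ z := by
  rcases z with n | n | n | n | _ <;> simp [brv, Gen.chg]
  rintro rfl
  simp

theorem L_zero_smul_smul (z : Gen) (y : M) :
    gen (.L 0) • gen z • y = gen z • gen (.L 0) • y - (z.idx : ℂ) • gen z • y := by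
  rw [gen_smul_smul, sgn_L_left, one_smul, brv_L_zero, sub_eq_add_neg]

theorem H_zero_smul_smul (z : Gen) (y : M) :
    gen (.H 0) • gen z • y = gen z • gen (.H 0) • y + (z.chg : ℂ) • gen z • y := by
  rw [gen_smul_smul, sgn_H_left, one_smul, brv_H_zero]

open Polynomial

variable {f : M →ₗ[ℂ] ℂ[X]}

theorem IsWhittaker.map_neg (hf : IsWhittaker v f) {z : Gen} (hz : z.idx < 0) (y : M) :
    f (gen z • y) = isT z • (X * f y) := by
  by_cases h : z = .L (-1)
  · rw [h, hf.map_t]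
    simp [isT]
  · rw [hf.map_letter z ⟨hz, h⟩, isT_eq_zero h, zero_smul]

/-- Both sides agree on v and commute in the same way with negative generators: L_{-1} has level 1
and becomes X, which has degree 1 for X d/dX. -/
theorem IsWhittaker.map_L_zero (hf : IsWhittaker v f) (hv : IsChiralVec c q v) (u : U) :
    f (gen (.L 0) • u • v) = X * derivative (f (u • v)) := by
  set T : Submodule ℂ M := LinearMap.ker (f ∘ₗ Algebra.lsmul ℂ ℂ M (gen (.L 0)) -
    LinearMap.mulLeft ℂ X ∘ₗ derivative ∘ₗ f) with hT
  have hmem : ∀ y, y ∈ T ↔ f (gen (.L 0) • y) = X * derivative (f y) := by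
    intro y
    simp [hT, sub_eq_zero]
  rw [← hmem]
  refine mem_of_neg_stable hv ?_ (fun z hz y hy => ?_) u
  · rw [hmem, hv (.L 0) le_rfl, hf.map_vec]
    simp [hwChar]
  · rw [hmem] at hy ⊢
    by_cases h : z = .L (-1)
    · subst h
      rw [L_zero_smul_smul, map_sub, LinearMap.map_smul, hf.map_t, hf.map_t, hy]
      simp [Gen.idx, derivative_mul]
      ring
    · rw [L_zero_smul_smul, map_sub, LinearMap.map_smul, hf.map_letter z ⟨hz, h⟩,
        hf.map_letter z ⟨hz, h⟩]
      simp

theorem IsWhittaker.map_H_zero (hf : IsWhittaker v f) (hv : IsChiralVec c q v) (u : U) :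
    f (gen (.H 0) • u • v) = q • f (u • v) := by
  set T : Submodule ℂ M := LinearMap.ker (f ∘ₗ Algebra.lsmul ℂ ℂ M (gen (.H 0)) - q • f) with hT
  have hmem : ∀ y, y ∈ T ↔ f (gen (.H 0) • y) = q • f y := by
    intro y
    simp [hT, sub_eq_zero]
  rw [← hmem]
  refine mem_of_neg_stable hv ?_ (fun z hz y hy => ?_) u
  · rw [hmem, hv (.H 0) le_rfl, map_smul]
    simp [hwChar]
  · rw [hmem] at hy ⊢
    by_cases h : z = .L (-1)
    · subst h
      rw [H_zero_smul_smul, map_add, LinearMap.map_smul, hf.map_t, hf.map_t, hy]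
      simp [Gen.chg]
    · rw [H_zero_smul_smul, map_add, LinearMap.map_smul, hf.map_letter z ⟨hz, h⟩,
        hf.map_letter z ⟨hz, h⟩]
      simp

/-- The vectors of weight `a` for `L_0` and `q + b` for `H_0`, on which `C` acts by `c`. -/
structure IsWt (c q a : ℂ) (b : ℤ) (y : M) : Prop where
  L : gen (.L 0) • y = a • y
  H : gen (.H 0) • y = (q + b) • y
  C : gen .C • y = c • y

theorem IsWt.smul {a : ℂ} {b : ℤ} {y : M} (h : IsWt c q a b y) (z : Gen) :
    IsWt c q (a - z.idx) (b + z.chg) (gen z • y) := by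
  refine ⟨?_, ?_, ?_⟩
  · rw [L_zero_smul_smul, h.L, smul_comm, sub_smul]
  · rw [H_zero_smul_smul, h.H, smul_comm, ← add_smul, Int.cast_add, add_assoc]
  · rw [gen_smul_smul, h.C, smul_comm (gen z) c]
    simp [sgn, Gen.odd, brv]

theorem IsChiralVec.isWt (hv : IsChiralVec c q v) : IsWt c q 0 0 v :=
  ⟨hv (.L 0) le_rfl, by rw [hv (.H 0) le_rfl]; simp [hwChar], hv .C le_rfl⟩

/-- On a vector of weight a the polynomial p = f(y) satisfies Xp' = ap, so it is a multiple of a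
single monomial and its value at 1 is the only coefficient. -/
theorem IsWhittaker.eq_zero_of_eval (hf : IsWhittaker v f) (hv : IsChiralVec c q v) {a : ℂ} {b : ℤ}
    {u : U} (h : IsWt c q a b (u • v)) (h0 : (f (u • v)).eval 1 = 0) : f (u • v) = 0 := by
  have h1 := hf.map_L_zero hv u
  rw [h.L, LinearMap.map_smul] at h1
  have h2 : ∀ i, (f (u • v)).coeff i ≠ 0 → a = i := by
    intro i hi
    have := congrArg (fun p : ℂ[X] => p.coeff i) h1
    rcases i with _ | i
    · simpa [hi] using this
    · simp only [coeff_smul, coeff_X_mul, coeff_derivative, smul_eq_mul] at this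
      rw [mul_comm] at this
      have := mul_left_cancel₀ hi this
      simpa using this
  by_contra hne
  obtain ⟨i, hi⟩ := Polynomial.support_nonempty.mpr hne
  rw [mem_support_iff] at hi
  rw [eval_eq_sum, Polynomial.sum, Finset.sum_eq_single i] at h0
  · exact hi (by simpa using h0)
  · intro j hj hji
    rw [mem_support_iff] at hj
    exact absurd (by exact_mod_cast (h2 j hj).symm.trans (h2 i hi)) hji
  · intro h
    simpa using h

theorem IsWhittaker.eq_zero_of_charge (hf : IsWhittaker v f) (hv : IsChiralVec c q v) {a : ℂ}
    {b : ℤ} {u : U} (h : IsWt c q a b (u • v)) (hb : b ≠ 0) : f (u • v) = 0 := by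
  have h1 := hf.map_H_zero hv u
  rw [h.H, LinearMap.map_smul, add_smul, add_eq_left] at h1
  simpa [hb] using h1

end

section
variable {E : Type*} [Ring E] [Algebra ℂ E]

theorem sub_eq_neg_smul {x y z : E} {r : ℂ} (h : x = y + -(r • z)) : x - y = (-r) • z := by
  rw [h]
  module

theorem mul_eq_two_smul_sub {x y l h k : E} {r s : ℂ}
    (hxy : x * y = (-1 : ℂ) • (y * x) + ((2 : ℂ) • l - r • h + s • k)) (hr : r = 0) (hs : s = 0) :
    x * y = (2 : ℂ) • l - y * x := by
  rw [hxy, hr, hs]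
  module

theorem eq_zero_of_eq_neg_smul {x : E} (h : x = (-1 : ℂ) • x) : x = 0 := by
  rw [neg_one_smul, eq_neg_iff_add_eq_zero, ← two_smul ℂ] at h
  simpa using h

theorem commutator_mul {t x y : E} {a b : ℂ} (hx : t * x - x * t = a • x)
    (hy : t * y - y * t = b • y) : t * (x * y) - x * y * t = (a + b) • (x * y) := by
  rw [add_smul, ← smul_mul_assoc, ← mul_smul_comm, ← hx, ← hy]
  noncomm_ring

end

theorem gen_homogeneous (z : Gen) :
    gen (.L 0) * gen z - gen z * gen (.L 0) = (-z.idx : ℂ) • gen z := by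
  refine sub_eq_neg_smul ?_
  rw [gen_mul, sgn_L_left, brv_L_zero, one_smul]

theorem gen_mem_posU {z : Gen} (hz : 0 < z.idx) : gen z ∈ posU :=
  Submodule.subset_span ⟨-z.idx, by lia, by rw [gen_homogeneous]; push_cast; rfl⟩

theorem gen_mul_gen_mem_posU {x z : Gen} (hx : x.idx = 0) (hz : 0 < z.idx) :
    gen x * gen z ∈ posU :=
  Submodule.subset_span ⟨-z.idx, by lia, by
    rw [commutator_mul (gen_homogeneous x) (gen_homogeneous z), hx]
    push_cast
    rw [neg_zero, zero_add]⟩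

/-- Eigenvalues of ad L_0 add. Thus if all of `posU` annihilates y under the test functional, the
same is true of gen z • y for z of nonnegative index. -/
theorem mul_gen_mem_posU {x : U} (hx : x ∈ posU) {z : Gen} (hz : 0 ≤ z.idx) :
    x * gen z ∈ posU := by
  suffices posU ≤ posU.comap (LinearMap.mulRight ℂ (gen z)) from this hx
  refine Submodule.span_le.mpr ?_
  rintro x ⟨l, hl, hx⟩
  refine Submodule.subset_span ⟨l - z.idx, by lia, ?_⟩
  rw [LinearMap.mulRight_apply, commutator_mul hx (gen_homogeneous z)]
  push_cast
  rw [sub_eq_add_neg]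

/-- The pairs of zero modes used for the two sets of annihilation operators. -/
structure IsZeroModePair (A B : Gen) : Prop where
  idx_left : A.idx = 0
  chg_right : B.chg ≠ 0
  left_sq : gen A * gen A = 0
  right_sq : gen B * gen B = 0
  eq_or_eq : ∀ z : Gen, z.idx = 0 → z.odd = true → z = A ∨ z = B
  left_right : gen A * gen B = (2 : ℂ) • gen (.L 0) - gen B * gen A

theorem gen_sq_eq_zero {g : Gen} (h : g.odd = true) : gen g * gen g = 0 := by
  refine eq_zero_of_eq_neg_smul ?_
  have h1 := gen_mul g g
  rwa [show sgn g g = -1 by simp [sgn, h],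
    show brv gen g g = 0 by cases g <;> simp_all [brv, Gen.odd], add_zero] at h1

theorem isZeroModePair_GQ : IsZeroModePair (.G 0) (.Q 0) where
  idx_left := rfl
  chg_right := by decide
  left_sq := gen_sq_eq_zero rfl
  right_sq := gen_sq_eq_zero rfl
  eq_or_eq z h h' := by rcases z with n | n | n | n | _ <;> simp_all [Gen.idx, Gen.odd]
  left_right := by
    have h := gen_mul (.G 0) (.Q 0)
    rw [show sgn (.G 0) (.Q 0) = -1 by simp [sgn, Gen.odd]] at h
    exact mul_eq_two_smul_sub h (by simp) (by simp)

theorem isZeroModePair_QG : IsZeroModePair (.Q 0) (.G 0) where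
  idx_left := rfl
  chg_right := by decide
  left_sq := gen_sq_eq_zero rfl
  right_sq := gen_sq_eq_zero rfl
  eq_or_eq z h h' := by rcases z with n | n | n | n | _ <;> simp_all [Gen.idx, Gen.odd]
  left_right := by
    have h := gen_mul (.Q 0) (.G 0)
    rw [show sgn (.Q 0) (.G 0) = -1 by simp [sgn, Gen.odd]] at h
    exact mul_eq_two_smul_sub h (by simp) (by simp)

section
open Polynomial
variable {M : Type*} [AddCommGroup M] [Module U M] [Module ℂ M] [IsScalarTower ℂ U M]
variable {v : M} {c q : ℂ} {f : M →ₗ[ℂ] ℂ[X]} {A B : Gen}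

/-- The functional whose vanishing on the images under the annihilation operators is studied. -/
noncomputable def testFun (f : M →ₗ[ℂ] ℂ[X]) (B : Gen) : M →ₗ[ℂ] ℂ :=
  leval 1 ∘ₗ (f + f ∘ₗ Algebra.lsmul ℂ ℂ M (gen B))

theorem testFun_apply (y : M) :
    testFun f B y = (f y).eval 1 + (f (gen B • y)).eval 1 := by
  simp [testFun]

variable (hf : IsWhittaker v f) (hv : IsChiralVec c q v) (hgen : ∀ y : M, ∃ u : U, u • v = y)
  (hAB : IsZeroModePair A B)
include hf hv hgen hAB

/-- B changes the charge, so at most one of y and By has relative charge 0. The other is killed by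
f, and the sum in `testFun` therefore controls both terms. -/
theorem map_eq_zero_of_testFun {a : ℂ} {b : ℤ} {y : M} (hy : IsWt c q a b y)
    (h : testFun f B y = 0) : f y = 0 ∧ f (gen B • y) = 0 := by
  have hBy := hy.smul B
  rw [testFun_apply] at h
  obtain ⟨u, rfl⟩ := hgen y
  rw [smul_smul] at hBy h ⊢
  by_cases hb : b = 0
  · have h1 := hf.eq_zero_of_charge hv hBy (by simpa [hb] using hAB.chg_right)
    rw [h1, eval_zero, add_zero] at h
    exact ⟨hf.eq_zero_of_eval hv hy h, h1⟩
  · have h1 := hf.eq_zero_of_charge hv hy hb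
    rw [h1, eval_zero, zero_add] at h
    exact ⟨h1, hf.eq_zero_of_eval hv hBy h⟩

/-- The weight vectors on which the functional and its composites with the annihilation operators
vanish. -/
theorem map_smul_eq_zero {a : ℂ} {b : ℤ} {x : M} (hx : IsWt c q a b x) (h0 : testFun f B x = 0)
    (h : ∀ Γ ∈ posU ⊔ Submodule.span ℂ {gen A}, testFun f B (Γ • x) = 0) (u : U) :
    f (u • x) = 0 := by
  -- These conditions hold for x, are passed on by generators of nonnegative index, and imply f y =
  -- 0. Negative generators preserve the kernel of f, so together they give f(Ux) = 0.
  set S : Set M := {y | (∃ a b, IsWt c q a b y) ∧ testFun f B y = 0 ∧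
    testFun f B (gen A • y) = 0 ∧ ∀ Γ ∈ posU, testFun f B (Γ • y) = 0} with hS
  have hmul : ∀ z : Gen, 0 ≤ z.idx → ∀ y ∈ S, ∀ Γ ∈ posU, testFun f B (Γ • gen z • y) = 0 := by
    rintro z hz y ⟨-, -, -, h3⟩ Γ hΓ
    rw [smul_smul]
    exact h3 _ (mul_gen_mem_posU hΓ hz)
  have hodd : ∀ z : Gen, z.idx = 0 → z.odd = true → ∀ y ∈ S,
      gen z • y ∈ Submodule.span ℂ S := by
    intro z hz hz' y hyS
    have h4 := hmul z hz.ge y hyS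
    obtain ⟨⟨a, b, hy⟩, h1, h2, h3⟩ := hyS
    obtain ⟨-, hBy⟩ := map_eq_zero_of_testFun hf hv hgen hAB hy h1
    obtain ⟨-, hBAy⟩ := map_eq_zero_of_testFun hf hv hgen hAB (hy.smul A) h2
    refine Submodule.subset_span ⟨⟨_, _, hy.smul z⟩, ?_, ?_, h4⟩
    · rcases hAB.eq_or_eq z hz hz' with rfl | rfl
      · exact h2
      · rw [testFun_apply, hBy, smul_smul, hAB.right_sq, zero_smul, map_zero, eval_zero, add_zero]
    · rcases hAB.eq_or_eq z hz hz' with rfl | rfl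
      · rw [smul_smul, hAB.left_sq, zero_smul, map_zero]
      -- For z = B the condition on ABy follows from AB = 2L_0 - BA: y is an eigenvector of L_0, and
      -- BAy is controlled by testing Ay.
      · rw [smul_smul, hAB.left_right, sub_smul, smul_assoc, hy.L, mul_smul, map_sub, map_smul,
          map_smul, h1, testFun_apply, hBAy, smul_smul, smul_smul, hAB.right_sq]
        simp
  have key : ∀ z : Gen, 0 ≤ z.idx → ∀ y ∈ S, gen z • y ∈ Submodule.span ℂ S := by
    rintro z hz y ⟨⟨a, b, hy⟩, h1, h2, h3⟩
    have hyS : y ∈ Submodule.span ℂ S := Submodule.subset_span ⟨⟨a, b, hy⟩, h1, h2, h3⟩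
    have h4 := hmul z hz y ⟨⟨a, b, hy⟩, h1, h2, h3⟩
    rcases hz.eq_or_lt with hz | hz
    · rcases z with n | n | n | n | _
      · obtain rfl : 0 = n := hz
        rw [hy.L]
        exact Submodule.smul_mem _ _ hyS
      · obtain rfl : 0 = n := hz
        rw [hy.H]
        exact Submodule.smul_mem _ _ hyS
      · exact hodd (.G n) hz.symm rfl y ⟨⟨a, b, hy⟩, h1, h2, h3⟩
      · exact hodd (.Q n) hz.symm rfl y ⟨⟨a, b, hy⟩, h1, h2, h3⟩
      · rw [hy.C]
        exact Submodule.smul_mem _ _ hyS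
    · refine Submodule.subset_span ⟨⟨_, _, hy.smul z⟩, h3 _ (gen_mem_posU hz), ?_, h4⟩
      rw [smul_smul]
      exact h3 _ (gen_mul_gen_mem_posU hAB.idx_left hz)
  have hxS : x ∈ Submodule.span ℂ S := by
    refine Submodule.subset_span ⟨⟨a, b, hx⟩, h0, h _ ?_, fun Γ hΓ => h Γ ?_⟩
    · exact Submodule.mem_sup_right (Submodule.mem_span_singleton_self _)
    · exact Submodule.mem_sup_left hΓ
  refine smul_mem_of_stable (S := Submodule.span ℂ S) (T := LinearMap.ker f) (fun z hz => ?_) ?_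
    (fun z hz y hy => ?_) u hxS
  · suffices Submodule.span ℂ S ≤ (Submodule.span ℂ S).comap (Algebra.lsmul ℂ ℂ M (gen z)) from
      fun y hy => this hy
    exact Submodule.span_le.mpr fun y hy => key z hz y hy
  · refine Submodule.span_le.mpr ?_
    rintro y ⟨⟨a, b, hy⟩, h1, -⟩
    exact (map_eq_zero_of_testFun hf hv hgen hAB hy h1).1
  · rw [LinearMap.mem_ker] at hy ⊢
    rw [hf.map_neg hz, hy, mul_zero, smul_zero]

end

/-! ### Standard terms as ordered words, and the ordering of terms. -/

/-- The letters of the factor of a term given by `w = [m_1, …, m_I]`. -/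
def part (Z : ℤ → Gen) (w : List ℕ) : List Gen := w.reverse.map fun j : ℕ => Z (-(j : ℤ))

/-- The letters of a term to the left of `L_{-1}^k`. -/
def BasisTerm.head (X : BasisTerm) : List Gen :=
  part .L X.L ++ part .H X.H ++ part .G X.G ++ part .Q X.Q

/-- The letters of a term to the right of `L_{-1}^k`. -/
def BasisTerm.tail (X : BasisTerm) : List Gen :=
  List.replicate X.r1 (.G (-1)) ++ List.replicate X.r2 (.Q (-1))

theorem wordU_append (w w' : List Gen) : wordU (w ++ w') = wordU w * wordU w' := by
  simp [wordU]

theorem wordU_part (Z : ℤ → Gen) (w : List ℕ) : wordU (part Z w) = word Z w := by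
  have h : ∀ l : List ℕ, (l.flatMap fun a : ℕ => [(a : ℤ)]) = l.map fun a : ℕ => (a : ℤ) :=
    List.flatMap_pure_eq_map _
  simp [wordU, part, word, Function.comp_def, h]

theorem BasisTerm.op_eq {X : BasisTerm} (h : X.r3 = 0) :
    X.op = wordU X.head * gen (.L (-1)) ^ X.k * wordU X.tail := by
  simp only [BasisTerm.op, BasisTerm.head, BasisTerm.tail, wordU_append, wordU_part, h, pow_zero,
    mul_one, mul_assoc]
  simp [wordU]

theorem forall_mem_part {Z : ℤ → Gen} {w : List ℕ} {p : Gen → Prop}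
    (h : ∀ j ∈ w, p (Z (-(j : ℤ)))) : ∀ g ∈ part Z w, p g := by
  intro g hg
  simp only [part, List.mem_map, List.mem_reverse] at hg
  obtain ⟨j, hj, rfl⟩ := hg
  exact h j hj

theorem pairwise_part {Z : ℤ → Gen} {w : List ℕ} {r : ℕ → ℕ → Prop} (hw : w.Pairwise r)
    (h : ∀ i ∈ w, ∀ j ∈ w, r i j → letterLE (Z (-(j : ℤ))) (Z (-(i : ℤ)))) :
    (part Z w).Pairwise letterLE := by
  rw [part, List.pairwise_map, List.pairwise_reverse]
  exact hw.imp_of_mem fun hi hj hr => h _ hi _ hj hr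

theorem BasisTerm.kind_of_mem {m : ℕ} {n : ℤ} {X : BasisTerm} (hX : X ∈ CGQ m n) :
    (∀ g ∈ part .L X.L, g.kind = 0 ∧ IsLetter g) ∧ (∀ g ∈ part .H X.H, g.kind = 1 ∧ IsLetter g) ∧
    (∀ g ∈ part .G X.G, g.kind = 2 ∧ IsLetter g) ∧ (∀ g ∈ part .Q X.Q, g.kind = 3 ∧ IsLetter g) ∧
    (∀ g ∈ List.replicate X.r1 (Gen.G (-1)), g.kind = 4 ∧ IsLetter g) ∧
    ∀ g ∈ List.replicate X.r2 (Gen.Q (-1)), g.kind = 5 ∧ IsLetter g := by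
  obtain ⟨⟨⟨-, hL'⟩, ⟨-, hH'⟩, ⟨-, hG'⟩, ⟨-, hQ'⟩, -⟩, -⟩ := hX
  refine ⟨forall_mem_part fun j hj => ⟨rfl, ?_⟩, forall_mem_part fun j hj => ⟨rfl, ?_⟩,
    forall_mem_part fun j hj => ⟨if_neg ?_, ?_⟩, forall_mem_part fun j hj => ⟨if_neg ?_, ?_⟩,
    fun g hg => ?_, fun g hg => ?_⟩
  · exact isLetter_of_idx_lt (by have := hL' j hj; simp only [Gen.idx]; lia)
  · exact ⟨by have := hH' j hj; simp only [Gen.idx]; lia, by simp⟩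
  · have := hG' j hj; lia
  · exact isLetter_of_idx_lt (by have := hG' j hj; simp only [Gen.idx]; lia)
  · have := hQ' j hj; lia
  · exact isLetter_of_idx_lt (by have := hQ' j hj; simp only [Gen.idx]; lia)
  · rw [List.eq_of_mem_replicate hg]
    exact ⟨rfl, by decide, by simp⟩
  · rw [List.eq_of_mem_replicate hg]
    exact ⟨rfl, by decide, by simp⟩

theorem BasisTerm.ordered {m : ℕ} {n : ℤ} {X : BasisTerm} (hX : X ∈ CGQ m n) :
    Ordered (X.head ++ X.tail) := by
  obtain ⟨kL, kH, kG, kQ, k1, k2⟩ := BasisTerm.kind_of_mem hX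
  obtain ⟨⟨⟨hL, -⟩, ⟨hH, -⟩, ⟨hG, -⟩, ⟨hQ, -⟩, h1, h2, -⟩, -⟩ := hX
  have hlt : ∀ {g g' : Gen} {i j : ℕ}, g.kind = i → g'.kind = j → i < j → letterLE g g' :=
    fun h h' hij => Or.inl (by lia)
  have pw : ∀ {r : ℕ} (g : Gen), r ≤ 1 → (List.replicate r g).Pairwise letterLE := by
    intro r g hr
    interval_cases r <;> simp
  refine ⟨?_, ?_⟩
  · rw [BasisTerm.head, BasisTerm.tail]
    simp only [List.append_assoc, List.pairwise_append, List.mem_append]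
    refine ⟨pairwise_part hL fun i hi j hj h => ?_, ⟨pairwise_part hH fun i hi j hj h => ?_,
      ⟨pairwise_part hG fun i hi j hj h => ?_, ⟨pairwise_part hQ fun i hi j hj h => ?_,
      ⟨pw _ h1, pw _ h2, ?_⟩, ?_⟩, ?_⟩, ?_⟩, ?_⟩
    · exact Or.inr ⟨rfl, by simp only [Gen.idx, Gen.odd]; lia⟩
    · exact Or.inr ⟨rfl, by simp only [Gen.idx, Gen.odd]; lia⟩
    · refine Or.inr ⟨?_, Or.inl (by simp only [Gen.idx]; lia)⟩
      rw [(kG (.G (-j)) (by simpa [part] using hj)).1,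
        (kG (.G (-i)) (by simpa [part] using hi)).1]
    · refine Or.inr ⟨?_, Or.inl (by simp only [Gen.idx]; lia)⟩
      rw [(kQ (.Q (-j)) (by simpa [part] using hj)).1,
        (kQ (.Q (-i)) (by simpa [part] using hi)).1]
    · exact fun a ha b hb => hlt (k1 a ha).1 (k2 b hb).1 (by decide)
    · rintro a ha b (hb | hb)
      · exact hlt (kQ a ha).1 (k1 b hb).1 (by decide)
      · exact hlt (kQ a ha).1 (k2 b hb).1 (by decide)
    · rintro a ha b (hb | hb | hb)
      · exact hlt (kG a ha).1 (kQ b hb).1 (by decide)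
      · exact hlt (kG a ha).1 (k1 b hb).1 (by decide)
      · exact hlt (kG a ha).1 (k2 b hb).1 (by decide)
    · rintro a ha b (hb | hb | hb | hb)
      · exact hlt (kH a ha).1 (kG b hb).1 (by decide)
      · exact hlt (kH a ha).1 (kQ b hb).1 (by decide)
      · exact hlt (kH a ha).1 (k1 b hb).1 (by decide)
      · exact hlt (kH a ha).1 (k2 b hb).1 (by decide)
    · rintro a ha b (hb | hb | hb | hb | hb)
      · exact hlt (kL a ha).1 (kH b hb).1 (by decide)
      · exact hlt (kL a ha).1 (kG b hb).1 (by decide)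
      · exact hlt (kL a ha).1 (kQ b hb).1 (by decide)
      · exact hlt (kL a ha).1 (k1 b hb).1 (by decide)
      · exact hlt (kL a ha).1 (k2 b hb).1 (by decide)
  · intro g hg
    simp only [BasisTerm.head, BasisTerm.tail, List.mem_append] at hg
    rcases hg with (((hg | hg) | hg) | hg) | hg | hg
    · exact (kL g hg).2
    · exact (kH g hg).2
    · exact (kG g hg).2
    · exact (kQ g hg).2
    · exact (k1 g hg).2
    · exact (k2 g hg).2

/-- The absolute indices of the letters of a given kind in a word, read from right to left. -/
def extract (i : ℕ) (w : List Gen) : List ℕ :=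
  (w.reverse.filter fun g => g.kind = i).map fun g => g.idx.natAbs

theorem extract_append (i : ℕ) (w w' : List Gen) :
    extract i (w ++ w') = extract i w' ++ extract i w := by
  simp [extract]

theorem extract_of_kind {w : List Gen} {j : ℕ} (h : ∀ g ∈ w, g.kind = j) (i : ℕ) :
    extract i w = if j = i then w.reverse.map fun g => g.idx.natAbs else [] := by
  unfold extract
  split_ifs with hij
  · rw [List.filter_eq_self.mpr]
    intro g hg
    simpa [← hij] using h g (by simpa using hg)
  · rw [List.filter_eq_nil_iff.mpr, List.map_nil]
    intro g hg
    simpa [h g (by simpa using hg)] using hij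

theorem map_natAbs_part {Z : ℤ → Gen} (hZ : ∀ n, (Z n).idx = n) (w : List ℕ) :
    ((part Z w).reverse.map fun g => g.idx.natAbs) = w := by
  simp [part, hZ, Function.comp_def]

/-- The six factors consist of letters of different kinds, so filtering the word by kind recovers
each of them. -/
theorem BasisTerm.eq_of_letters_eq {m : ℕ} {n : ℤ} {X Y : BasisTerm} (hX : X ∈ CGQ m n)
    (hY : Y ∈ CGQ m n) (hk : X.k = Y.k) (h : X.head ++ X.tail = Y.head ++ Y.tail) : X = Y := by
  have key : ∀ {X : BasisTerm}, X ∈ CGQ m n → ∀ i, extract i (X.head ++ X.tail) =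
      (if 5 = i then List.replicate X.r2 1 else []) ++ ((if 4 = i then List.replicate X.r1 1 else [])
        ++ ((if 3 = i then X.Q else []) ++ ((if 2 = i then X.G else []) ++
        ((if 1 = i then X.H else []) ++ (if 0 = i then X.L else []))))) := by
    intro X hX i
    obtain ⟨kL, kH, kG, kQ, k1, k2⟩ := BasisTerm.kind_of_mem hX
    simp only [BasisTerm.head, BasisTerm.tail, extract_append, List.append_assoc]
    rw [extract_of_kind fun g hg => (kL g hg).1, extract_of_kind fun g hg => (kH g hg).1,
      extract_of_kind fun g hg => (kG g hg).1, extract_of_kind fun g hg => (kQ g hg).1,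
      extract_of_kind fun g hg => (k1 g hg).1, extract_of_kind fun g hg => (k2 g hg).1,
      map_natAbs_part fun _ => rfl, map_natAbs_part fun _ => rfl, map_natAbs_part fun _ => rfl,
      map_natAbs_part fun _ => rfl, List.reverse_replicate, List.reverse_replicate,
      List.map_replicate, List.map_replicate]
    rfl
  have e : ∀ i, extract i (X.head ++ X.tail) = extract i (Y.head ++ Y.tail) := fun i => by rw [h]
  simp only [key hX, key hY] at e
  have e0 := e 0
  have e1 := e 1
  have e2 := e 2
  have e3 := e 3
  have e4 := congrArg List.length (e 4)
  have e5 := congrArg List.length (e 5)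
  simp at e0 e1 e2 e3 e4 e5
  have hX3 := hX.2
  have hY3 := hY.2
  cases X
  cases Y
  simp_all

theorem finite_setOf_list (m : ℕ) : {l : List ℕ | (∀ j ∈ l, 1 ≤ j) ∧ l.sum ≤ m}.Finite := by
  refine ((List.finite_length_le (Fin (m + 1)) m).image (List.map Fin.val)).subset ?_
  rintro l ⟨h1, h2⟩
  refine ⟨l.attach.map fun j => ⟨j.1, Nat.lt_succ_of_le ((List.le_sum_of_mem j.2).trans h2)⟩, ?_, ?_⟩
  · have : l.length • 1 ≤ l.sum := List.card_nsmul_le_sum l 1 h1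
    simp only [smul_eq_mul, mul_one] at this
    simpa using this.trans h2
  · simp [Function.comp_def]

theorem finite_CGQ (m : ℕ) (n : ℤ) : (CGQ m n).Finite := by
  have hS := finite_setOf_list m
  refine ((hS.prod (hS.prod (hS.prod (hS.prod ((Set.finite_Iic m).prod
    ((Set.finite_Iic 1).prod (Set.finite_Iic 1))))))).image
    fun x : List ℕ × List ℕ × List ℕ × List ℕ × ℕ × ℕ × ℕ => (⟨x.1, x.2.1, x.2.2.1, x.2.2.2.1,
      x.2.2.2.2.1, x.2.2.2.2.2.1, x.2.2.2.2.2.2, 0⟩ : BasisTerm)).subset ?_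
  rintro ⟨L, H, G, Q, k, r1, r2, r3⟩ hX
  obtain ⟨⟨⟨-, hL⟩, ⟨-, hH⟩, ⟨-, hG⟩, ⟨-, hQ⟩, h1, h2, h3, hm, -⟩, h0⟩ := hX
  simp only at hL hH hG hQ h1 h2 h3 hm h0
  refine ⟨(L, H, G, Q, k, r1, r2), ?_, by rw [h0]⟩
  simp only [Set.mem_prod, Set.mem_ofPred_eq, Set.mem_Iic]
  exact ⟨⟨fun j hj => one_le_two.trans (hL j hj), by lia⟩, ⟨hH, by lia⟩,
    ⟨fun j hj => one_le_two.trans (hG j hj), by lia⟩,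
    ⟨fun j hj => one_le_two.trans (hQ j hj), by lia⟩, by lia, h1, h2⟩

open OrderDual in
theorem wordLT_iff (l l' : List ℕ) : wordLT l l' ↔ l'.map toDual < l.map toDual := by
  induction l generalizing l' with
  | nil => simp [wordLT]
  | cons a l ih =>
    rcases l' with _ | ⟨b, l'⟩
    · simp [wordLT]
    · simp [wordLT, ih, List.cons_lt_cons_iff, eq_comm]

open OrderDual in
/-- A key whose lexicographic order is the reverse of `≺_G`. -/
def BasisTerm.key (X : BasisTerm) :
    ℕ ×ₗ ℕ ×ₗ List ℕᵒᵈ ×ₗ List ℕᵒᵈ ×ₗ List ℕᵒᵈ ×ₗ List ℕᵒᵈ :=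
  toLex (X.k, toLex (X.r1 + X.r2, toLex (X.Q.map toDual, toLex (X.G.map toDual,
    toLex (X.L.map toDual, X.H.map toDual)))))

theorem ltG_iff (X Y : BasisTerm) : ltG X Y ↔ Y.key < X.key := by
  have h : Function.Injective (List.map OrderDual.toDual : List ℕ → List ℕᵒᵈ) :=
    List.map_injective_iff.mpr OrderDual.toDual.injective
  simp only [ltG, BasisTerm.key, Prod.Lex.toLex_lt_toLex, wordLT_iff, h.eq_iff, eq_comm]

/-- The key only contains the sum r1 + r2; the fixed charge supplies the difference r1 - r2. -/
theorem BasisTerm.key_injOn (m : ℕ) (n : ℤ) : Set.InjOn BasisTerm.key (CGQ m n) := by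
  rintro ⟨L, H, G, Q, k, r1, r2, r3⟩ hX ⟨L', H', G', Q', k', r1', r2', r3'⟩ hY h
  have hi : Function.Injective (List.map OrderDual.toDual : List ℕ → List ℕᵒᵈ) :=
    List.map_injective_iff.mpr OrderDual.toDual.injective
  simp only [BasisTerm.key, EmbeddingLike.apply_eq_iff_eq, Prod.mk.injEq, hi.eq_iff] at h
  obtain ⟨rfl, hr, rfl, rfl, rfl, rfl⟩ := h
  obtain ⟨⟨-, -, -, -, -, -, -, -, hn⟩, h0⟩ := hX
  obtain ⟨⟨-, -, -, -, -, -, -, -, hn'⟩, h0'⟩ := hY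
  simp only at hn h0 hn' h0'
  obtain rfl : r1 = r1' := by lia
  obtain rfl : r2 = r2' := by lia
  rw [h0, h0']

theorem precG_iff {m : ℕ} {n : ℤ} {X Y : BasisTerm} (hX : X ∈ CGQ m n) (hY : Y ∈ CGQ m n) :
    precG X Y ↔ Y.key ≤ X.key := by
  rw [precG, ltG_iff, le_iff_eq_or_lt, ← (BasisTerm.key_injOn m n).eq_iff hX hY, eq_comm]

theorem eq_lowTerm_of_le {m : ℕ} {n : ℤ} {X : BasisTerm} (hX : X ∈ CGQ m n)
    (h : m ≤ X.k + X.r1 + X.r2) : X = lowTerm X.k X.r1 X.r2 := by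
  obtain ⟨L, H, G, Q, k, r1, r2, r3⟩ := X
  obtain ⟨⟨⟨-, hL⟩, ⟨-, hH⟩, ⟨-, hG⟩, ⟨-, hQ⟩, -, -, -, hm, -⟩, h0⟩ := hX
  simp only at hL hH hG hQ hm h0 h
  have nil : ∀ {l : List ℕ}, (∀ j ∈ l, 1 ≤ j) → l.sum = 0 → l = [] := by
    rintro (_ | ⟨a, l⟩) h h'
    · rfl
    · have := h a (by simp)
      simp at h'
      lia
  obtain rfl := nil (fun j hj => one_le_two.trans (hL j hj)) (by lia)
  obtain rfl := nil hH (by lia)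
  obtain rfl := nil (fun j hj => one_le_two.trans (hG j hj)) (by lia)
  obtain rfl := nil (fun j hj => one_le_two.trans (hQ j hj)) (by lia)
  rw [h0]
  rfl

theorem lowTerm_mem_CGQ (k r1 r2 : ℕ) (h1 : r1 ≤ 1) (h2 : r2 ≤ 1) :
    lowTerm k r1 r2 ∈ CGQ (k + r1 + r2) (r1 - r2) := by
  refine ⟨?_, rfl⟩
  simp [CG, lowTerm, h1, h2]

/-- The terms `L_{-1}^k G_{-1}^{r1} Q_{-1}^{r2}` with `r1 + r2 ≤ 1` are minimal. -/
theorem not_ltG_lowTerm {m k r1 r2 : ℕ} {n : ℤ} (hr : r1 + r2 ≤ 1)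
    (hY : lowTerm k r1 r2 ∈ CGQ m n) {X : BasisTerm} (hX : X ∈ CGQ m n) :
    ¬ ltG X (lowTerm k r1 r2) := by
  intro h
  obtain ⟨⟨-, -, -, -, -, -, -, hm, hn⟩, -⟩ := hY
  have hX' := hX
  obtain ⟨⟨-, -, -, -, h1, h2, -, hm', hn'⟩, -⟩ := hX'
  simp only [lowTerm, List.sum_nil, List.length_nil] at hm hn
  have h3 : k < X.k ∨ X.k = k ∧ r1 + r2 ≤ X.r1 + X.r2 := by
    simp only [ltG, lowTerm] at h
    lia
  have h4 := eq_lowTerm_of_le hX (by lia)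
  rw [h4] at h hn'
  simp only [lowTerm, List.length_nil] at hn'
  simp only [ltG, lowTerm, wordLT] at h
  lia

/-! ### Duality and adaptedness. -/

/-- A linear functional that does not vanish is a coordinate function of some basis. -/
theorem exists_basis_repr {M : Type} [AddCommGroup M] [Module ℂ M] (φ : M →ₗ[ℂ] ℂ) {x : M}
    (hx : φ x = 1) : ∃ (ι : Type) (b : Module.Basis ι ℂ M) (i : ι), ∀ y, b.repr y i = φ y := by
  let e : M ≃ₗ[ℂ] LinearMap.ker φ × ℂ :=
    { toFun := fun y => (⟨y - φ y • x, by simp [hx]⟩, φ y)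
      map_add' := fun y z => by
        ext
        · simp only [map_add, Prod.fst_add, Submodule.coe_add]
          module
        · simp
      map_smul' := fun r y => by
        ext
        · simp only [map_smul, RingHom.id_apply, Prod.smul_fst, Submodule.coe_smul, smul_eq_mul]
          module
        · simp
      invFun := fun p => p.1 + p.2 • x
      left_inv := fun y => by simp
      right_inv := fun p => by
        have h : φ p.1 = 0 := p.1.2
        ext <;> simp [h, hx] }
  refine ⟨_, ((Module.Basis.ofVectorSpace ℂ (LinearMap.ker φ)).prod
    (Module.Basis.singleton Unit ℂ)).map e.symm, Sum.inr (), fun y => ?_⟩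
  simp [e]

section
open Polynomial
variable {M : Type} [AddCommGroup M] [Module U M] [Module ℂ M] [IsScalarTower ℂ U M]
variable {v : M} {c q : ℂ} {f : M →ₗ[ℂ] ℂ[X]} {A B : Gen}

theorem wordU_smul_vec (p w : List Gen) (k : ℕ) : wordU p • vec v w k = vec v (p ++ w) k := by
  rw [vec, vec, wordU_append, smul_smul, mul_assoc]

theorem wordU_smul_mem {p : List Gen} (hp : ∀ g ∈ p, IsLetter g) {k : ℕ} {x : M}
    (hx : x ∈ fil v k) : wordU p • x ∈ fil v k := by
  induction p with
  | nil => simpa [wordU] using hx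
  | cons g p ih =>
    rw [show wordU (g :: p) = gen g * wordU p by simp [wordU], mul_smul]
    exact letter_smul_mem (hp g (by simp)) (ih fun g hg => hp g (by simp [hg]))

theorem t_pow_smul_vec {w : List Gen} (hw : ∀ g ∈ w, IsLetter g) (k : ℕ) :
    gen (.L (-1)) ^ k • vec v w 0 - vec v w k ∈ fil v k := by
  induction k with
  | zero => simp
  | succ k ih =>
    have := Submodule.add_mem _ (t_smul_mem ih) (t_smul_vec (v := v) hw k)
    rwa [smul_sub, sub_add_sub_cancel, smul_smul, ← pow_succ'] at this

/-- Only L_{-1}^k has to be moved, past the letters G_{-1} and Q_{-1} to its right; this costs lower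
powers of L_{-1}. -/
theorem BasisTerm.op_smul {m : ℕ} {n : ℤ} {X : BasisTerm} (hX : X ∈ CGQ m n) :
    X.op • v - vec v (X.head ++ X.tail) X.k ∈ fil v X.k := by
  have h := (BasisTerm.ordered hX).2
  have h1 : wordU X.tail • v = vec v X.tail 0 := by simp [vec]
  rw [BasisTerm.op_eq hX.2, mul_smul, mul_smul, h1, ← wordU_smul_vec, ← smul_sub]
  exact wordU_smul_mem (fun g hg => h g (by simp [hg]))
    (t_pow_smul_vec (fun g hg => h g (by simp [hg])) _)

theorem IsWt.wordU_smul {a : ℂ} {b : ℤ} {y : M} (h : IsWt c q a b y) (w : List Gen) :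
    IsWt c q (a - ((w.map Gen.idx).sum : ℤ)) (b + (w.map Gen.chg).sum) (wordU w • y) := by
  induction w with
  | nil => simpa [wordU] using h
  | cons g w ih =>
    rw [show wordU (g :: w) = gen g * wordU w by simp [wordU], mul_smul]
    convert ih.smul g using 1
    · simp
      ring
    · simp
      ring

theorem sum_map_part {Z : ℤ → Gen} (w : List ℕ) {F : Gen → ℤ} (r s : ℤ)
    (hF : ∀ n : ℤ, F (Z n) = r * n + s) :
    ((part Z w).map F).sum = -r * w.sum + s * w.length := by
  induction w with
  | nil => simp [part]
  | cons j w ih =>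
    simp only [part, List.map_map, List.reverse_cons, List.map_append, List.sum_append] at ih ⊢
    rw [ih]
    simp [hF]
    ring

theorem IsChiralVec.isWt_op (hv : IsChiralVec c q v) {m : ℕ} {n : ℤ} {X : BasisTerm}
    (hX : X ∈ CGQ m n) : IsWt c q m n (X.op • v) := by
  have h1 : X.op = wordU (X.head ++ (List.replicate X.k (.L (-1)) ++ X.tail)) := by
    rw [BasisTerm.op_eq hX.2, wordU_append, wordU_append, mul_assoc]
    simp [wordU]
  have h2 := hv.isWt.wordU_smul (X.head ++ (List.replicate X.k (.L (-1)) ++ X.tail))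
  rw [← h1] at h2
  obtain ⟨⟨-, -, -, -, -, -, -, hm, hn⟩, h0⟩ := hX
  convert h2 using 1
  · simp only [BasisTerm.head, BasisTerm.tail, List.map_append, List.sum_append]
    rw [sum_map_part _ 1 0 (by simp [Gen.idx]), sum_map_part _ 1 0 (by simp [Gen.idx]),
      sum_map_part _ 1 0 (by simp [Gen.idx]), sum_map_part _ 1 0 (by simp [Gen.idx]), ← hm]
    push_cast [-Nat.cast_list_sum, -Int.cast_list_sum]
    simp [Gen.idx, -Nat.cast_list_sum, -Int.cast_list_sum]
    ring
  · simp only [BasisTerm.head, BasisTerm.tail, List.map_append, List.sum_append]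
    rw [sum_map_part _ 0 0 (by simp [Gen.chg]), sum_map_part _ 0 0 (by simp [Gen.chg]),
      sum_map_part _ 0 1 (by simp [Gen.chg]), sum_map_part _ 0 (-1) (by simp [Gen.chg]), ← hn]
    simp [Gen.chg, h0]
    ring

theorem IsWt.zero (a : ℂ) (b : ℤ) : IsWt c q a b (0 : M) := ⟨by simp, by simp, by simp⟩

theorem IsWt.add {a : ℂ} {b : ℤ} {x y : M} (hx : IsWt c q a b x) (hy : IsWt c q a b y) :
    IsWt c q a b (x + y) :=
  ⟨by rw [smul_add, smul_add, hx.L, hy.L], by rw [smul_add, smul_add, hx.H, hy.H],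
    by rw [smul_add, smul_add, hx.C, hy.C]⟩

theorem IsWt.const_smul {a : ℂ} {b : ℤ} {x : M} (hx : IsWt c q a b x) (r : ℂ) :
    IsWt c q a b (r • x) :=
  ⟨by rw [smul_comm, hx.L, smul_comm], by rw [smul_comm, hx.H, smul_comm],
    by rw [smul_comm _ r, hx.C, smul_comm]⟩

theorem IsWt.sum {ι : Type*} (s : Finset ι) {a : ℂ} {b : ℤ} {x : ι → M}
    (h : ∀ i ∈ s, IsWt c q a b (x i)) : IsWt c q a b (∑ i ∈ s, x i) := by
  classical
  induction s using Finset.induction_on with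
  | empty => exact IsWt.zero a b
  | insert i s hi ih =>
    rw [Finset.sum_insert hi]
    exact (h i (by simp)).add (ih fun j hj => h j (by simp [hj]))

/-- The largest submodule in the kernel of a functional. -/
def radical (f : M →ₗ[ℂ] ℂ[X]) : Submodule U M where
  carrier := {y | ∀ u : U, f (u • y) = 0}
  add_mem' ha hb u := by rw [smul_add, map_add, ha u, hb u, add_zero]
  zero_mem' u := by rw [smul_zero, map_zero]
  smul_mem' w y hy u := by rw [smul_smul]; exact hy _

/-- Among the terms with nonzero coefficient take those with the largest power of L_{-1}. Modulo
lower powers they give distinct ordered words, to which `eq_zero_of_vecL_mem` applies with the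
radical of f as submodule. -/
theorem coeff_eq_zero_of_mem_radical (hc : c ≠ 3) (hv : IsChiralVec c q v) (hf : IsWhittaker v f)
    {ι : Type*} [Fintype ι] {τ : ι → BasisTerm} (hτ : Function.Injective τ) {m : ℕ} {n : ℤ}
    (hmem : ∀ i, τ i ∈ CGQ m n) {a : ι → ℂ} (h : ∑ i, a i • (τ i).op • v ∈ radical f) :
    a = 0 := by
  classical
  by_contra hne
  obtain ⟨i₁, hi₁⟩ := Function.ne_iff.mp hne
  obtain ⟨i₀, hi₀, hmax⟩ := Finset.exists_max_image (Finset.univ.filter fun i => a i ≠ 0)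
    (fun i => (τ i).k) ⟨i₁, by simpa using hi₁⟩
  set K := (τ i₀).k with hK
  set b : WordSpace := ∑ i, (if (τ i).k = K then a i else 0) •
    Finsupp.single ((τ i).head ++ (τ i).tail) 1 with hb
  have h1 : ∑ i, a i • (τ i).op • v - vecL v K b ∈ fil v K := by
    rw [hb, map_sum, ← Finset.sum_sub_distrib]
    refine Submodule.sum_mem _ fun i _ => ?_
    rw [map_smul, vecL_single, one_smul]
    have h2 := BasisTerm.op_smul (v := v) (hmem i)
    by_cases hai : a i = 0
    · simp [hai]
    have h3 := hmax i (by simpa using hai)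
    split_ifs with hk
    · rw [← smul_sub, ← hk]
      exact Submodule.smul_mem _ _ h2
    · rw [zero_smul, sub_zero]
      refine Submodule.smul_mem _ _ ?_
      rw [← sub_add_cancel ((τ i).op • v) (vec v ((τ i).head ++ (τ i).tail) (τ i).k)]
      exact Submodule.add_mem _ (fil_mono h3 h2)
        (vec_mem_fil (BasisTerm.ordered (hmem i)).2 (by lia))
  have h2 : b = 0 := by
    refine eq_zero_of_vecL_mem hc hv hf (J := radical f) (k := K)
      (fun y hy => by simpa using hy 1) (fun w hw => ?_) ?_
    · have : b ∈ Finsupp.supported ℂ ℂ {w | Ordered w} :=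
        Submodule.sum_mem _ fun i _ => Submodule.smul_mem _ _
          (Finsupp.single_mem_supported ℂ 1 (BasisTerm.ordered (hmem i)))
      exact (Finsupp.mem_supported ℂ b).mp this hw
    · rw [← sub_sub_cancel (∑ i, a i • (τ i).op • v) (vecL v K b)]
      exact Submodule.sub_mem _ (Submodule.mem_sup_left h) (Submodule.mem_sup_right h1)
  have h3 := DFunLike.congr_fun h2 ((τ i₀).head ++ (τ i₀).tail)
  rw [hb, Finsupp.finsetSum_apply, Finset.sum_eq_single i₀] at h3
  · simp only [Finsupp.smul_apply, Finsupp.single_eq_same, ← hK, if_true] at h3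
    simp at h3
    simp [h3] at hi₀
  · intro i _ hi
    rw [Finsupp.smul_apply, Finsupp.single_apply, smul_eq_mul]
    split_ifs with h4 h5
    · exact absurd (hτ (BasisTerm.eq_of_letters_eq (hmem i) (hmem i₀) h4 h5)) hi
    all_goals simp
  · simp

/-- All terms outside N are separated simultaneously by the single functional `testFun f B`; the
ordering matters only in that the elements of N are minimal. -/
theorem isOrderingKernel_of_testFun (hc : c ≠ 3) (hv : IsChiralVec c q v) (hf : IsWhittaker v f)
    (hgen : ∀ y : M, ∃ u : U, u • v = y) (hAB : IsZeroModePair A B) {m : ℕ} {n : ℤ}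
    {N : Set BasisTerm} (hN : N ⊆ CGQ m n) (hmin : ∀ Y ∈ N, ∀ X ∈ CGQ m n, ¬ ltG X Y)
    (h0 : ∀ X ∈ CGQ m n \ N, testFun f B (X.op • v) = 0) :
    IsOrderingKernel ((posU ⊔ Submodule.span ℂ {gen A} : Submodule ℂ U) : Set U) BasisTerm.op v
      precG (CGQ m n) N := by
  classical
  refine ⟨CGQ m n \ N, ⟨?_, ?_, ?_, ?_, ?_, Set.sdiff_subset, ?_⟩, Set.sdiff_sdiff_cancel_left hN⟩
  · exact fun X _ => Or.inl rfl
  · intro X hX Y hY h h'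
    rw [precG_iff hX hY] at h
    rw [precG_iff hY hX] at h'
    exact BasisTerm.key_injOn m n hX hY (le_antisymm h' h)
  · intro X hX Y hY Z hZ h h'
    rw [precG_iff hX hY] at h
    rw [precG_iff hY hZ] at h'
    exact (precG_iff hX hZ).mpr (h'.trans h)
  · intro X hX Y hY
    rw [precG_iff hX hY, precG_iff hY hX]
    exact le_total _ _
  · intro hne
    obtain ⟨X, hX, hmax⟩ := Set.exists_max_image _ BasisTerm.key (finite_CGQ m n) hne
    exact ⟨X, hX, fun Y hY => (precG_iff hX hY).mpr (hmax Y hY)⟩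
  · intro X₀ hX₀
    have hfin : (CGQ m n \ N).Finite := (finite_CGQ m n).subset Set.sdiff_subset
    have : Fintype ↥(CGQ m n \ N) := hfin.fintype
    set K : Submodule ℂ U := posU ⊔ Submodule.span ℂ {gen A} with hK
    let T : K →ₗ[ℂ] (↥(CGQ m n \ N) → ℂ) := LinearMap.pi fun X =>
      testFun f B ∘ₗ ((LinearMap.toSpanSingleton U M (X.1.op • v)).restrictScalars ℂ) ∘ₗ K.subtype
    have hT : ∀ Γ X, T Γ X = testFun f B (Γ.1 • X.1.op • v) := fun _ _ => rfl
    -- A functional vanishing on the range gives coefficients a such that the test functional kills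
    -- K applied to the combination Σ a_X Xv. By `map_smul_eq_zero` this combination lies in the
    -- radical of f, so a = 0.
    have hsurj : LinearMap.range T = ⊤ := by
      by_contra hlt
      obtain ⟨g, hg, hle⟩ := Submodule.exists_le_ker_of_lt_top _ (lt_top_iff_ne_top.mpr hlt)
      set a : ↥(CGQ m n \ N) → ℂ := fun X => g fun Y => if X = Y then 1 else 0 with ha
      have hga : ∀ y, g y = ∑ X, y X * a X := fun y => LinearMap.pi_apply_eq_sum_univ g y
      have hwt : IsWt c q m n (∑ X, a X • X.1.op • v) :=
        IsWt.sum _ fun X _ => (hv.isWt_op X.2.1).const_smul _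
      have ha0 : a = 0 := by
        refine coeff_eq_zero_of_mem_radical hc hv hf Subtype.val_injective (fun X => X.2.1)
          fun u => map_smul_eq_zero hf hv hgen hAB hwt ?_ (fun Γ hΓ => ?_) u
        · rw [map_sum]
          exact Finset.sum_eq_zero fun X _ => by rw [map_smul, h0 X.1 X.2, smul_zero]
        · have h1 : g (T ⟨Γ, hΓ⟩) = 0 := hle ⟨_, rfl⟩
          rw [hga] at h1
          rw [Finset.smul_sum, map_sum, ← h1]
          refine Finset.sum_congr rfl fun X _ => ?_
          rw [smul_comm, map_smul, hT, smul_eq_mul, mul_comm]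
      refine hg (LinearMap.ext fun y => ?_)
      simp [hga, ha0]
    obtain ⟨Γ, hΓ⟩ : Pi.single (⟨X₀, hX₀⟩ : ↥(CGQ m n \ N)) (1 : ℂ) ∈ LinearMap.range T := by
      rw [hsurj]; trivial
    have hΓ' : ∀ X (hX : X ∈ CGQ m n \ N), testFun f B (Γ.1 • X.op • v) =
        if X = X₀ then 1 else 0 := by
      intro X hX
      rw [← hT Γ ⟨X, hX⟩, hΓ, Pi.single_apply]
      simp
    have h1 := hΓ' X₀ hX₀
    rw [if_pos rfl] at h1
    obtain ⟨ι, b, i, hb⟩ := exists_basis_repr (testFun f B) h1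
    refine ⟨Γ.1, Γ.2, ι, b, i, by simp [hb, h1], fun Y hY hXY hne => ?_⟩
    rw [hb]
    -- Nothing is known about the test functional on ΓYv for Y in N, but such Y cannot come after
    -- X₀.
    have hYN : Y ∉ N := fun hYN => hXY.elim (fun h => hne h.symm) (hmin Y hYN X₀ hX₀.1)
    rw [hΓ' Y ⟨hY, hYN⟩, if_neg hne]

/-- Any letter standing leftmost, apart from powers of L_{-1}, is killed by f, and it survives under
f ∘ B only if its bracket with B contains L_{-1}, that is, if it equals D. Then L_{-1} replaces D
and a further letter would again be killed. -/
theorem testFun_op_eq_zero (hf : IsWhittaker v f) {D : Gen} (hB : B.idx = 0) (hD : IsLetter D) (hD' : 4 ≤ D.kind)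
    (hBD : ∀ g, brv isT B g ≠ 0 → g = D) {m : ℕ} {n : ℤ} {X : BasisTerm} (hX : X ∈ CGQ m n)
    (h : ¬ (X.head = [] ∧ (X.tail = [] ∨ X.tail = [D]))) : testFun f B (X.op • v) = 0 := by
  have hlet := (BasisTerm.ordered hX).2
  have hcomm : ∀ z : Gen, z.idx < 0 → ∀ y, f (gen B • gen z • y) =
      sgn B z • f (gen z • gen B • y) + brv isT B z • (Polynomial.X * f y) := by
    intro z hz y
    rw [gen_smul_smul, map_add, LinearMap.map_smul, map_brv f, ← brv_isT_smul]
    congr 1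
    exact brv_congr fun g hg _ => hf.map_neg (by lia) y
  have hpow : ∀ k y, f (gen (.L (-1)) ^ k • y) = Polynomial.X ^ k * f y := by
    intro k y
    induction k with
    | zero => simp
    | succ k ih => rw [pow_succ', mul_smul, hf.map_t, ih, pow_succ', mul_assoc]
  have hpow' : ∀ k y, f (gen B • gen (.L (-1)) ^ k • y) = Polynomial.X ^ k * f (gen B • y) := by
    intro k y
    induction k with
    | zero => simp
    | succ k ih =>
      have h1 : brv isT B (.L (-1)) = 0 := by
        by_contra h1
        exact hD.2 (hBD _ h1).symm
      rw [pow_succ', mul_smul, hcomm _ (by decide), h1, zero_smul, add_zero, sgn_L_right, one_smul,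
        hf.map_t, ih, pow_succ', mul_assoc]
  have hcons : ∀ (g : Gen) (w : List Gen), wordU (g :: w) = gen g * wordU w := fun g w => by
    simp [wordU]
  rw [testFun_apply, BasisTerm.op_eq hX.2, mul_smul, mul_smul]
  rcases hh : X.head with _ | ⟨g, w⟩
  · have hnil : wordU [] = 1 := by simp [wordU]
    rw [hnil, one_smul, hpow, hpow']
    rcases ht : X.tail with _ | ⟨g, w⟩
    · exact absurd ⟨hh, Or.inl ht⟩ h
    · have hg : IsLetter g := hlet g (by simp [ht])
      rw [hcons, mul_smul, hcomm g hg.1, hf.map_letter g hg, hf.map_letter g hg]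
      by_cases hgD : brv isT B g = 0
      · simp [hgD]
      · obtain rfl := hBD g hgD
        rcases w with _ | ⟨g', w⟩
        · exact absurd ⟨hh, Or.inr ht⟩ h
        · rw [hcons, mul_smul, hf.map_letter g' (hlet g' (by simp [ht]))]
          simp
  · have hg : IsLetter g := hlet g (by simp [hh])
    have hgD : brv isT B g = 0 := by
      by_contra hgD
      obtain rfl := hBD g hgD
      obtain ⟨kL, kH, kG, kQ, -, -⟩ := BasisTerm.kind_of_mem hX
      have h1 : g ∈ X.head := by simp [hh]
      simp only [BasisTerm.head, List.mem_append] at h1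
      rcases h1 with ((h1 | h1) | h1) | h1
      · have := (kL g h1).1; lia
      · have := (kH g h1).1; lia
      · have := (kG g h1).1; lia
      · have := (kQ g h1).1; lia
    rw [hcons, mul_smul, hcomm g hg.1, hf.map_letter g hg, hf.map_letter g hg, hgD]
    simp

end

/-! ### The two ordering kernels. -/

theorem head_eq_nil {X : BasisTerm} :
    X.head = [] ↔ X.L = [] ∧ X.H = [] ∧ X.G = [] ∧ X.Q = [] := by
  simp [BasisTerm.head, part]

theorem mem_kernelG_of_letters {m : ℕ} {n : ℤ} {X : BasisTerm} (hX : X ∈ CGQ m n)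
    (h : X.head = []) (h' : X.tail = [] ∨ X.tail = [.G (-1)]) : X ∈ kernelG m n := by
  obtain ⟨L, H, G, Q, k, r1, r2, r3⟩ := X
  obtain ⟨rfl, rfl, rfl, rfl⟩ := head_eq_nil.mp h
  obtain ⟨⟨-, -, -, -, h1, h2, -, hm, hn⟩, h0⟩ := hX
  simp only at h0 h1 h2 hm hn
  subst h0
  interval_cases r1 <;> interval_cases r2 <;>
    (simp_all [BasisTerm.tail, kernelG, lowTerm]; try lia)

theorem mem_kernelQ_of_letters {m : ℕ} {n : ℤ} {X : BasisTerm} (hX : X ∈ CGQ m n)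
    (h : X.head = []) (h' : X.tail = [] ∨ X.tail = [.Q (-1)]) : X ∈ kernelQ m n := by
  obtain ⟨L, H, G, Q, k, r1, r2, r3⟩ := X
  obtain ⟨rfl, rfl, rfl, rfl⟩ := head_eq_nil.mp h
  obtain ⟨⟨-, -, -, -, h1, h2, -, hm, hn⟩, h0⟩ := hX
  simp only at h0 h1 h2 hm hn
  subst h0
  interval_cases r1 <;> interval_cases r2 <;>
    (simp_all [BasisTerm.tail, kernelQ, lowTerm]; try lia)

theorem mem_CGQ_of_mem_kernelG {m : ℕ} {n : ℤ} {X : BasisTerm} (hX : X ∈ kernelG m n) :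
    X ∈ CGQ m n ∧ ∃ k r1 r2, r1 + r2 ≤ 1 ∧ X = lowTerm k r1 r2 := by
  rcases hX with ⟨rfl, h, rfl⟩ | ⟨rfl, rfl⟩
  · refine ⟨?_, _, _, _, le_rfl, rfl⟩
    simpa [h] using lowTerm_mem_CGQ (m - 1) 1 0 le_rfl zero_le_one
  · refine ⟨?_, _, _, _, zero_le_one, rfl⟩
    simpa using lowTerm_mem_CGQ m 0 0 zero_le_one zero_le_one

theorem mem_CGQ_of_mem_kernelQ {m : ℕ} {n : ℤ} {X : BasisTerm} (hX : X ∈ kernelQ m n) :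
    X ∈ CGQ m n ∧ ∃ k r1 r2, r1 + r2 ≤ 1 ∧ X = lowTerm k r1 r2 := by
  rcases hX with ⟨rfl, rfl⟩ | ⟨rfl, h, rfl⟩
  · refine ⟨?_, _, _, _, zero_le_one, rfl⟩
    simpa using lowTerm_mem_CGQ m 0 0 zero_le_one zero_le_one
  · refine ⟨?_, _, _, _, le_rfl, rfl⟩
    simpa [h] using lowTerm_mem_CGQ (m - 1) 0 1 zero_le_one le_rfl

theorem ket_generates (c q : ℂ) (y : ChiralVerma c q) : ∃ u : U, u • ket c q = y := by
  obtain ⟨u, rfl⟩ := (chiralIdeal c q).mkQ_surjective y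
  exact ⟨u, by rw [ket, ← map_smul, smul_eq_mul, mul_one]⟩

theorem isOrderingKernel_kernelG {c q : ℂ} (hc : c ≠ 3) (m : ℕ) (n : ℤ) :
    IsOrderingKernel (annG : Set U) BasisTerm.op (ket c q) precG (CGQ m n) (kernelG m n) := by
  obtain ⟨f, h1, h2, h3⟩ := exists_whittaker c q
  have hf : IsWhittaker (ket c q) f := ⟨h1, h2, fun g hg => h3 g hg.1 hg.2⟩
  refine isOrderingKernel_of_testFun hc (isChiralVec_ket c q) hf (ket_generates c q)
    isZeroModePair_GQ (fun X hX => (mem_CGQ_of_mem_kernelG hX).1) (fun Y hY X hX => ?_)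
    fun X hX => ?_
  · obtain ⟨hY', k, r1, r2, hr, rfl⟩ := mem_CGQ_of_mem_kernelG hY
    exact not_ltG_lowTerm hr hY' hX
  · refine testFun_op_eq_zero hf (D := .G (-1)) rfl ⟨by decide, by simp⟩ (by decide)
      (fun g hg => ?_) hX.1 fun h => hX.2 (mem_kernelG_of_letters hX.1 h.1 h.2)
    rcases g with m | m | m | m | _ <;> simp [brv, isT] at hg
    exact congrArg _ hg

theorem isOrderingKernel_kernelQ {c q : ℂ} (hc : c ≠ 3) (m : ℕ) (n : ℤ) :
    IsOrderingKernel (annQ : Set U) BasisTerm.op (ket c q) precG (CGQ m n) (kernelQ m n) := by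
  obtain ⟨f, h1, h2, h3⟩ := exists_whittaker c q
  have hf : IsWhittaker (ket c q) f := ⟨h1, h2, fun g hg => h3 g hg.1 hg.2⟩
  refine isOrderingKernel_of_testFun hc (isChiralVec_ket c q) hf (ket_generates c q)
    isZeroModePair_QG (fun X hX => (mem_CGQ_of_mem_kernelQ hX).1) (fun Y hY X hX => ?_)
    fun X hX => ?_
  · obtain ⟨hY', k, r1, r2, hr, rfl⟩ := mem_CGQ_of_mem_kernelQ hY
    exact not_ltG_lowTerm hr hY' hX
  · refine testFun_op_eq_zero hf (D := .Q (-1)) rfl ⟨by decide, by simp⟩ (by decide)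
      (fun g hg => ?_) hX.1 fun h => hX.2 (mem_kernelQ_of_letters hX.1 h.1 h.2)
    rcases g with m | m | m | m | _ <;> simp [brv, isT] at hg
    exact congrArg _ hg

end TopN2

theorem mainTheorem3 (c q : ℂ) (hc : c ≠ 3) (m : ℕ) (n : ℤ) :
    TopN2.IsOrderingKernel (TopN2.annG : Set TopN2.U) TopN2.BasisTerm.op (TopN2.ket c q)
        TopN2.precG (TopN2.CGQ m n) (TopN2.kernelG m n) ∧
      TopN2.IsOrderingKernel (TopN2.annQ : Set TopN2.U) TopN2.BasisTerm.op (TopN2.ket c q)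
        TopN2.precG (TopN2.CGQ m n) (TopN2.kernelQ m n) :=
  ⟨TopN2.isOrderingKernel_kernelG hc m n, TopN2.isOrderingKernel_kernelQ hc m n⟩
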